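/- Let $X$ be a finite non-empty set with $n$ elements. A \emph{distance} on $X$ is a symmetric map $D:X\times X\to\mathbb{R}_{\ge 0}$ with $D(x,x)=0$ for all $x\in X$. A \emph{split} $A|B$ of $X$ is an unordered bipartition of $X$ into two non-empty subsets; put $D_{A|B}(x,y)=1$ if $|A\cap\{x,y\}|=|B\cap\{x,y\}|=1$ and $D_{A|B}(x,y)=0$ otherwise. A distance $D$ is \emph{circular} if $D=\sum_{S\in\mathcal S}\omega(S)\,D_S$ for some set $\mathcal S$ of splits of $X$ with weights $\omega(S)\ge 0$, such that for some ordering $x_1,\dots,x_n$ of the elements of $X$ every $S\in\mathcal S$ is of the form $\{x_i,x_{i+1},\dots,x_j\}\,|\,X\setminus\{x_i,x_{i+1},\dots,x_j\}$ with $1\le i\le j<n$ (the ordering, $\mathcal S$ and $\omega$ are not part of the input below). For $u\ne v$ in $X$ let $X_{u,v}=\{x\in X: D(u,x)<D(v,x)\}$ and $E_{\{u,v\}}=\{x\in X: D(u,x)=D(v,x)\}$. For real numbers $q\ge\frac p2>0$ the \emph{order distance} of $D$ is $$O_{p,q}(D)=\sum_{\substack{(u,v)\in X\times X,\ u\ne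 v\\ \emptyset\subsetneq X_{u,v}\subsetneq X}}\frac p2\, D_{X_{u,v}|X\setminus X_{u,v}}\;+\sum_{\substack{\{u,v\}\in\binom X2\\ \emptyset\subsetneq E_{\{u,v\}}\subsetneq X}}\Bigl(q-\frac p2\Bigr) D_{E_{\{u,v\}}|X\setminus E_{\{u,v\}}}.$$ \textbf{Theorem.} The order distance $O_{p,\frac p2}(D)$ of a circular distance $D$ on a set with $n$ elements can be computed in $\mathcal{O}(n^2\log n)$ time. Here time is counted on a unit-cost real RAM: there is one fixed program which, for every $n\ge 1$, every real $p>0$ and every circular distance $D$ on an $n$-element set with any enumeration $y_1,\dots,y_n$ of that set, when given $n$, $p$ and the matrix $(D(y_i,y_j))_{i,j}$, halts after at most $T(n)$ steps with the matrix $(O_{p,\frac p2}(D)(y_i,y_j))_{i,j}$ in its output array, where $T(n)=\mathcal{O}(n^2\log n)$ depends only on $n$. The program operates on memory cells (registers and randomly accessed arrays) holding exact real numbers, with rational constants, $+$, $-$, $\times$ and comparisons, and on memory cells holding natural numbers, used as array indices, with $+$, truncated $-$, $\times$, halving and comparisons; each operation, memory access, test and assignment costs at least one step; there is no conversion between reals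 and natural numbers, and the natural-number operations and constants never exceed $(n+2)^k$ for some constant $k$ (that is, index words have $\mathcal{O}(\log n)$ bits). -/

import Mathlib

open Filter Asymptotics

namespace OrderDist

/-! ### Distances, splits and the order distance -/

section Combinatorics

variable {X : Type*} [Fintype X] [DecidableEq X]

/-- A distance on `X`: symmetric, zero on the diagonal and non-negative
(no triangle inequality, and distinct points may have distance zero). -/
structure IsDistance (D : X → X → ℝ) : Prop where
  symm : ∀ x y, D x y = D y x
  self : ∀ x, D x x = 0
  nonneg : ∀ x y, 0 ≤ D x y

/-- A split of `X`: an unordered bipartition `{A, Aᶜ}` of `X` into two non-empty parts. -/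
structure Split (X : Type*) [Fintype X] [DecidableEq X] where
  parts : Finset (Finset X)
  isBipartition : ∃ A : Finset X, A.Nonempty ∧ Aᶜ.Nonempty ∧ parts = {A, Aᶜ}

/-- The distance of a bipartition given by its set of parts: it is `1` at `(x, y)` if
`{x, y}` meets every part in exactly one element, and `0` otherwise. -/
def partsDist (P : Finset (Finset X)) (x y : X) : ℝ :=
  if ∀ A ∈ P, (A ∩ {x, y}).card = 1 then 1 else 0

/-- The distance generated by a weighted split system. -/
noncomputable def generatedDist (𝒮 : Finset (Split X)) (ω : Split X → ℝ) (x y : X) : ℝ :=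
  ∑ S ∈ 𝒮, ω S * partsDist S.parts x y

/-- The split system `𝒮` fits on the ordering `θ`: each of its splits separates a segment
`θ i, θ (i+1), …, θ j` that does not contain the last element from the rest. -/
def FitsOn (𝒮 : Finset (Split X)) (θ : Fin (Fintype.card X) ≃ X) : Prop :=
  ∀ S ∈ 𝒮, ∃ i j : Fin (Fintype.card X), i ≤ j ∧ (j : ℕ) + 1 < Fintype.card X ∧
    S.parts = {(Finset.Icc i j).map θ.toEmbedding, ((Finset.Icc i j).map θ.toEmbedding)ᶜ}

/-- A split system is circular if it fits on some ordering of the elements. -/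
def IsCircular (𝒮 : Finset (Split X)) : Prop :=
  ∃ θ : Fin (Fintype.card X) ≃ X, FitsOn 𝒮 θ

/-- A distance is circular if a circular split system with a non-negative weighting
generates it. -/
def IsCircularDistance (D : X → X → ℝ) : Prop :=
  IsDistance D ∧ ∃ (𝒮 : Finset (Split X)) (ω : Split X → ℝ),
    IsCircular 𝒮 ∧ (∀ S ∈ 𝒮, 0 ≤ ω S) ∧ D = generatedDist 𝒮 ω

open Classical in
/-- `X_{u,v}`: the elements strictly closer to `u` than to `v`. -/
noncomputable def closer (D : X → X → ℝ) (u v : X) : Finset X :=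
  Finset.univ.filter fun x => D u x < D v x

theorem mem_closer {Y : Type*} [Fintype Y] (D : Y → Y → ℝ) (u v x : Y) :
    x ∈ closer D u v ↔ D u x < D v x := by
  simp [closer]

open Classical in
/-- `E_{e}` for a 2-element set `e = {u, v}`: the elements with the same distance to `u`
and to `v`. -/
noncomputable def equidistant (D : X → X → ℝ) (e : Finset X) : Finset X :=
  Finset.univ.filter fun x => ∀ u ∈ e, ∀ v ∈ e, D u x = D v x

theorem mem_equidistant (D : X → X → ℝ) (e : Finset X) (x : X) :
    x ∈ equidistant D e ↔ ∀ u ∈ e, ∀ v ∈ e, D u x = D v x := by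
  simp [equidistant]

open Classical in
/-- The order distance `O_{p,q}(D)`: a sum over all ordered pairs `(u, v)` of distinct elements
with `∅ ⊊ X_{u,v} ⊊ X`, plus a sum over all 2-element sets `e` with `∅ ⊊ E_e ⊊ X`. -/
noncomputable def orderDistance (p q : ℝ) (D : X → X → ℝ) (x y : X) : ℝ :=
  (∑ w ∈ Finset.univ.filter (fun w : X × X =>
      w.1 ≠ w.2 ∧ ∅ ⊂ closer D w.1 w.2 ∧ closer D w.1 w.2 ⊂ Finset.univ),
    p / 2 * partsDist {closer D w.1 w.2, (closer D w.1 w.2)ᶜ} x y) +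
  ∑ e ∈ ((Finset.univ : Finset X).powersetCard 2).filter (fun e =>
      ∅ ⊂ equidistant D e ∧ equidistant D e ⊂ Finset.univ),
    (q - p / 2) * partsDist {equidistant D e, (equidistant D e)ᶜ} x y

end Combinatorics

/-! ### The machine model: a real RAM with bounded index words

Programs are structured imperative programs over a memory that holds natural numbers (words,
used for indexing) and exact real numbers, in scalar registers and in random-access arrays.
Names of registers and arrays are fixed by the program; array positions are computed at run time.
Every operation, memory access, test and assignment costs one unit. There is no conversion between
reals and words, and no operation may produce a word larger than the word bound `W`. -/

/-- The memory of the machine. -/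
structure Memory where
  /-- word registers -/
  wreg : ℕ → ℕ
  /-- word arrays: array name, then position -/
  warr : ℕ → ℕ → ℕ
  /-- real registers -/
  rreg : ℕ → ℝ
  /-- real arrays: array name, then position -/
  rarr : ℕ → ℕ → ℝ

namespace Memory

/-- Write `v` to word register `x`. -/
def setW (s : Memory) (x v : ℕ) : Memory :=
  { s with wreg := Function.update s.wreg x v }

/-- Write `v` to position `i` of word array `a`. -/
def storeW (s : Memory) (a i v : ℕ) : Memory :=
  { s with warr := Function.update s.warr a (Function.update (s.warr a) i v) }

/-- Write `v` to real register `x`. -/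
def setR (s : Memory) (x : ℕ) (v : ℝ) : Memory :=
  { s with rreg := Function.update s.rreg x v }

/-- Write `v` to position `i` of real array `a`. -/
def storeR (s : Memory) (a i : ℕ) (v : ℝ) : Memory :=
  { s with rarr := Function.update s.rarr a (Function.update (s.rarr a) i v) }

end Memory

/-- Expressions for words. -/
inductive WExp where
  | const (c : ℕ)
  | reg (x : ℕ)
  | arr (a : ℕ) (i : WExp)
  | add (e f : WExp)
  | sub (e f : WExp)
  | mul (e f : WExp)
  | half (e : WExp)

namespace WExp

/-- The value of a word expression (subtraction is truncated, `half` rounds down). -/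
def eval (s : Memory) : WExp → ℕ
  | const c => c
  | reg x => s.wreg x
  | arr a i => s.warr a (i.eval s)
  | add e f => e.eval s + f.eval s
  | sub e f => e.eval s - f.eval s
  | mul e f => e.eval s * f.eval s
  | half e => e.eval s / 2

/-- No operation in the expression exceeds the word bound `W`. The operations that are not
tested cannot increase the largest word in use. -/
def Fits (W : ℕ) (s : Memory) : WExp → Prop
  | const c => c ≤ W
  | reg _ => True
  | arr _ i => i.Fits W s
  | add e f => e.Fits W s ∧ f.Fits W s ∧ e.eval s + f.eval s ≤ W
  | sub e f => e.Fits W s ∧ f.Fits W s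
  | mul e f => e.Fits W s ∧ f.Fits W s ∧ e.eval s * f.eval s ≤ W
  | half e => e.Fits W s

/-- The number of operations and memory accesses in the expression. -/
def cost : WExp → ℕ
  | const _ => 1
  | reg _ => 1
  | arr _ i => i.cost + 1
  | add e f => e.cost + f.cost + 1
  | sub e f => e.cost + f.cost + 1
  | mul e f => e.cost + f.cost + 1
  | half e => e.cost + 1

end WExp

/-- Expressions for reals: rational constants, memory, and the ring operations. -/
inductive RExp where
  | const (c : ℚ)
  | reg (x : ℕ)
  | arr (a : ℕ) (i : WExp)
  | add (e f : RExp)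
  | sub (e f : RExp)
  | mul (e f : RExp)

namespace RExp

/-- The value of a real expression. -/
noncomputable def eval (s : Memory) : RExp → ℝ
  | const c => (c : ℝ)
  | reg x => s.rreg x
  | arr a i => s.rarr a (i.eval s)
  | add e f => e.eval s + f.eval s
  | sub e f => e.eval s - f.eval s
  | mul e f => e.eval s * f.eval s

/-- All positions computed in the expression respect the word bound. -/
def Fits (W : ℕ) (s : Memory) : RExp → Prop
  | const _ => True
  | reg _ => True
  | arr _ i => i.Fits W s
  | add e f => e.Fits W s ∧ f.Fits W s
  | sub e f => e.Fits W s ∧ f.Fits W s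
  | mul e f => e.Fits W s ∧ f.Fits W s

/-- The number of operations and memory accesses in the expression. -/
def cost : RExp → ℕ
  | const _ => 1
  | reg _ => 1
  | arr _ i => i.cost + 1
  | add e f => e.cost + f.cost + 1
  | sub e f => e.cost + f.cost + 1
  | mul e f => e.cost + f.cost + 1

end RExp

/-- Tests. -/
inductive Test where
  | wle (e f : WExp)
  | rle (e f : RExp)
  | neg (b : Test)
  | conj (b c : Test)

namespace Test

/-- The test succeeds in memory `s`. -/
def Holds (s : Memory) : Test → Prop
  | wle e f => e.eval s ≤ f.eval s
  | rle e f => e.eval s ≤ f.eval s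
  | neg b => ¬ b.Holds s
  | conj b c => b.Holds s ∧ c.Holds s

/-- All words computed in the test respect the word bound. -/
def Fits (W : ℕ) (s : Memory) : Test → Prop
  | wle e f => e.Fits W s ∧ f.Fits W s
  | rle e f => e.Fits W s ∧ f.Fits W s
  | neg b => b.Fits W s
  | conj b c => b.Fits W s ∧ c.Fits W s

/-- The cost of evaluating the test. -/
def cost : Test → ℕ
  | wle e f => e.cost + f.cost + 1
  | rle e f => e.cost + f.cost + 1
  | neg b => b.cost + 1
  | conj b c => b.cost + c.cost + 1

end Test

/-- Programs. -/
inductive Prog where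
  | skip
  | setW (x : ℕ) (e : WExp)
  | storeW (a : ℕ) (i e : WExp)
  | setR (x : ℕ) (e : RExp)
  | storeR (a : ℕ) (i : WExp) (e : RExp)
  | seq (c d : Prog)
  | cond (b : Test) (c d : Prog)
  | loop (b : Test) (c : Prog)

/-- `Exec W c s s' t`: under the word bound `W`, the program `c` started in memory `s` halts in
memory `s'` after exactly `t` steps. A program that exceeds the word bound has no execution.
`loop b c` repeats `c` as long as `b` holds. -/
inductive Exec (W : ℕ) : Prog → Memory → Memory → ℕ → Prop
  | skip (s : Memory) : Exec W .skip s s 1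
  | setW (s : Memory) (x : ℕ) (e : WExp) (he : e.Fits W s) :
      Exec W (.setW x e) s (s.setW x (e.eval s)) (e.cost + 1)
  | storeW (s : Memory) (a : ℕ) (i e : WExp) (hi : i.Fits W s) (he : e.Fits W s) :
      Exec W (.storeW a i e) s
        (s.storeW a (i.eval s) (e.eval s)) (i.cost + e.cost + 1)
  | setR (s : Memory) (x : ℕ) (e : RExp) (he : e.Fits W s) :
      Exec W (.setR x e) s (s.setR x (e.eval s)) (e.cost + 1)
  | storeR (s : Memory) (a : ℕ) (i : WExp) (e : RExp) (hi : i.Fits W s) (he : e.Fits W s) :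
      Exec W (.storeR a i e) s
        (s.storeR a (i.eval s) (e.eval s)) (i.cost + e.cost + 1)
  | seq {c d : Prog} {s s' s'' : Memory} {t t' : ℕ}
      (hc : Exec W c s s' t) (hd : Exec W d s' s'' t') : Exec W (.seq c d) s s'' (t + t')
  | condTrue {b : Test} {c d : Prog} {s s' : Memory} {t : ℕ} (hf : b.Fits W s) (hb : b.Holds s)
      (hc : Exec W c s s' t) : Exec W (.cond b c d) s s' (b.cost + 1 + t)
  | condFalse {b : Test} {c d : Prog} {s s' : Memory} {t : ℕ} (hf : b.Fits W s)
      (hb : ¬ b.Holds s) (hd : Exec W d s s' t) : Exec W (.cond b c d) s s' (b.cost + 1 + t)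
  | loopDone {b : Test} {c : Prog} {s : Memory} (hf : b.Fits W s) (hb : ¬ b.Holds s) :
      Exec W (.loop b c) s s (b.cost + 1)
  | loopStep {b : Test} {c : Prog} {s s' s'' : Memory} {t t' : ℕ} (hf : b.Fits W s)
      (hb : b.Holds s) (hc : Exec W c s s' t) (hl : Exec W (.loop b c) s' s'' t') :
      Exec W (.loop b c) s s'' (b.cost + 1 + t + t')

/-- The initial memory for the input `(n, p, M)` with `M` an `n × n` matrix: word register `0`
holds `n`, real register `0` holds `p`, real array `0` holds `M` row by row, and all other cells
hold zero. -/
noncomputable def inputMemory (n : ℕ) (p : ℝ) (M : Fin n → Fin n → ℝ) : Memory where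
  wreg x := if x = 0 then n else 0
  warr _ _ := 0
  rreg x := if x = 0 then p else 0
  rarr a m :=
    if h : a = 0 ∧ m / n < n ∧ m % n < n then M ⟨m / n, h.2.1⟩ ⟨m % n, h.2.2⟩ else 0

/-- In memory `s`, real array `1` holds the `n × n` matrix `M` row by row. -/
def HoldsOutput {n : ℕ} (s : Memory) (M : Fin n → Fin n → ℝ) : Prop :=
  ∀ i j : Fin n, s.rarr 1 ((i : ℕ) * n + (j : ℕ)) = M i j

end OrderDist

/-!
The order distance with `q = p / 2` counts, with weight `p / 2`, the ordered pairs `(u, v)` for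
which exactly one of `x` and `y` is nearer to `u` than to `v` (`orderDistance_half`). For a circular
distance it is computed in two stages: a circular ordering is found in `O(n ^ 2)` steps, and given
the ordering, all bisectors together are processed in `O(n ^ 2 log n)` steps.

**Finding a circular ordering.** Fix an element `r`. For the Gromov product
`G x y = D r x + D r y - D x y`, a linear order is a circular ordering of `D`, cut open somewhere,
as soon as it makes `G` Robinsonian and satisfies one more four-point inequality (`Valid`,
`Valid.kalmanson`); circular distances satisfy the Kalmanson inequalities and hence have valid
orders (`IsCircularDistance.exists_valid`).

The algorithm keeps an ordered partition that is compatible with some valid order. Elements outside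
a class refine it, in the direction forced by the Robinson property (`OrderInv.refine`). When no
further refinement is possible, every class is a module: its elements are not distinguished from
outside. Inside a module, any valid order of the module may be substituted (`Valid.substitute`), so
that it is enough to know one element that is first in some valid order of the module. Such an
element is the last one of a similarity-first search (`SearchOrder.exists_valid_first`), and since a
search order of the whole set restricts to a search order of each module (`SearchOrder.of_module`),
one search at the beginning, itself a partition refinement, serves all modules.

Refining naively by all pivots would be too expensive. Instead, each time a class is divided into
two parts, an event is put into a queue, and when the event is processed, the elements on either
side of the cut refine the classes on the other side. This takes a number of steps proportional to
the number of pairs separated by the cut, and each pair is separated by at most one event, so that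
these steps add up to `O(n ^ 2)`. The new classes cost `O(n)` steps each, `O(n ^ 2)` in total.

**Summing up the bisectors.** In a circular ordering, the function `D u x - D v x` increases along
the arc from `u` to `v` and decreases along the arc from `v` back to `u`, so that the elements
nearer to `u` form an arc (`CircularMetric.cut_iff`). Two binary searches find the cuts at its ends.
The cuts are recorded in an `n × n` matrix. The indicator of the pairs separated by a bisector obeys
a recursion from shorter to longer intervals (`CircularMetric.bisects_recursion`) that is linear in
this matrix. Hence the sums over all bisectors obey it too, and one pass of dynamic programming
over the summed matrix yields the output.

Programs are reasoned about by the weakest-precondition predicate `Runs`, which bounds the number of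
steps along with the final memory, and by the frame property `Exec.frame`: cells that a program does
not mention as targets are unchanged.
-/

set_option linter.unusedSimpArgs false
set_option linter.unnecessarySeqFocus false

namespace OrderDist

/-! ### Seriation orders of a similarity -/

/-- `R` is a strict total order on `M` that makes the similarity `G` Robinsonian (`rob`) and
satisfies the second Kalmanson inequality (`kal`). For `G = gromov d r` these two inequalities
say that `R`, closed up to a cycle, is a circular ordering of `d`. -/
structure Valid {α : Type*} (G : α → α → ℝ) (M : Finset α) (R : α → α → Prop) : Prop where
  irrefl : ∀ x ∈ M, ¬ R x x
  trans : ∀ x ∈ M, ∀ y ∈ M, ∀ z ∈ M, R x y → R y z → R x z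
  total : ∀ x ∈ M, ∀ y ∈ M, x ≠ y → R x y ∨ R y x
  rob : ∀ x ∈ M, ∀ y ∈ M, ∀ z ∈ M, R x y → R y z → G x z ≤ G x y ∧ G x z ≤ G y z
  kal : ∀ x ∈ M, ∀ y ∈ M, ∀ z ∈ M, ∀ w ∈ M, R x y → R y z → R z w →
    G x z + G y w ≤ G x w + G y z

/-- `rank` lists the elements of `M` in a similarity-first search order: if `x` comes before `y`,
then the vector of similarities of `x` to the elements listed before it is lexicographically at
least that of `y`. -/
def SearchOrder {α : Type*} (G : α → α → ℝ) (rank : α → ℕ) (M : Finset α) : Prop :=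
  ∀ x ∈ M, ∀ y ∈ M, rank x < rank y →
    (∀ v ∈ M, rank v < rank x → G v x = G v y) ∨
    ∃ v ∈ M, rank v < rank x ∧ G v y < G v x ∧ ∀ v' ∈ M, rank v' < rank v → G v' x = G v' y

section Orders

variable {α : Type*} {G : α → α → ℝ} {M N : Finset α} {R R' : α → α → Prop}

theorem Valid.asymm (h : Valid G M R) {x y : α} (hx : x ∈ M) (hy : y ∈ M) (hxy : R x y) :
    ¬ R y x := fun hyx => h.irrefl x hx (h.trans x hx y hy x hx hxy hyx)

theorem Valid.mono (h : Valid G M R) (hN : N ⊆ M) : Valid G N R where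
  irrefl x hx := h.irrefl x (hN hx)
  trans x hx y hy z hz := h.trans x (hN hx) y (hN hy) z (hN hz)
  total x hx y hy := h.total x (hN hx) y (hN hy)
  rob x hx y hy z hz := h.rob x (hN hx) y (hN hy) z (hN hz)
  kal x hx y hy z hz w hw := h.kal x (hN hx) y (hN hy) z (hN hz) w (hN hw)

theorem Valid.flip (hG : ∀ x y, G x y = G y x) (h : Valid G M R) :
    Valid G M (fun x y => R y x) where
  irrefl x hx := h.irrefl x hx
  trans x hx y hy z hz hxy hyz := h.trans z hz y hy x hx hyz hxy
  total x hx y hy hxy := h.total y hy x hx (Ne.symm hxy)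
  rob x hx y hy z hz hxy hyz := by
    have := h.rob z hz y hy x hx hyz hxy
    rw [hG x z, hG x y, hG y z]
    exact ⟨this.2, this.1⟩
  kal x hx y hy z hz w hw hxy hyz hzw := by
    have := h.kal w hw z hz y hy x hx hzw hyz hxy
    rw [hG x z, hG y w, hG x w, hG y z]
    linarith

/-- An interval `N` of a valid order that is a module (the elements outside do not distinguish its
elements) may be reordered by any order that is valid on `N`. -/
theorem Valid.substitute (hG : ∀ x y, G x y = G y x) (h : Valid G M R) (hN : N ⊆ M)
    (hint : ∀ x ∈ N, ∀ y ∈ M, ∀ z ∈ N, R x y → R y z → y ∈ N)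
    (hmod : ∀ v ∈ M, v ∉ N → ∀ x ∈ N, ∀ y ∈ N, G v x = G v y) (h' : Valid G N R') :
    Valid G M (fun x y => (x ∈ N ∧ y ∈ N ∧ R' x y) ∨ (¬ (x ∈ N ∧ y ∈ N) ∧ R x y)) := by
  -- An element outside of `N` has all of `N` on the same side.
  have left : ∀ x ∈ N, ∀ y ∈ M, y ∉ N → R x y → ∀ z ∈ N, R z y := by
    intro x hx y hy hyN hxy z hz
    rcases h.total z (hN hz) y hy (fun e => hyN (e ▸ hz)) with h1 | h1
    · exact h1
    · exact absurd (hint x hx y hy z hz hxy h1) hyN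
  have right : ∀ x ∈ N, ∀ y ∈ M, y ∉ N → R y x → ∀ z ∈ N, R y z := by
    intro x hx y hy hyN hxy z hz
    rcases h.total z (hN hz) y hy (fun e => hyN (e ▸ hz)) with h1 | h1
    · exact absurd (hint z hz y hy x hx h1 hxy) hyN
    · exact h1
  have hmod' : ∀ v ∈ M, v ∉ N → ∀ x ∈ N, ∀ y ∈ N, G x v = G y v := by
    intro v hv hvN x hx y hy
    rw [hG x v, hG y v]; exact hmod v hv hvN x hx y hy
  refine ⟨?_, ?_, ?_, ?_, ?_⟩
  · rintro x hx (⟨a, b, c⟩ | ⟨a, c⟩)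
    · exact h'.irrefl x a c
    · exact h.irrefl x hx c
  · rintro x hx y hy z hz (⟨a, b, c⟩ | ⟨a, c⟩) (⟨a', b', c'⟩ | ⟨a', c'⟩)
    · exact Or.inl ⟨a, b', h'.trans x a y b z b' c c'⟩
    · have hzN : z ∉ N := fun e => a' ⟨b, e⟩
      exact Or.inr ⟨fun e => hzN e.2, left y b z hz hzN c' x a⟩
    · have hxN : x ∉ N := fun e => a ⟨e, a'⟩
      exact Or.inr ⟨fun e => hxN e.1, right y a' x hx hxN c z b'⟩
    · refine Or.inr ⟨?_, h.trans x hx y hy z hz c c'⟩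
      rintro ⟨e1, e2⟩
      exact a ⟨e1, hint x e1 y hy z e2 c c'⟩
  · intro x hx y hy hxy
    by_cases e : x ∈ N ∧ y ∈ N
    · rcases h'.total x e.1 y e.2 hxy with h1 | h1
      · exact Or.inl (Or.inl ⟨e.1, e.2, h1⟩)
      · exact Or.inr (Or.inl ⟨e.2, e.1, h1⟩)
    · rcases h.total x hx y hy hxy with h1 | h1
      · exact Or.inl (Or.inr ⟨e, h1⟩)
      · exact Or.inr (Or.inr ⟨fun e' => e e'.symm, h1⟩)
  · rintro x hx y hy z hz (⟨a, b, c⟩ | ⟨a, c⟩) (⟨a', b', c'⟩ | ⟨a', c'⟩)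
    · exact h'.rob x a y b z b' c c'
    · have hzN : z ∉ N := fun e => a' ⟨b, e⟩
      -- `x` and `y` may be in the wrong order for `R`, but `z` does not distinguish them.
      have e1 := hmod' z hz hzN x a y b
      refine ⟨?_, e1.le⟩
      rcases h.total x hx y hy (fun e => h'.irrefl x a (by subst e; exact c)) with h1 | h1
      · exact (h.rob x hx y hy z hz h1 c').1
      · rw [e1, hG x y]
        exact (h.rob y hy x hx z hz h1 (left y b z hz hzN c' x a)).1
    · have hxN : x ∉ N := fun e => a ⟨e, a'⟩
      have e1 := hmod x hx hxN y a' z b'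
      refine ⟨e1.symm.le, ?_⟩
      rcases h.total y hy z hz (fun e => h'.irrefl y a' (by subst e; exact c')) with h1 | h1
      · exact (h.rob x hx y hy z hz c h1).2
      · rw [← e1, hG y z]
        exact (h.rob x hx z hz y hy (right y a' x hx hxN c z b') h1).2
    · exact h.rob x hx y hy z hz c c'
  · rintro x hx y hy z hz w hw hxy hyz hzw
    by_cases xN : x ∈ N <;> by_cases yN : y ∈ N <;> by_cases zN : z ∈ N <;> by_cases wN : w ∈ N
    all_goals simp only [xN, yN, zN, wN, true_and, false_and, and_false, and_true, not_true,
      not_false_eq_true, or_false, false_or] at hxy hyz hzw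
    · exact h'.kal x xN y yN z zN w wN hxy hyz hzw
    · rw [hmod' w hw wN x xN y yN]
      have := (h'.rob x xN y yN z zN hxy hyz).2
      linarith
    · exact absurd (hint y yN z hz w wN hyz hzw) zN
    · have e1 := hmod' z hz zN x xN y yN
      have e2 := hmod' w hw wN x xN y yN
      linarith
    · exact absurd (hint x xN y hy z zN hxy hyz) yN
    · exact absurd (hint x xN y hy z zN hxy hyz) yN
    · have := h.trans y hy z hz w hw hyz hzw
      exact absurd (hint x xN y hy w wN hxy this) yN
    · exact h.kal x hx y hy z hz w hw hxy hyz hzw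
    · rw [hmod x hx xN z zN w wN]
      have := (h'.rob y yN z zN w wN hyz hzw).1
      linarith
    · have e1 := hmod' w hw wN y yN z zN
      -- the module `{y, z}` may be swapped
      rcases h.total y hy z hz (fun e => h'.irrefl y yN (by subst e; exact hyz)) with h1 | h1
      · exact h.kal x hx y hy z hz w hw hxy h1 hzw
      · have e2 := hmod x hx xN y yN z zN
        have := h.kal x hx z hz y hy w hw (right y yN x hx xN hxy z zN) h1
          (left z zN w hw wN hzw y yN)
        rw [hG z y] at this
        linarith
    · exact absurd (hint y yN z hz w wN hyz hzw) zN
    · exact h.kal x hx y hy z hz w hw hxy hyz hzw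
    · have e1 := hmod x hx xN z zN w wN
      have e2 := hmod y hy yN z zN w wN
      linarith
    · exact h.kal x hx y hy z hz w hw hxy hyz hzw
    · exact h.kal x hx y hy z hz w hw hxy hyz hzw
    · exact h.kal x hx y hy z hz w hw hxy hyz hzw

theorem SearchOrder.of_module {rank : α → ℕ} (h : SearchOrder G rank M) (hN : N ⊆ M)
    (hmod : ∀ v ∈ M, v ∉ N → ∀ x ∈ N, ∀ y ∈ N, G v x = G v y) : SearchOrder G rank N := by
  intro x hx y hy hxy
  rcases h x (hN hx) y (hN hy) hxy with h1 | ⟨v, hv, hvx, hlt, heq⟩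
  · exact Or.inl fun v hv => h1 v (hN hv)
  · refine Or.inr ⟨v, ?_, hvx, hlt, fun v' hv' => heq v' (hN hv')⟩
    by_contra hvN
    exact hlt.ne' (hmod v hv hvN x hx y hy)

/-- The set of elements not listed before time `t` that the elements listed before time `t` do
not distinguish from `z`. -/
def lastClass {α : Type*} (G : α → α → ℝ) (rank : α → ℕ) (M : Finset α) (z : α) (t : ℕ) : Set α :=
  {y | y ∈ M ∧ t ≤ rank y ∧ ∀ v ∈ M, rank v < t → G v y = G v z}

/-- In a search order with last element `z`, the elements with the same similarities as `z` come
last among those not yet listed. -/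
theorem SearchOrder.first_not_mem_lastClass {rank : α → ℕ} (h : SearchOrder G rank M)
    (hinj : ∀ x ∈ M, ∀ y ∈ M, rank x = rank y → x = y) {z : α} (hz : z ∈ M)
    (hmax : ∀ x ∈ M, rank x ≤ rank z) {t : ℕ} {x v : α} (hx : x ∈ M) (htx : t ≤ rank x)
    (hxS : x ∉ lastClass G rank M z t) (hv : v ∈ M) (hvt : rank v = t) :
    v ∉ lastClass G rank M z t := by
  intro hvS
  have hxS' : ¬ ∀ u ∈ M, rank u < t → G u x = G u z := fun e => hxS ⟨hx, htx, e⟩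
  have hvx : rank v < rank x := by
    rcases (hvt ▸ htx : rank v ≤ rank x).lt_or_eq with e | e
    · exact e
    · exact absurd (hinj v hv x hx e ▸ hvS) hxS
  have hxz : rank x < rank z := by
    rcases (hmax x hx).lt_or_eq with e | e
    · exact e
    · exact absurd (fun u _ _ => by rw [hinj x hx z hz e]) hxS'
  rcases h v hv x hx hvx with h1 | ⟨u, hu, huv, hlt, heq⟩
  · exact hxS' fun u hu hut => by rw [← h1 u hu (hvt ▸ hut)]; exact hvS.2.2 u hu hut
  have hut : rank u < t := hvt ▸ huv
  rcases h x hx z hz hxz with h2 | ⟨u', hu', hux', hlt', heq'⟩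
  · exact hxS' fun u hu hut => h2 u hu (hut.trans_le htx)
  have huz := hvS.2.2 u hu hut
  rcases lt_trichotomy (rank u') (rank u) with e | e | e
  · have e1 := heq u' hu' e
    have e2 := hvS.2.2 u' hu' (e.trans hut)
    linarith
  · obtain rfl := hinj u' hu' u hu e
    linarith
  · have := heq' u hu e
    linarith

/-- As long as the last class is not everything that remains, it is the union of an initial and a
final segment of any valid order. -/
theorem SearchOrder.lastClass_outer {rank : α → ℕ} (hG : ∀ x y, G x y = G y x)
    (hR : Valid G M R) (h : SearchOrder G rank M)
    (hinj : ∀ x ∈ M, ∀ y ∈ M, rank x = rank y → x = y) {z : α} (hz : z ∈ M)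
    (hmax : ∀ x ∈ M, rank x ≤ rank z) {a : α} (hmin : ∀ x ∈ M, rank a ≤ rank x)
    (k : ℕ) (hk : ∀ i < k, 0 < i → ∃ x ∈ M, rank a + i ≤ rank x ∧
      x ∉ lastClass G rank M z (rank a + i)) :
    ∀ y ∈ lastClass G rank M z (rank a + k), ∀ u ∈ M, ∀ w ∈ M,
      u ∉ lastClass G rank M z (rank a + k) → w ∉ lastClass G rank M z (rank a + k) →
      R u y → ¬ R y w := by
  induction k with
  | zero =>
    intro y _ u hu w _ huS
    exact absurd ⟨hu, hmin u hu, fun v hv hlt => absurd (hmin v hv) (by omega)⟩ huS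
  | succ k ih =>
    have ih := ih fun i hi => hk i (by omega)
    intro y hy u hu w hw huS hwS huy hyw
    have hyM := hy.1
    have hyk : y ∈ lastClass G rank M z (rank a + k) :=
      ⟨hyM, by have := hy.2.1; omega, fun v hv hlt => hy.2.2 v hv (by omega)⟩
    by_cases hex : ∃ v ∈ M, rank v = rank a + k
    · obtain ⟨v, hv, hvk⟩ := hex
      have hvS : ∀ x ∈ M, x ∉ lastClass G rank M z (rank a + k) →
          v ∉ lastClass G rank M z (rank a + k) := by
        intro x hx hxS
        rcases Nat.eq_zero_or_pos k with rfl | hpos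
        · exact absurd ⟨hx, hmin x hx, fun v hv hlt => absurd (hmin v hv) (by omega)⟩ hxS
        · obtain ⟨x', hx', htx', hxS'⟩ := hk k (by omega) hpos
          exact h.first_not_mem_lastClass hinj hz hmax hx' htx' hxS' hv hvk
      -- `v` is less similar to `z` than to the other elements of the class
      have hle : ∀ x ∈ lastClass G rank M z (rank a + k), x ≠ v → G v z ≤ G v x := by
        intro x hx hxv
        have hvx : rank v < rank x := by
          rcases (hvk ▸ hx.2.1 : rank v ≤ rank x).lt_or_eq with e | e
          · exact e
          · exact absurd (hinj v hv x hx.1 e).symm hxv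
        rcases (hmax x hx.1).lt_or_eq with e | e
        · rcases h x hx.1 z hz e with h1 | ⟨v', hv', hvx', hlt, heq⟩
          · exact (h1 v hv hvx).ge
          · rcases lt_trichotomy (rank v') (rank v) with e | e | e
            · exact absurd (hx.2.2 v' hv' (hvk ▸ e)) hlt.ne'
            · obtain rfl := hinj v' hv' v hv e
              exact hlt.le
            · exact (heq v hv e).ge
        · rw [hinj x hx.1 z hz e]
      have hmem : ∀ x ∈ lastClass G rank M z (rank a + k), x ≠ v → G v x ≤ G v y →
          x ∈ lastClass G rank M z (rank a + (k + 1)) := by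
        intro x hx hxv hxy
        have hxr : rank x ≠ rank a + k := fun e => hxv (hinj x hx.1 v hv (e.trans hvk.symm))
        refine ⟨hx.1, by have := hx.2.1; omega, fun v' hv' hlt => ?_⟩
        rcases (show rank v' ≤ rank a + k by omega).lt_or_eq with e | e
        · exact hx.2.2 v' hv' e
        · obtain rfl := hinj v' hv' v hv (e.trans hvk.symm)
          exact le_antisymm (hxy.trans (hy.2.2 v' hv (by omega)).le) (hle x hx hxv)
      have hvy : v ≠ y := by
        rintro rfl
        have := hy.2.1
        omega
      rcases hR.total v hv y hyM hvy with hvy' | hvy'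
      · by_cases hwk : w ∈ lastClass G rank M z (rank a + k)
        · have hwv : w ≠ v := by
            rintro rfl
            exact hR.asymm hv hyM hvy' hyw
          exact hwS (hmem w hwk hwv (hR.rob v hv y hyM w hw hvy' hyw).1)
        · exact ih y hyk v hv w hw (hvS w hw hwk) hwk hvy' hyw
      · by_cases huk : u ∈ lastClass G rank M z (rank a + k)
        · have huv : u ≠ v := by
            rintro rfl
            exact hR.asymm hv hyM huy hvy'
          refine huS (hmem u huk huv ?_)
          rw [hG v u, hG v y]
          exact (hR.rob u hu y hyM v hv huy hvy').2
        · exact ih y hyk u hu v hv huk (hvS u hu huk) huy hvy'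
    · push Not at hex
      have hiff : ∀ x, x ∈ lastClass G rank M z (rank a + k) →
          x ∈ lastClass G rank M z (rank a + (k + 1)) := by
        intro x hx
        have := hex x hx.1
        refine ⟨hx.1, by have := hx.2.1; omega, fun v hv hlt => hx.2.2 v hv ?_⟩
        have := hex v hv
        omega
      exact ih y hyk u hu w hw (fun e => huS (hiff u e)) (fun e => hwS (hiff w e)) huy hyw

/-- The last element `z` of a search order is an end of some valid order. The elements `T` that
remain when the last class has become everything that is left form the two ends of the given
order; the end that contains `z` is a module, so it may be reordered by induction. -/
theorem SearchOrder.exists_valid_first {rank : α → ℕ} (hG : ∀ x y, G x y = G y x)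
    (hR : Valid G M R) (h : SearchOrder G rank M)
    (hinj : ∀ x ∈ M, ∀ y ∈ M, rank x = rank y → x = y) {z : α} (hz : z ∈ M)
    (hmax : ∀ x ∈ M, rank x ≤ rank z) :
    ∃ R', Valid G M R' ∧ ∀ x ∈ M, x ≠ z → R' z x := by
  classical
  induction hn : M.card using Nat.strong_induction_on generalizing M R with
  | _ n ih =>
  obtain ⟨a, ha, hmin⟩ := M.exists_min_image rank ⟨z, hz⟩
  by_cases haz : a = z
  · refine ⟨R, hR, fun x hx hxz => absurd (hinj x hx z hz ?_) hxz⟩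
    exact le_antisymm (hmax x hx) (haz ▸ hmin x hx)
  have hraz : rank a < rank z :=
    lt_of_le_of_ne (hmin z hz) fun e => haz (hinj a ha z hz e)
  -- the first time after the start at which the last class is everything that is left
  have hex : ∃ k, 0 < k ∧ ∀ x ∈ M, rank a + k ≤ rank x → x ∈ lastClass G rank M z (rank a + k) := by
    refine ⟨rank z - rank a, by omega, fun x hx hle => ?_⟩
    obtain rfl := hinj x hx z hz (le_antisymm (hmax x hx) (by omega))
    exact ⟨hx, hle, fun _ _ _ => rfl⟩
  obtain ⟨hk0, hk⟩ := Nat.find_spec hex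
  have hkmin : ∀ i < Nat.find hex, 0 < i → ∃ x ∈ M, rank a + i ≤ rank x ∧
      x ∉ lastClass G rank M z (rank a + i) := by
    intro i hi hpos
    have := Nat.find_min hex hi
    push Not at this
    exact this hpos
  set k := Nat.find hex
  have hkz : k ≤ rank z - rank a := Nat.find_min' hex ⟨by omega, fun x hx hle => by
    obtain rfl := hinj x hx z hz (le_antisymm (hmax x hx) (by omega))
    exact ⟨hx, hle, fun _ _ _ => rfl⟩⟩
  have outer := h.lastClass_outer hG hR hinj hz hmax hmin k hkmin
  set T := lastClass G rank M z (rank a + k)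
  have hzT : z ∈ T := hk z hz (by omega)
  have haT : a ∉ T := fun e => by have := e.2.1; omega
  have hTout : ∀ v ∈ M, v ∉ T → rank v < rank a + k := fun v hv hvT => by
    by_contra e
    exact hvT (hk v hv (by omega))
  -- by symmetry, `z` lies to the right of `a`
  suffices key : ∀ R : α → α → Prop, Valid G M R → R a z →
      (∀ y ∈ T, ∀ u ∈ M, ∀ w ∈ M, u ∉ T → w ∉ T → R u y → ¬ R y w) →
      ∃ R', Valid G M R' ∧ ∀ x ∈ M, x ≠ z → R' z x by
    rcases hR.total a ha z hz haz with e | e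
    · exact key R hR e outer
    · exact key _ (hR.flip hG) e fun y hy u hu w hw huT hwT huy hyw =>
        outer y hy w hw u hu hwT huT hyw huy
  intro R hR haz' outer
  let N := M.filter fun y => y ∈ T ∧ R a y
  have hNM : N ⊆ M := Finset.filter_subset _ _
  have hmem : ∀ y, y ∈ N ↔ y ∈ M ∧ y ∈ T ∧ R a y := fun y => Finset.mem_filter
  have hzN : z ∈ N := (hmem z).2 ⟨hz, hzT, haz'⟩
  have haN : a ∉ N := fun e => haT ((hmem a).1 e).2.1
  have hup : ∀ y ∈ N, ∀ w ∈ M, R y w → w ∈ N := by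
    intro y hy w hw hyw
    obtain ⟨hyM, hyT, hay⟩ := (hmem y).1 hy
    refine (hmem w).2 ⟨hw, ?_, hR.trans a ha y hyM w hw hay hyw⟩
    by_contra hwT
    exact outer y hyT a ha w hw haT hwT hay hyw
  have hmod : ∀ v ∈ M, v ∉ N → ∀ x ∈ N, ∀ y ∈ N, G v x = G v y := by
    have hTmod : ∀ v ∈ M, v ∉ T → ∀ x ∈ N, ∀ y ∈ N, G v x = G v y := by
      intro v hv hvT x hx y hy
      rw [((hmem x).1 hx).2.1.2.2 v hv (hTout v hv hvT),
        ((hmem y).1 hy).2.1.2.2 v hv (hTout v hv hvT)]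
    intro v hv hvN
    by_cases hvT : v ∈ T
    · have hva : R v a := by
        rcases hR.total v hv a ha (fun e => haT (e ▸ hvT)) with e | e
        · exact e
        · exact absurd ((hmem v).2 ⟨hv, hvT, e⟩) hvN
      have main : ∀ x ∈ N, ∀ y ∈ N, R x y → G v x = G v y := by
        intro x hx y hy hxy
        obtain ⟨hxM, hxT, hax⟩ := (hmem x).1 hx
        have hyM := hNM hy
        have e1 := (hR.rob v hv x hxM y hyM (hR.trans v hv a ha x hxM hva hax) hxy).1
        have e2 := hR.kal v hv a ha x hxM y hyM hva hax hxy
        have e3 := hTmod a ha haT x hx y hy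
        linarith
      intro x hx y hy
      by_cases hxy : x = y
      · rw [hxy]
      rcases hR.total x (hNM hx) y (hNM hy) hxy with e | e
      · exact main x hx y hy e
      · exact (main y hy x hx e).symm
    · exact hTmod v hv hvT
  have hcard : N.card < n := hn ▸ Finset.card_lt_card ⟨hNM, fun e => haN (e ha)⟩
  obtain ⟨R₁, hR₁, hfirst⟩ := ih N.card hcard (hR.mono hNM) (h.of_module hNM hmod)
    (fun x hx y hy => hinj x (hNM hx) y (hNM hy)) hzN (fun x hx => hmax x (hNM hx)) rfl
  have hsub := hR.substitute hG hNM (fun x hx y hy _ _ hxy _ => hup x hx y hy hxy) hmod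
    (hR₁.flip hG)
  refine ⟨_, hsub.flip hG, fun x hx hxz => ?_⟩
  by_cases hxN : x ∈ N
  · exact Or.inl ⟨hxN, hzN, hfirst x hxN hxz⟩
  · refine Or.inr ⟨fun e => hxN e.1, ?_⟩
    rcases hR.total x hx z hz hxz with e | e
    · exact e
    · exact absurd (hup z hzN x hx e) hxN

end Orders

/-! ### Kalmanson inequalities of circular distances -/

/-- The Kalmanson inequalities for four points in this cyclic order. -/
def Kalmanson {α : Type*} (D : α → α → ℝ) (a b c d : α) : Prop :=
  D a b + D c d ≤ D a c + D b d ∧ D a d + D b c ≤ D a c + D b d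

/-- Twice the Gromov product with base point `r`. -/
def gromov {α : Type*} (D : α → α → ℝ) (r x y : α) : ℝ := D r x + D r y - D x y

theorem Kalmanson.rotate {α : Type*} {D : α → α → ℝ} (hD : ∀ x y, D x y = D y x) {a b c d : α}
    (h : Kalmanson D a b c d) : Kalmanson D b c d a := by
  unfold Kalmanson at *
  rw [hD d a, hD b a, hD c a]
  constructor <;> linarith [h.1, h.2]

section Circular

variable {X : Type*} [Fintype X] [DecidableEq X]

theorem partsDist_pair (A : Finset X) (x y : X) :
    partsDist {A, Aᶜ} x y = if (x ∈ A ↔ y ∈ A) then 0 else 1 := by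
  unfold partsDist
  by_cases hxy : x = y
  · subst hxy
    by_cases hx : x ∈ A
    · simp [hx]
    · simp [hx]
  by_cases hx : x ∈ A <;> by_cases hy : y ∈ A <;>
    simp [hx, hy, hxy, Finset.inter_insert_of_mem, Finset.inter_insert_of_notMem]

theorem generatedDist_eq {𝒮 : Finset (Split X)} (ω : Split X → ℝ)
    {θ : Fin (Fintype.card X) ≃ X} (h : FitsOn 𝒮 θ) {S : Split X} (hS : S ∈ 𝒮) :
    ∃ i j : ℕ, ∀ x y, ω S * partsDist S.parts x y = ω S *
      if ((i ≤ (θ.symm x : ℕ) ∧ (θ.symm x : ℕ) ≤ j) ↔ (i ≤ (θ.symm y : ℕ) ∧ (θ.symm y : ℕ) ≤ j))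
      then 0 else 1 := by
  obtain ⟨i, j, -, -, hp⟩ := h S hS
  refine ⟨i, j, fun x y => ?_⟩
  have hmem : ∀ z, z ∈ (Finset.Icc i j).map θ.toEmbedding ↔
      ((i : ℕ) ≤ (θ.symm z : ℕ) ∧ (θ.symm z : ℕ) ≤ j) := by
    intro z
    simp only [Finset.mem_map_equiv, Finset.mem_Icc, Fin.le_def]
  rw [hp, partsDist_pair]
  simp only [hmem]

theorem IsCircularDistance.triangle {D : X → X → ℝ} (h : IsCircularDistance D) (x y z : X) :
    D x z ≤ D x y + D y z := by
  obtain ⟨-, 𝒮, ω, ⟨θ, hθ⟩, hω, rfl⟩ := h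
  unfold generatedDist
  rw [← Finset.sum_add_distrib]
  refine Finset.sum_le_sum fun S hS => ?_
  obtain ⟨i, j, hS'⟩ := generatedDist_eq ω hθ hS
  rw [hS', hS', hS', ← mul_add]
  refine mul_le_mul_of_nonneg_left ?_ (hω S hS)
  split_ifs <;> first | (norm_num; done) | (exfalso; tauto)

theorem IsCircularDistance.kalmanson {D : X → X → ℝ} (h : IsCircularDistance D) :
    ∃ pos : X → ℕ, Function.Injective pos ∧
      ∀ a b c d, pos a < pos b → pos b < pos c → pos c < pos d → Kalmanson D a b c d := by
  obtain ⟨-, 𝒮, ω, ⟨θ, hθ⟩, hω, rfl⟩ := h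
  refine ⟨fun x => θ.symm x, fun x y hxy => θ.symm.injective (Fin.ext hxy),
    fun a b c d hab hbc hcd => ?_⟩
  constructor
  all_goals
    unfold generatedDist
    rw [← Finset.sum_add_distrib, ← Finset.sum_add_distrib]
    refine Finset.sum_le_sum fun S hS => ?_
    obtain ⟨i, j, hS'⟩ := generatedDist_eq ω hθ hS
    rw [hS', hS', hS', hS', ← mul_add, ← mul_add]
    refine mul_le_mul_of_nonneg_left ?_ (hω S hS)
    simp only at hab hbc hcd
    split_ifs <;> first | (norm_num; done) | (exfalso; omega)

/-- The circular ordering can be cut open just before any element `r`. -/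
theorem IsCircularDistance.kalmanson_first {D : X → X → ℝ} (h : IsCircularDistance D) (r : X) :
    ∃ pos : X → ℕ, Function.Injective pos ∧ (∀ x, pos r ≤ pos x) ∧
      ∀ a b c d, pos a < pos b → pos b < pos c → pos c < pos d → Kalmanson D a b c d := by
  obtain ⟨pos, hinj, hk⟩ := h.kalmanson
  have hsymm := h.1.symm
  obtain ⟨B, hB⟩ : ∃ B, ∀ x, pos x < B :=
    ⟨Finset.univ.sup pos + 1, fun x => Nat.lt_succ_of_le (Finset.le_sup (Finset.mem_univ x))⟩
  refine ⟨fun x => if pos x < pos r then pos x + B else pos x, fun x y hxy => hinj ?_,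
    fun x => ?_, fun a b c d hab hbc hcd => ?_⟩
  · have := hB x
    have := hB y
    simp only at hxy
    split_ifs at hxy <;> omega
  · have := hB r
    simp only [lt_irrefl, if_false]
    split_ifs <;> omega
  · have := hB a
    have := hB b
    have := hB c
    have := hB d
    simp only at hab hbc hcd
    by_cases ha : pos a < pos r
    · exact hk a b c d (by split_ifs at * <;> omega) (by split_ifs at * <;> omega)
        (by split_ifs at * <;> omega)
    by_cases hb : pos b < pos r
    · exact ((hk b c d a (by split_ifs at * <;> omega) (by split_ifs at * <;> omega)
        (by split_ifs at * <;> omega)).rotate hsymm).rotate hsymm |>.rotate hsymm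
    by_cases hc : pos c < pos r
    · exact ((hk c d a b (by split_ifs at * <;> omega) (by split_ifs at * <;> omega)
        (by split_ifs at * <;> omega)).rotate hsymm).rotate hsymm
    by_cases hd : pos d < pos r
    · exact (hk d a b c (by split_ifs at * <;> omega) (by split_ifs at * <;> omega)
        (by split_ifs at * <;> omega)).rotate hsymm
    · exact hk a b c d (by split_ifs at * <;> omega) (by split_ifs at * <;> omega)
        (by split_ifs at * <;> omega)

theorem IsCircularDistance.exists_valid {D : X → X → ℝ} (h : IsCircularDistance D) (r : X) :
    ∃ R, Valid (gromov D r) Finset.univ R := by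
  obtain ⟨pos, hinj, hr, hk⟩ := h.kalmanson_first r
  have hrr := h.1.self r
  have rob : ∀ x y z, pos x < pos y → pos y < pos z →
      gromov D r x z ≤ gromov D r x y ∧ gromov D r x z ≤ gromov D r y z := by
    intro x y z hxy hyz
    rcases (hr x).lt_or_eq with e | e
    · have := hk r x y z e hxy hyz
      unfold Kalmanson at this
      unfold gromov
      constructor <;> linarith [this.1, this.2]
    · obtain rfl := hinj e
      have := h.triangle y r z
      have := h.1.symm r y
      unfold gromov
      constructor <;> linarith
  refine ⟨fun x y => pos x < pos y, fun x _ => lt_irrefl _, fun x _ y _ z _ => lt_trans,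
    fun x _ y _ hxy => lt_or_gt_of_ne fun e => hxy (hinj e), fun x _ y _ z _ => rob x y z,
    fun x _ y _ z _ w _ hxy hyz hzw => ?_⟩
  have := (hk x y z w hxy hyz hzw).2
  unfold gromov
  linarith

end Circular

/-- A valid order for the Gromov product is a circular ordering of the distance, wherever the base
point is placed. -/
theorem Valid.kalmanson {α : Type*} {D : α → α → ℝ} {r : α} {M : Finset α} {R : α → α → Prop}
    (h : Valid (gromov D r) M R) {a b c d : α} (ha : a ∈ M) (hb : b ∈ M) (hc : c ∈ M) (hd : d ∈ M)
    (hab : R a b) (hbc : R b c) (hcd : R c d) : Kalmanson D a b c d := by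
  have h1 := (h.rob a ha b hb c hc hab hbc).1
  have h2 := (h.rob b hb c hc d hd hbc hcd).2
  have h3 := h.kal a ha b hb c hc d hd hab hbc hcd
  unfold gromov at *
  constructor <;> linarith

theorem gromov_symm {α : Type*} {D : α → α → ℝ} (hD : ∀ x y, D x y = D y x) (r x y : α) :
    gromov D r x y = gromov D r y x := by
  unfold gromov
  rw [hD x y]
  ring

/-! ### Reasoning about programs -/

section Memory

variable (s : Memory)

@[simp] theorem Memory.setW_wreg (x v y : ℕ) :
    (s.setW x v).wreg y = if y = x then v else s.wreg y := by
  simp [Memory.setW, Function.update_apply]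

@[simp] theorem Memory.setW_warr (x v : ℕ) : (s.setW x v).warr = s.warr := rfl

@[simp] theorem Memory.setW_rreg (x v : ℕ) : (s.setW x v).rreg = s.rreg := rfl

@[simp] theorem Memory.setW_rarr (x v : ℕ) : (s.setW x v).rarr = s.rarr := rfl

@[simp] theorem Memory.storeW_wreg (a i v : ℕ) : (s.storeW a i v).wreg = s.wreg := rfl

@[simp] theorem Memory.storeW_warr (a i v b : ℕ) :
    (s.storeW a i v).warr b = if b = a then Function.update (s.warr a) i v else s.warr b := by
  simp [Memory.storeW, Function.update_apply]

@[simp] theorem Memory.storeW_rreg (a i v : ℕ) : (s.storeW a i v).rreg = s.rreg := rfl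

@[simp] theorem Memory.storeW_rarr (a i v : ℕ) : (s.storeW a i v).rarr = s.rarr := rfl

@[simp] theorem Memory.setR_wreg (x : ℕ) (v : ℝ) : (s.setR x v).wreg = s.wreg := rfl

@[simp] theorem Memory.setR_warr (x : ℕ) (v : ℝ) : (s.setR x v).warr = s.warr := rfl

@[simp] theorem Memory.setR_rreg (x : ℕ) (v : ℝ) (y : ℕ) :
    (s.setR x v).rreg y = if y = x then v else s.rreg y := by
  simp [Memory.setR, Function.update_apply]

@[simp] theorem Memory.setR_rarr (x : ℕ) (v : ℝ) : (s.setR x v).rarr = s.rarr := rfl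

@[simp] theorem Memory.storeR_wreg (a i : ℕ) (v : ℝ) : (s.storeR a i v).wreg = s.wreg := rfl

@[simp] theorem Memory.storeR_warr (a i : ℕ) (v : ℝ) : (s.storeR a i v).warr = s.warr := rfl

@[simp] theorem Memory.storeR_rreg (a i : ℕ) (v : ℝ) : (s.storeR a i v).rreg = s.rreg := rfl

@[simp] theorem Memory.storeR_rarr (a i : ℕ) (v : ℝ) (b : ℕ) :
    (s.storeR a i v).rarr b = if b = a then Function.update (s.rarr a) i v else s.rarr b := by
  simp [Memory.storeR, Function.update_apply]

end Memory

attribute [simp] WExp.eval WExp.Fits WExp.cost RExp.eval RExp.Fits RExp.cost Test.Holds Test.Fits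
  Test.cost

namespace Prog

/-- The word registers that the program may write to. -/
def wregs : Prog → List ℕ
  | setW x _ => [x]
  | seq c d => c.wregs ++ d.wregs
  | cond _ c d => c.wregs ++ d.wregs
  | loop _ c => c.wregs
  | _ => []

/-- The word arrays that the program may write to. -/
def warrs : Prog → List ℕ
  | storeW a _ _ => [a]
  | seq c d => c.warrs ++ d.warrs
  | cond _ c d => c.warrs ++ d.warrs
  | loop _ c => c.warrs
  | _ => []

/-- The real registers that the program may write to. -/
def rregs : Prog → List ℕ
  | setR x _ => [x]
  | seq c d => c.rregs ++ d.rregs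
  | cond _ c d => c.rregs ++ d.rregs
  | loop _ c => c.rregs
  | _ => []

/-- The real arrays that the program may write to. -/
def rarrs : Prog → List ℕ
  | storeR a _ _ => [a]
  | seq c d => c.rarrs ++ d.rarrs
  | cond _ c d => c.rarrs ++ d.rarrs
  | loop _ c => c.rarrs
  | _ => []

end Prog

/-- The memories `s` and `s'` agree on all cells that `c` does not write to. -/
structure Frame (c : Prog) (s s' : Memory) : Prop where
  wreg : ∀ x, x ∉ c.wregs → s'.wreg x = s.wreg x
  warr : ∀ x, x ∉ c.warrs → s'.warr x = s.warr x
  rreg : ∀ x, x ∉ c.rregs → s'.rreg x = s.rreg x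
  rarr : ∀ x, x ∉ c.rarrs → s'.rarr x = s.rarr x

theorem Frame.refl (c : Prog) (s : Memory) : Frame c s s :=
  ⟨fun _ _ => rfl, fun _ _ => rfl, fun _ _ => rfl, fun _ _ => rfl⟩

theorem Frame.trans {c : Prog} {s s' s'' : Memory} (h : Frame c s s') (h' : Frame c s' s'') :
    Frame c s s'' :=
  ⟨fun x hx => (h'.wreg x hx).trans (h.wreg x hx), fun x hx => (h'.warr x hx).trans (h.warr x hx),
    fun x hx => (h'.rreg x hx).trans (h.rreg x hx), fun x hx => (h'.rarr x hx).trans (h.rarr x hx)⟩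

theorem Frame.mono {c d : Prog} {s s' : Memory} (h : Frame c s s') (h1 : c.wregs ⊆ d.wregs)
    (h2 : c.warrs ⊆ d.warrs) (h3 : c.rregs ⊆ d.rregs) (h4 : c.rarrs ⊆ d.rarrs) : Frame d s s' :=
  ⟨fun x hx => h.wreg x fun e => hx (h1 e), fun x hx => h.warr x fun e => hx (h2 e),
    fun x hx => h.rreg x fun e => hx (h3 e), fun x hx => h.rarr x fun e => hx (h4 e)⟩

theorem Exec.frame {W : ℕ} {c : Prog} {s s' : Memory} {t : ℕ} (h : Exec W c s s' t) :
    Frame c s s' := by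
  induction h with
  | skip s => exact Frame.refl _ _
  | setW s x e he => constructor <;> intro y hy <;> simp_all [Prog.wregs]
  | storeW s a i e hi he => constructor <;> intro y hy <;> simp_all [Prog.warrs]
  | setR s x e he => constructor <;> intro y hy <;> simp_all [Prog.rregs]
  | storeR s a i e hi he => constructor <;> intro y hy <;> simp_all [Prog.rarrs]
  | seq hc hd ihc ihd =>
    refine (ihc.mono ?_ ?_ ?_ ?_).trans (ihd.mono ?_ ?_ ?_ ?_) <;> intro x hx <;>
      simp [Prog.wregs, Prog.warrs, Prog.rregs, Prog.rarrs, hx]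
  | condTrue hf hb hc ih =>
    refine ih.mono ?_ ?_ ?_ ?_ <;> intro x hx <;>
      simp [Prog.wregs, Prog.warrs, Prog.rregs, Prog.rarrs, hx]
  | condFalse hf hb hc ih =>
    refine ih.mono ?_ ?_ ?_ ?_ <;> intro x hx <;>
      simp [Prog.wregs, Prog.warrs, Prog.rregs, Prog.rarrs, hx]
  | loopDone hf hb => exact Frame.refl _ _
  | loopStep hf hb hc hl ihc ihl =>
    exact Frame.trans (ihc.mono (d := .loop _ _) (fun _ h => h) (fun _ h => h) (fun _ h => h)
      fun _ h => h) ihl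

/-- The program `c` started in `s` halts, and the final memory and the number of steps
satisfy `Q`. -/
def Runs (W : ℕ) (c : Prog) (s : Memory) (Q : Memory → ℕ → Prop) : Prop :=
  ∃ s' t, Exec W c s s' t ∧ Q s' t

section Runs

variable {W : ℕ} {c d : Prog} {s : Memory} {Q Q' : Memory → ℕ → Prop}

theorem Runs.mono (h : Runs W c s Q) (hQ : ∀ s' t, Frame c s s' → Q s' t → Q' s' t) :
    Runs W c s Q' := by
  obtain ⟨s', t, he, hq⟩ := h
  exact ⟨s', t, he, hQ s' t he.frame hq⟩

@[simp] theorem runs_skip : Runs W .skip s Q ↔ Q s 1 := by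
  constructor
  · rintro ⟨s', t, he, hq⟩
    cases he
    exact hq
  · exact fun hq => ⟨_, _, .skip s, hq⟩

@[simp] theorem runs_setW {x : ℕ} {e : WExp} :
    Runs W (.setW x e) s Q ↔ e.Fits W s ∧ Q (s.setW x (e.eval s)) (e.cost + 1) := by
  constructor
  · rintro ⟨s', t, he, hq⟩
    cases he
    exact ⟨‹_›, hq⟩
  · exact fun hq => ⟨_, _, .setW s x e hq.1, hq.2⟩

@[simp] theorem runs_storeW {a : ℕ} {i e : WExp} :
    Runs W (.storeW a i e) s Q ↔ i.Fits W s ∧ e.Fits W s ∧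
      Q (s.storeW a (i.eval s) (e.eval s)) (i.cost + e.cost + 1) := by
  constructor
  · rintro ⟨s', t, he, hq⟩
    cases he
    exact ⟨‹_›, ‹_›, hq⟩
  · exact fun hq => ⟨_, _, .storeW s a i e hq.1 hq.2.1, hq.2.2⟩

@[simp] theorem runs_setR {x : ℕ} {e : RExp} :
    Runs W (.setR x e) s Q ↔ e.Fits W s ∧ Q (s.setR x (e.eval s)) (e.cost + 1) := by
  constructor
  · rintro ⟨s', t, he, hq⟩
    cases he
    exact ⟨‹_›, hq⟩
  · exact fun hq => ⟨_, _, .setR s x e hq.1, hq.2⟩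

@[simp] theorem runs_storeR {a : ℕ} {i : WExp} {e : RExp} :
    Runs W (.storeR a i e) s Q ↔ i.Fits W s ∧ e.Fits W s ∧
      Q (s.storeR a (i.eval s) (e.eval s)) (i.cost + e.cost + 1) := by
  constructor
  · rintro ⟨s', t, he, hq⟩
    cases he
    exact ⟨‹_›, ‹_›, hq⟩
  · exact fun hq => ⟨_, _, .storeR s a i e hq.1 hq.2.1, hq.2.2⟩

@[simp] theorem runs_seq :
    Runs W (.seq c d) s Q ↔
      Runs W c s fun s' t => Runs W d s' fun s'' t' => Q s'' (t + t') := by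
  constructor
  · rintro ⟨s', t, he, hq⟩
    cases he with
    | seq hc hd => exact ⟨_, _, hc, _, _, hd, hq⟩
  · rintro ⟨s', t, hc, s'', t', hd, hq⟩
    exact ⟨_, _, .seq hc hd, hq⟩

@[simp] theorem runs_cond {b : Test} :
    Runs W (.cond b c d) s Q ↔ b.Fits W s ∧
      (b.Holds s → Runs W c s fun s' t => Q s' (b.cost + 1 + t)) ∧
      (¬ b.Holds s → Runs W d s fun s' t => Q s' (b.cost + 1 + t)) := by
  constructor
  · rintro ⟨s', t, he, hq⟩
    cases he with
    | condTrue hf hb hc => exact ⟨hf, fun _ => ⟨_, _, hc, hq⟩, fun h => absurd hb h⟩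
    | condFalse hf hb hc => exact ⟨hf, fun h => absurd h hb, fun _ => ⟨_, _, hc, hq⟩⟩
  · rintro ⟨hf, h1, h2⟩
    by_cases hb : b.Holds s
    · obtain ⟨s', t, he, hq⟩ := h1 hb
      exact ⟨_, _, .condTrue hf hb he, hq⟩
    · obtain ⟨s', t, he, hq⟩ := h2 hb
      exact ⟨_, _, .condFalse hf hb he, hq⟩

/-- Rule for loops: the invariant `I` speaks of the memory and of the steps taken so far, and the
variant `μ` decreases. -/
theorem Runs.loop {b : Test} {I : Memory → ℕ → Prop} (μ : Memory → ℕ) (h0 : I s 0)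
    (hstep : ∀ s₁ t, Frame (.loop b c) s s₁ → I s₁ t → b.Fits W s₁ ∧ (b.Holds s₁ →
      Runs W c s₁ fun s₂ t₂ => I s₂ (t + t₂ + (b.cost + 1)) ∧ μ s₂ < μ s₁))
    (hQ : ∀ s₁ t, Frame (.loop b c) s s₁ → I s₁ t → ¬ b.Holds s₁ → Q s₁ (t + (b.cost + 1))) :
    Runs W (.loop b c) s Q := by
  suffices key : ∀ n s₁ t, μ s₁ ≤ n → Frame (.loop b c) s s₁ → I s₁ t →
      Runs W (.loop b c) s₁ fun s₂ t₂ => Q s₂ (t + t₂) by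
    obtain ⟨s', t, he, hq⟩ := key _ s 0 le_rfl (Frame.refl _ _) h0
    exact ⟨s', t, he, by simpa using hq⟩
  intro n
  induction n using Nat.strong_induction_on with
  | _ n ih =>
  intro s₁ t hn hf hI
  obtain ⟨hfit, hbody⟩ := hstep s₁ t hf hI
  by_cases hb : b.Holds s₁
  · obtain ⟨s₂, t₂, he, hI₂, hμ⟩ := hbody hb
    obtain ⟨s₃, t₃, he₃, hq⟩ := ih (μ s₂) (by omega) s₂ _ le_rfl
      (hf.trans (he.frame.mono (fun _ h => h) (fun _ h => h) (fun _ h => h) (fun _ h => h))) hI₂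
    exact ⟨s₃, _, .loopStep hfit hb he he₃, by convert hq using 1; ring⟩
  · exact ⟨s₁, _, .loopDone hfit hb, hQ s₁ t hf hI hb⟩

/-- The loop `for x ≤ · < e`: it runs `body` and increments register `x` as long as `x` is less
than register `e`. -/
def forUp (x e : ℕ) (body : Prog) : Prog :=
  .loop (.wle (.add (.reg x) (.const 1)) (.reg e))
    (.seq body (.setW x (.add (.reg x) (.const 1))))

/-- Rule for counting loops: `I i` is the invariant when the counter has value `i`. -/
theorem Runs.forUp {x e : ℕ} {body : Prog} (I : ℕ → Memory → ℕ → Prop) (hW : s.wreg e + 1 ≤ W)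
    (hle : s.wreg x ≤ s.wreg e) (h0 : I (s.wreg x) s 0)
    (hstep : ∀ i s₁ t, Frame (forUp x e body) s s₁ → s.wreg x ≤ i → i < s.wreg e →
      s₁.wreg x = i → s₁.wreg e = s.wreg e → I i s₁ t →
      Runs W body s₁ fun s₂ t₂ => I (i + 1) (s₂.setW x (i + 1)) (t + t₂ + 10))
    (hQ : ∀ s₁ t, Frame (OrderDist.forUp x e body) s s₁ → s₁.wreg x = s.wreg e →
      I (s.wreg e) s₁ t → Q s₁ (t + 6))
    (hx : x ∉ body.wregs := by decide) (he : e ∉ body.wregs := by decide)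
    (hxe : e ≠ x := by decide) :
    Runs W (OrderDist.forUp x e body) s Q := by
  refine Runs.loop (I := fun s₁ t => s.wreg x ≤ s₁.wreg x ∧ s₁.wreg x ≤ s.wreg e ∧
    s₁.wreg e = s.wreg e ∧ I (s₁.wreg x) s₁ t) (fun s₁ => s.wreg e - s₁.wreg x)
    ⟨le_rfl, hle, rfl, h0⟩ ?_ ?_
  · rintro s₁ t hf ⟨h1, h2, h3, hI⟩
    refine ⟨by simp; omega, fun hb => ?_⟩
    simp only [Test.Holds, WExp.eval, h3] at hb
    rw [runs_seq]
    refine (hstep (s₁.wreg x) s₁ t hf h1 (by omega) rfl h3 hI).mono fun s₂ t₂ hf₂ hI₂ => ?_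
    have e1 := hf₂.wreg x hx
    have e2 := hf₂.wreg e he
    simp only [runs_setW, WExp.Fits, WExp.eval, WExp.cost, e1]
    refine ⟨⟨trivial, by omega, by omega⟩, ?_⟩
    simp only [Memory.setW_wreg, if_true, if_neg hxe, e2, h3, Test.cost, WExp.cost]
    exact ⟨⟨by omega, by omega, trivial, by convert hI₂ using 1; omega⟩, by omega⟩
  · rintro s₁ t hf ⟨h1, h2, h3, hI⟩ hb
    simp only [Test.Holds, WExp.eval, h3] at hb
    have e1 : s₁.wreg x = s.wreg e := by omega
    exact hQ s₁ t hf e1 (e1 ▸ hI)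

end Runs

/-! ### Ordered partitions stored in arrays -/

/-- The positions `j` and `k` lie in the same class, if classes start at the positions where `bd`
is nonzero. -/
def Same (bd : ℕ → ℕ) (j k : ℕ) : Prop :=
  ∀ m, (j < m ∧ m ≤ k) ∨ (k < m ∧ m ≤ j) → bd m = 0

theorem Same.refl (bd : ℕ → ℕ) (j : ℕ) : Same bd j j := fun m h => by omega

theorem Same.symm {bd : ℕ → ℕ} {j k : ℕ} (h : Same bd j k) : Same bd k j :=
  fun m hm => h m hm.symm

theorem Same.trans {bd : ℕ → ℕ} {i j k : ℕ} (h : Same bd i j) (h' : Same bd j k) :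
    Same bd i k := fun m hm => by
  by_cases e : (i < m ∧ m ≤ j) ∨ (j < m ∧ m ≤ i)
  · exact h m e
  · exact h' m (by omega)

theorem Same.anti {bd bd' : ℕ → ℕ} (hbd : ∀ k, bd k ≠ 0 → bd' k ≠ 0) {i j : ℕ}
    (h : Same bd' i j) : Same bd i j := fun m hm => by
  by_contra e
  exact hbd m e (h m hm)

theorem Same.le_iff {bd : ℕ → ℕ} {i j l : ℕ} (h : Same bd i j) (hl : bd l ≠ 0) :
    l ≤ i ↔ l ≤ j := by
  by_contra e
  exact hl (h l (by omega))

/-- An array of elements whose positions are divided into consecutive classes (a class starts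
wherever `bd` is nonzero), with a queue of `cnt` events. The event `k` records that the class
of the positions from `lft k` up to `rgt k` (exclusive) has been divided at position `cut k`. -/
structure Layout where
  arr : ℕ → ℕ
  bd : ℕ → ℕ
  lft : ℕ → ℕ
  cut : ℕ → ℕ
  rgt : ℕ → ℕ
  cnt : ℕ

/-- The number of positions below `n` at which no class starts. -/
def nonStarts (n : ℕ) (bd : ℕ → ℕ) : ℕ := ((Finset.range n).filter fun k => bd k = 0).card

open Classical in
/-- The number of pairs of positions below `n` that share a class. -/
noncomputable def samePairs (n : ℕ) (bd : ℕ → ℕ) : ℕ :=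
  ((Finset.range n ×ˢ Finset.range n).filter fun q => q.1 < q.2 ∧ Same bd q.1 q.2).card

/-- Starting a class at `c` uses up one position, so that at most `n` events are ever created. -/
theorem nonStarts_update {n c : ℕ} {bd : ℕ → ℕ} (hc : c < n) (h0 : bd c = 0) :
    nonStarts n (Function.update bd c 1) + 1 = nonStarts n bd := by
  unfold nonStarts
  have : (Finset.range n).filter (fun k => Function.update bd c 1 k = 0) =
      ((Finset.range n).filter fun k => bd k = 0).erase c := by
    ext k
    by_cases hk : k = c
    · simp [hk]
    · simp [hk]
  rw [this, Finset.card_erase_add_one]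
  simp [hc, h0]

theorem nonStarts_le (n : ℕ) (bd : ℕ → ℕ) : nonStarts n bd ≤ n :=
  (Finset.card_filter_le _ _).trans (by simp)

/-- Dividing a class separates the pairs with one position on either side of the cut. This is what
bounds the total size of all events. -/
theorem samePairs_update {n a b c : ℕ} {bd : ℕ → ℕ} (hac : a < c) (hcb : c < b) (hb : b ≤ n)
    (h0 : ∀ k, a < k → k < b → bd k = 0) :
    samePairs n (Function.update bd c 1) + (c - a) * (b - c) ≤ samePairs n bd := by
  classical
  unfold samePairs
  have hcard : (Finset.Ico a c ×ˢ Finset.Ico c b).card = (c - a) * (b - c) := by simp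
  rw [← hcard, ← Finset.card_union_of_disjoint]
  · refine Finset.card_le_card ?_
    rintro ⟨i, j⟩ h
    simp only [Finset.mem_union, Finset.mem_filter, Finset.mem_product, Finset.mem_range,
      Finset.mem_Ico] at h ⊢
    rcases h with ⟨h1, h2, h3⟩ | ⟨h1, h2⟩
    · refine ⟨h1, h2, h3.anti fun k hk => ?_⟩
      by_cases e : k = c
      · simp [e]
      · simpa [e] using hk
    · exact ⟨by omega, by omega, fun m hm => h0 m (by omega) (by omega)⟩
  · rw [Finset.disjoint_left]
    rintro ⟨i, j⟩ h h'
    simp only [Finset.mem_filter, Finset.mem_product, Finset.mem_range, Finset.mem_Ico] at h h'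
    have := h.2.2 c (by omega)
    simp at this

theorem samePairs_le (n : ℕ) (bd : ℕ → ℕ) : samePairs n bd ≤ n * n := by
  classical
  exact (Finset.card_filter_le _ _).trans (by simp)

/-- The number of pairs of positions separated by event `k`. -/
def Layout.size (P : Layout) (k : ℕ) : ℕ := (P.cut k - P.lft k) * (P.rgt k - P.cut k)

/-- The queue of events is well-formed, it covers all separated pairs of positions, and each pair
is separated by at most one event. -/
structure QueueInv (n : ℕ) (P : Layout) : Prop where
  event : ∀ k < P.cnt, P.lft k < P.cut k ∧ P.cut k < P.rgt k ∧ P.rgt k ≤ n ∧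
    P.bd (P.lft k) ≠ 0 ∧ P.bd (P.cut k) ≠ 0 ∧ P.bd (P.rgt k) ≠ 0
  cover : ∀ i j, i < j → j < n → ¬ Same P.bd i j →
    ∃ k < P.cnt, P.lft k ≤ i ∧ i < P.cut k ∧ P.cut k ≤ j ∧ j < P.rgt k
  total : samePairs n P.bd + ∑ k ∈ Finset.range P.cnt, P.size k ≤ n * n

/-- `P'` arises from `P` by permuting elements within the classes between the positions `lo` and
`hi`, and by dividing these classes further. -/
structure Refines (n lo hi : ℕ) (P P' : Layout) : Prop where
  perm : ∃ σ : Equiv.Perm ℕ, P'.arr = P.arr ∘ σ ∧ (∀ i, Same P.bd (σ i) i) ∧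
    ∀ i, i < lo ∨ hi ≤ i → σ i = i
  bd_ne : ∀ k, P.bd k ≠ 0 → P'.bd k ≠ 0
  bd_out : ∀ k, k ≤ lo ∨ hi ≤ k → P'.bd k = P.bd k
  queue : QueueInv n P → P.bd lo ≠ 0 → P.bd hi ≠ 0 → QueueInv n P'
  cnt_le : P.cnt ≤ P'.cnt
  old : ∀ k < P.cnt, P'.lft k = P.lft k ∧ P'.cut k = P.cut k ∧ P'.rgt k = P.rgt k
  count : P'.cnt + nonStarts n P'.bd = P.cnt + nonStarts n P.bd

theorem Refines.refl (n lo hi : ℕ) (P : Layout) : Refines n lo hi P P where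
  perm := ⟨1, rfl, fun _ => Same.refl _ _, fun _ _ => rfl⟩
  bd_ne _ h := h
  bd_out _ _ := rfl
  queue h _ _ := h
  cnt_le := le_rfl
  old _ _ := ⟨rfl, rfl, rfl⟩
  count := rfl

theorem Refines.trans {n lo hi : ℕ} {P P' P'' : Layout} (h : Refines n lo hi P P')
    (h' : Refines n lo hi P' P'') : Refines n lo hi P P'' where
  perm := by
    obtain ⟨σ, h1, h2, h3⟩ := h.perm
    obtain ⟨τ, h1', h2', h3'⟩ := h'.perm
    refine ⟨τ.trans σ, by rw [h1', h1]; rfl, fun i => ?_, fun i hi => ?_⟩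
    · exact (h2 (τ i)).trans ((h2' i).anti h.bd_ne)
    · simp only [Equiv.trans_apply, h3' i hi, h3 i hi]
  bd_ne k hk := h'.bd_ne k (h.bd_ne k hk)
  bd_out k hk := (h'.bd_out k hk).trans (h.bd_out k hk)
  queue hq h1 h2 := h'.queue (h.queue hq h1 h2) (h.bd_ne _ h1) (h.bd_ne _ h2)
  cnt_le := h.cnt_le.trans h'.cnt_le
  old k hk := by
    have e := h.old k hk
    have e' := h'.old k (hk.trans_le h.cnt_le)
    exact ⟨e'.1.trans e.1, e'.2.1.trans e.2.1, e'.2.2.trans e.2.2⟩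
  count := h'.count.trans h.count

/-- `P'` arises from `P` by moving the elements with the least value of `κ` in the class of
positions from `a` up to `b` (exclusive) to the front, and by dividing the class after these
elements, at position `c`. -/
structure Extracts (κ : ℕ → ℝ) (a b c : ℕ) (P P' : Layout) (σ : Equiv.Perm ℕ) : Prop where
  lt : a < c
  le : c ≤ b
  inner : ∀ k, a < k → k < b → P.bd k = 0
  supp : ∀ i, i < a ∨ b ≤ i → σ i = i
  arr : P'.arr = P.arr ∘ σ
  least : ∃ m, (∀ i, a ≤ i → i < c → κ (P.arr (σ i)) = m) ∧
    ∀ i, c ≤ i → i < b → m < κ (P.arr (σ i))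
  push : (c = b ∧ P'.bd = P.bd ∧ P'.cnt = P.cnt ∧ P'.lft = P.lft ∧ P'.cut = P.cut ∧
      P'.rgt = P.rgt) ∨
    (c < b ∧ P'.bd = Function.update P.bd c 1 ∧ P'.cnt = P.cnt + 1 ∧
      P'.lft = Function.update P.lft P.cnt a ∧ P'.cut = Function.update P.cut P.cnt c ∧
      P'.rgt = Function.update P.rgt P.cnt b)

section Extracts

variable {κ : ℕ → ℝ} {a b c : ℕ} {P P' : Layout} {σ : Equiv.Perm ℕ}

theorem perm_mem_Ico {a b : ℕ} {σ : Equiv.Perm ℕ} (h : ∀ i, i < a ∨ b ≤ i → σ i = i) {i : ℕ}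
    (hi : a ≤ i ∧ i < b) : a ≤ σ i ∧ σ i < b := by
  by_contra e
  have := σ.injective (h (σ i) (by omega))
  omega

theorem Extracts.mem (h : Extracts κ a b c P P' σ) {i : ℕ} (hi : a ≤ i ∧ i < b) :
    a ≤ σ i ∧ σ i < b := perm_mem_Ico h.supp hi

theorem Extracts.bd_eq (h : Extracts κ a b c P P' σ) {k : ℕ} (hk : k ≠ c ∨ b ≤ k) :
    P'.bd k = P.bd k := by
  rcases h.push with ⟨_, e, _⟩ | ⟨hc, e, _⟩
  · rw [e]
  · rw [e, Function.update_of_ne (by omega)]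

theorem Extracts.bd_ne (h : Extracts κ a b c P P' σ) {k : ℕ} (hk : P.bd k ≠ 0) :
    P'.bd k ≠ 0 := by
  rcases h.push with ⟨_, e, _⟩ | ⟨_, e, _⟩
  · rwa [e]
  · rw [e]
    by_cases hkc : k = c
    · simp [hkc]
    · rwa [Function.update_of_ne hkc]

theorem Extracts.same (h : Extracts κ a b c P P' σ) (i : ℕ) : Same P.bd (σ i) i := by
  by_cases hi : a ≤ i ∧ i < b
  · have := h.mem hi
    exact fun m hm => h.inner m (by omega) (by omega)
  · rw [h.supp i (by omega)]
    exact Same.refl _ _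

/-- Recording the event keeps the queue well-formed, since the ends of the divided class are ends of
classes. -/
theorem Extracts.refines (h : Extracts κ a b c P P' σ) {n lo hi : ℕ} (hlo : lo ≤ a) (hhi : b ≤ hi)
    (hn : hi ≤ n) (ha : P.bd lo ≠ 0 → P.bd a ≠ 0) (hb : P.bd hi ≠ 0 → P.bd b ≠ 0) :
    Refines n lo hi P P' where
  perm := ⟨σ, h.arr, h.same, fun i hi => h.supp i (by omega)⟩
  bd_ne _ := h.bd_ne
  bd_out k hk := h.bd_eq (by have := h.lt; have := h.le; omega)
  cnt_le := by rcases h.push with ⟨_, _, e, _⟩ | ⟨_, _, e, _⟩ <;> omega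
  old k hk := by
    rcases h.push with ⟨_, _, _, e1, e2, e3⟩ | ⟨_, _, _, e1, e2, e3⟩
    · rw [e1, e2, e3]; exact ⟨rfl, rfl, rfl⟩
    · rw [e1, e2, e3]
      simp [Function.update_of_ne hk.ne]
  count := by
    rcases h.push with ⟨_, e0, e, _⟩ | ⟨hc, e0, e, _⟩
    · rw [e0, e]
    · rw [e, e0]
      have := nonStarts_update (n := n) (by omega) (h.inner c h.lt hc)
      omega
  queue hq h1 h2 := by
    have ha := ha h1
    have hb := hb h2
    have hlt := h.lt
    have hne : ∀ k, P.bd k ≠ 0 → P'.bd k ≠ 0 := fun _ => h.bd_ne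
    rcases h.push with ⟨_, e0, e, e1, e2, e3⟩ | ⟨hc, e0, e, e1, e2, e3⟩
    · refine ⟨?_, ?_, ?_⟩
      · rw [e0, e, e1, e2, e3]; exact hq.event
      · rw [e0, e, e1, e2, e3]; exact hq.cover
      · unfold Layout.size
        rw [e0, e, e1, e2, e3]; exact hq.total
    have old : ∀ k < P.cnt, P'.lft k = P.lft k ∧ P'.cut k = P.cut k ∧ P'.rgt k = P.rgt k := by
      intro k hk
      rw [e1, e2, e3]
      simp [Function.update_of_ne hk.ne]
    have new : P'.lft P.cnt = a ∧ P'.cut P.cnt = c ∧ P'.rgt P.cnt = b := by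
      rw [e1, e2, e3]
      simp
    refine ⟨fun k hk => ?_, fun i j hij hj hs => ?_, ?_⟩
    · rcases (show k < P.cnt ∨ k = P.cnt by omega) with hk | rfl
      · rw [(old k hk).1, (old k hk).2.1, (old k hk).2.2]
        have := hq.event k hk
        exact ⟨this.1, this.2.1, this.2.2.1, hne _ this.2.2.2.1, hne _ this.2.2.2.2.1,
          hne _ this.2.2.2.2.2⟩
      · rw [new.1, new.2.1, new.2.2]
        exact ⟨h.lt, hc, by omega, hne _ ha, by rw [e0]; simp, hne _ hb⟩
    · by_cases hs' : Same P.bd i j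
      · have hcm : i < c ∧ c ≤ j := by
          by_contra hcm
          refine hs fun m hm => ?_
          rw [e0, Function.update_of_ne (by omega)]
          exact hs' m hm
        have := hs'.le_iff ha
        have := hs'.le_iff hb
        exact ⟨P.cnt, by omega, by omega, by omega, by omega, by omega⟩
      · obtain ⟨k, hk, hk'⟩ := hq.cover i j hij hj hs'
        refine ⟨k, by omega, ?_⟩
        rw [(old k hk).1, (old k hk).2.1, (old k hk).2.2]
        exact hk'
    · rw [e, Finset.sum_range_succ]
      have e4 : ∑ k ∈ Finset.range P.cnt, P'.size k = ∑ k ∈ Finset.range P.cnt, P.size k := by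
        refine Finset.sum_congr rfl fun k hk => ?_
        have := old k (Finset.mem_range.1 hk)
        unfold Layout.size
        rw [this.1, this.2.1, this.2.2]
      have e5 : P'.size P.cnt = (c - a) * (b - c) := by
        unfold Layout.size
        rw [new.1, new.2.1, new.2.2]
      have := samePairs_update (n := n) h.lt hc (by omega) h.inner
      have := hq.total
      rw [e4, e5, e0]
      omega

end Extracts

/-- The classes of `P'` between `lo` and `hi` are obtained from those of `P` by sorting by `κ` and
dividing wherever `κ` changes, as far as the positions below `a` are concerned. -/
structure SortedTo (κ : ℕ → ℝ) (lo hi a : ℕ) (P P' : Layout) : Prop where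
  sep : ∀ j k, lo ≤ j → j < a → j < k → k < hi → Same P.bd j k → ¬ Same P'.bd j k →
    κ (P'.arr j) < κ (P'.arr k)
  const : ∀ j k, lo ≤ j → j < a → lo ≤ k → k < a → Same P'.bd j k → κ (P'.arr j) = κ (P'.arr k)

/-- Splitting off the elements with the least key, class by class and from the front of each class,
sorts all classes: `a` is the position reached so far, and `c` the next one. -/
theorem SortedTo.extracts {κ : ℕ → ℝ} {n lo hi a b c : ℕ} {P P' P'' : Layout} {σ : Equiv.Perm ℕ}
    (hr : Refines n lo hi P P') (h : SortedTo κ lo hi a P P') (he : Extracts κ a b c P' P'' σ)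
    (hb : b ≤ hi) (ha : a = lo ∨ P'.bd a ≠ 0)
    (hend : b = hi ∨ P'.bd b ≠ 0) (hbd : ∀ k, a < k → P'.bd k = P.bd k) :
    SortedTo κ lo hi c P P'' := by
  have hac := he.lt
  have hcb := he.le
  obtain ⟨m, hm1, hm2⟩ := he.least
  refine ⟨fun j k hj hjc hjk hk hs hs' => ?_, fun j k hj hjc hk hkc hs => ?_⟩
  · rw [he.arr]
    simp only [Function.comp_apply]
    by_cases hja : j < a
    · have ha' : P'.bd a ≠ 0 := by
        rcases ha with e | e
        · omega
        · exact e
      rw [he.supp j (by omega)]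
      have hks := he.same k
      by_cases hka : k < a
      · rw [he.supp k (by omega)]
        refine h.sep j k hj hja hjk hk hs fun e => hs' fun l hl => ?_
        rw [he.bd_eq (by omega)]
        exact e l hl
      · have h1 : a ≤ σ k := (hks.le_iff ha').2 (by omega)
        have h2 : σ k < hi := by
          by_cases e : k < b
          · exact (he.mem ⟨by omega, e⟩).2.trans_le hb
          · rw [he.supp k (by omega)]; exact hk
        refine h.sep j (σ k) hj hja (by omega) h2 (hs.trans (hks.symm.anti hr.bd_ne)) fun e => ?_
        exact ha' (e a (by omega))
    · have hkb : k < b := by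
        by_contra hkb
        rcases hend with e | e
        · omega
        · rw [hbd b (by omega)] at e
          exact e (hs b (by omega))
      have hck : c ≤ k := by
        by_contra hck
        refine hs' fun l hl => ?_
        rw [he.bd_eq (by omega)]
        exact he.inner l (by omega) (by omega)
      rw [hm1 j (by omega) hjc]
      exact hm2 k hck hkb
  · have main : ∀ j k, lo ≤ j → k < c → j < k → Same P''.bd j k →
        κ (P''.arr j) = κ (P''.arr k) := by
      intro j k hj hkc hjk hs
      rw [he.arr]
      simp only [Function.comp_apply]
      by_cases hka : k < a
      · rw [he.supp j (by omega), he.supp k (by omega)]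
        exact h.const j k hj (by omega) (by omega) hka (hs.anti fun _ => he.bd_ne)
      · by_cases hja : j < a
        · rcases ha with e | e
          · omega
          · exact absurd (hs a (by omega)) (he.bd_ne e)
        · rw [hm1 j (by omega) (by omega), hm1 k (by omega) hkc]
    rcases lt_trichotomy j k with e | e | e
    · exact main j k hj hkc e hs
    · rw [e]
    · exact (main k j hk hjc e hs.symm).symm

/-! ### Splitting off the elements with the least key -/

/-!
The programs share the following cells. Word register `0` holds `n`, real array `0` the distance
matrix, and real array `1` the output matrix. Word array `1` holds the arrangement of the elements,
and word array `2` is nonzero where classes start; word arrays `3`, `4`, `5` and word register `8`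
hold the queue of events, and word register `12` is its head. Real array `2` holds the keys by which
classes are divided, real array `3` the cut matrix, and real array `4` the search order. The other
registers hold loop counters and intermediate values.
-/

/-- The sequential composition of a list of programs. -/
def block : List Prog → Prog
  | [] => .skip
  | [c] => c
  | c :: l => .seq c (block l)

/-- The ordered partition held in memory: word arrays `1` to `5` and word register `8`. -/
def Memory.layout (s : Memory) : Layout :=
  ⟨s.warr 1, s.warr 2, s.warr 3, s.warr 4, s.warr 5, s.wreg 8⟩

/-- From position `wreg 2`, run `wreg 4` to the end of the class, or to `wreg 3`, and compute in
`rreg 1` the least key (real array `2`) of the elements passed. -/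
def findLeast : Prog := block [
  .setW 4 (.add (.reg 2) (.const 1)),
  .setR 1 (.arr 2 (.arr 1 (.reg 2))),
  .loop (.conj (.wle (.add (.reg 4) (.const 1)) (.reg 3)) (.wle (.arr 2 (.reg 4)) (.const 0)))
    (block [
      .cond (.rle (.reg 1) (.arr 2 (.arr 1 (.reg 4)))) .skip
        (.setR 1 (.arr 2 (.arr 1 (.reg 4)))),
      .setW 4 (.add (.reg 4) (.const 1))])]

/-- Move the elements between positions `wreg 2` and `wreg 4` whose key is at most `rreg 1` to the
front; `wreg 5` becomes the position after them. -/
def moveLeast : Prog := block [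
  .setW 5 (.reg 2),
  .setW 6 (.reg 2),
  forUp 6 4 (.cond (.rle (.arr 2 (.arr 1 (.reg 6))) (.reg 1))
    (block [
      .setW 7 (.arr 1 (.reg 6)),
      .storeW 1 (.reg 6) (.arr 1 (.reg 5)),
      .storeW 1 (.reg 5) (.reg 7),
      .setW 5 (.add (.reg 5) (.const 1))])
    .skip)]

/-- If `wreg 5` is less than `wreg 4`, start a class at `wreg 5` and append the event to the
queue. -/
def pushEvent : Prog :=
  .cond (.wle (.add (.reg 5) (.const 1)) (.reg 4))
    (block [
      .storeW 2 (.reg 5) (.const 1),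
      .storeW 3 (.reg 8) (.reg 2),
      .storeW 4 (.reg 8) (.reg 5),
      .storeW 5 (.reg 8) (.reg 4),
      .setW 8 (.add (.reg 8) (.const 1))])
    .skip

/-- Split off the elements with the least key of the class that starts at `wreg 2`. -/
def extractMin : Prog := block [findLeast, moveLeast, pushEvent]

/-- `findLeast` passes the class that starts at `wreg 2`, and the least key is attained in it. -/
theorem runs_findLeast {W : ℕ} {s : Memory} (hW : s.wreg 3 + 1 ≤ W) (hlt : s.wreg 2 < s.wreg 3) :
    Runs W findLeast s fun s' t =>
      s.wreg 2 < s'.wreg 4 ∧ s'.wreg 4 ≤ s.wreg 3 ∧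
      (∀ k, s.wreg 2 < k → k < s'.wreg 4 → s.warr 2 k = 0) ∧
      (s'.wreg 4 = s.wreg 3 ∨ s.warr 2 (s'.wreg 4) ≠ 0) ∧
      (∃ i, s.wreg 2 ≤ i ∧ i < s'.wreg 4 ∧ s.rarr 2 (s.warr 1 i) = s'.rreg 1) ∧
      (∀ i, s.wreg 2 ≤ i → i < s'.wreg 4 → s'.rreg 1 ≤ s.rarr 2 (s.warr 1 i)) ∧
      t ≤ 30 * (s'.wreg 4 - s.wreg 2) + 30 := by
  simp only [findLeast, block, runs_seq, runs_setW, runs_setR, WExp.Fits, WExp.eval, WExp.cost,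
    RExp.Fits, RExp.eval, RExp.cost, Memory.setW_wreg, Memory.setW_warr, Memory.setW_rarr]
  refine ⟨⟨trivial, by omega, by omega⟩, by simp, ?_⟩
  refine Runs.loop (I := fun s₁ t =>
      s.wreg 2 < s₁.wreg 4 ∧ s₁.wreg 4 ≤ s.wreg 3 ∧
      (∀ k, s.wreg 2 < k → k < s₁.wreg 4 → s.warr 2 k = 0) ∧
      (∃ i, s.wreg 2 ≤ i ∧ i < s₁.wreg 4 ∧ s.rarr 2 (s.warr 1 i) = s₁.rreg 1) ∧
      (∀ i, s.wreg 2 ≤ i → i < s₁.wreg 4 → s₁.rreg 1 ≤ s.rarr 2 (s.warr 1 i)) ∧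
      t + 30 ≤ 30 * (s₁.wreg 4 - s.wreg 2)) (fun s₁ => s.wreg 3 - s₁.wreg 4) ?_ ?_ ?_
  · simp only [Memory.setR_wreg, Memory.setW_wreg, Memory.setR_rreg, if_true]
    refine ⟨by omega, by omega, fun k h1 h2 => by omega, ⟨s.wreg 2, by simp⟩, fun i h1 h2 => ?_,
      by omega⟩
    rw [show i = s.wreg 2 by omega]
    simp
  · rintro s₁ t hf ⟨h1, h2, h3, h4, h5, h6⟩
    have e3 : s₁.wreg 3 = s.wreg 3 := by simpa using hf.wreg 3 (by decide)
    have a1 : s₁.warr 1 = s.warr 1 := by simpa using hf.warr 1 (by decide)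
    have a2 : s₁.warr 2 = s.warr 2 := by simpa using hf.warr 2 (by decide)
    have r2 : s₁.rarr 2 = s.rarr 2 := by simpa using hf.rarr 2 (by decide)
    simp only [Test.Fits, Test.Holds, Test.cost, WExp.Fits, WExp.eval, WExp.cost, e3, a2]
    refine ⟨⟨⟨⟨trivial, by omega, by omega⟩, trivial⟩, trivial, by omega⟩, fun ⟨hb1, hb2⟩ => ?_⟩
    simp only [runs_seq, runs_cond, runs_skip, runs_setR, runs_setW, Test.Fits, Test.Holds,
      Test.cost, RExp.Fits, RExp.eval, RExp.cost, WExp.Fits, WExp.eval, WExp.cost, a1, r2,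
      Memory.setW_wreg, Memory.setW_rreg, Memory.setR_wreg, Memory.setR_rreg, if_true]
    have hz : ∀ k, s.wreg 2 < k → k < s₁.wreg 4 + 1 → s.warr 2 k = 0 := by
      intro k hk hk'
      rcases (show k < s₁.wreg 4 ∨ k = s₁.wreg 4 by omega) with e | e
      · exact h3 k hk e
      · rw [e]; omega
    refine ⟨by simp, fun hle => ?_, fun hle => ?_⟩
    · refine ⟨⟨trivial, by omega, by omega⟩, ⟨by omega, by omega, hz, ?_, ?_, by omega⟩, by omega⟩
      · obtain ⟨i, hi⟩ := h4
        exact ⟨i, hi.1, by omega, hi.2.2⟩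
      · intro i hi hi'
        rcases (show i < s₁.wreg 4 ∨ i = s₁.wreg 4 by omega) with e | e
        · exact h5 i hi e
        · rw [e]; exact hle
    · refine ⟨by simp, ⟨trivial, by omega, by omega⟩,
        ⟨by omega, by omega, hz, ⟨s₁.wreg 4, by omega, by omega, rfl⟩, ?_, by omega⟩, by omega⟩
      intro i hi hi'
      rcases (show i < s₁.wreg 4 ∨ i = s₁.wreg 4 by omega) with e | e
      · exact (not_le.1 hle).le.trans (h5 i hi e)
      · rw [e]
  · rintro s₁ t hf ⟨h1, h2, h3, h4, h5, h6⟩ hb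
    have e3 : s₁.wreg 3 = s.wreg 3 := by simpa using hf.wreg 3 (by decide)
    have a2 : s₁.warr 2 = s.warr 2 := by simpa using hf.warr 2 (by decide)
    simp only [Test.Holds, WExp.eval, e3, a2] at hb
    refine ⟨h1, h2, h3, ?_, h4, h5, ?_⟩
    · by_cases e : s₁.wreg 4 = s.wreg 3
      · exact Or.inl e
      · exact Or.inr fun e' => hb ⟨by omega, by omega⟩
    · simp only [Test.cost, WExp.cost]
      omega

theorem update_update_eq_comp_swap (f : ℕ → ℕ) (i j : ℕ) :
    Function.update (Function.update f j (f i)) i (f j) = f ∘ Equiv.swap i j := by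
  funext k
  by_cases hi : k = i
  · simp [hi]
  · by_cases hj : k = j
    · subst hj
      simp [hi]
    · simp [hi, hj, Equiv.swap_apply_of_ne_of_ne hi hj]

/-- `moveLeast` permutes the elements of the class by transpositions, moving those with key at most
`rreg 1` to the front. -/
theorem runs_moveLeast {W : ℕ} {s : Memory} (hW : s.wreg 4 + 1 ≤ W) (hlt : s.wreg 2 < s.wreg 4) :
    Runs W moveLeast s fun s' t => ∃ σ : Equiv.Perm ℕ,
      s.wreg 2 ≤ s'.wreg 5 ∧ s'.wreg 5 ≤ s.wreg 4 ∧
      (∀ i, i < s.wreg 2 ∨ s.wreg 4 ≤ i → σ i = i) ∧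
      s'.warr 1 = s.warr 1 ∘ σ ∧
      (∀ i, s.wreg 2 ≤ i → i < s'.wreg 5 → s.rarr 2 (s.warr 1 (σ i)) ≤ s.rreg 1) ∧
      (∀ i, s'.wreg 5 ≤ i → i < s.wreg 4 → s.rreg 1 < s.rarr 2 (s.warr 1 (σ i))) ∧
      t ≤ 40 * (s.wreg 4 - s.wreg 2) + 10 := by
  simp only [moveLeast, block, runs_seq, runs_setW, WExp.Fits, WExp.eval, WExp.cost,
    Memory.setW_wreg]
  refine ⟨trivial, trivial, ?_⟩
  refine Runs.forUp (fun j s₁ t => ∃ σ : Equiv.Perm ℕ,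
      s.wreg 2 ≤ s₁.wreg 5 ∧ s₁.wreg 5 ≤ j ∧
      (∀ i, i < s.wreg 2 ∨ s.wreg 4 ≤ i → σ i = i) ∧
      s₁.warr 1 = s.warr 1 ∘ σ ∧
      (∀ i, s.wreg 2 ≤ i → i < s₁.wreg 5 → s.rarr 2 (s.warr 1 (σ i)) ≤ s.rreg 1) ∧
      (∀ i, s₁.wreg 5 ≤ i → i < j → s.rreg 1 < s.rarr 2 (s.warr 1 (σ i))) ∧
      t ≤ 40 * (j - s.wreg 2)) ?_ ?_ ?_ ?_ ?_
  · simpa using hW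
  · simpa using hlt.le
  · exact ⟨1, by simp, by simp, by simp, rfl, by simp; omega, by simp; omega, by simp⟩
  · rintro j s₁ t hf hj hj' h6 - ⟨σ, h1, h2, h3, h4, h5, h7, h8⟩
    simp at hj hj'
    have r2 : s₁.rarr 2 = s.rarr 2 := by simpa using hf.rarr 2 (by decide)
    have r1 : s₁.rreg 1 = s.rreg 1 := by simpa using hf.rreg 1 (by decide)
    simp only [block, runs_seq, runs_cond, runs_skip, runs_storeW, runs_setW, Test.Fits, Test.Holds,
      Test.cost, RExp.Fits, RExp.eval, RExp.cost, WExp.Fits, WExp.eval, WExp.cost, r1, r2, h6,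
      Memory.setW_wreg, Memory.setW_warr, Memory.storeW_wreg, Memory.storeW_warr, if_true,
      reduceIte, Nat.reduceEqDiff, OfNat.one_ne_ofNat, OfNat.ofNat_ne_one, and_true, true_and]
    refine ⟨fun hle => ⟨⟨by omega, by omega⟩, σ * Equiv.swap (s₁.wreg 5) j, by omega, by omega,
      ?_, ?_, ?_, ?_, by omega⟩, fun hle => ⟨σ, h1, by omega, h3, h4, h5, ?_, by omega⟩⟩
    · intro i hi
      rw [Equiv.Perm.mul_apply, Equiv.swap_apply_of_ne_of_ne (by omega) (by omega)]
      exact h3 i hi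
    · rw [update_update_eq_comp_swap, h4]
      rfl
    · intro i hi hi'
      rw [Equiv.Perm.mul_apply]
      rcases (show i < s₁.wreg 5 ∨ i = s₁.wreg 5 by omega) with e | e
      · rw [Equiv.swap_apply_of_ne_of_ne (by omega) (by omega)]
        exact h5 i hi e
      · rw [e, Equiv.swap_apply_left]
        rw [h4] at hle
        exact hle
    · intro i hi hi'
      rw [Equiv.Perm.mul_apply]
      rcases (show i < j ∨ i = j by omega) with e | e
      · rw [Equiv.swap_apply_of_ne_of_ne (by omega) (by omega)]
        exact h7 i (by omega) e
      · rw [e, Equiv.swap_apply_right]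
        exact h7 _ le_rfl (by omega)
    · intro i hi hi'
      rcases (show i < j ∨ i = j by omega) with e | e
      · exact h7 i hi e
      · rw [h4] at hle
        rw [e]
        exact not_le.1 hle
  · rintro s₁ t hf - ⟨σ, h1, h2, h3, h4, h5, h6, h7⟩
    simp at h2 h6 h7
    exact ⟨σ, h1, h2, h3, h4, h5, h6, by omega⟩

/-- The effect of `extractMin`; the steps are linear in the size of the class. -/
theorem runs_extractMin {W : ℕ} {s : Memory} (hW : s.wreg 3 + 1 ≤ W) (hcnt : s.wreg 8 + 1 ≤ W)
    (hW1 : 1 ≤ W) (hlt : s.wreg 2 < s.wreg 3) :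
    Runs W extractMin s fun s' t => ∃ b σ,
      Extracts (s.rarr 2) (s.wreg 2) b (s'.wreg 5) s.layout s'.layout σ ∧
      b ≤ s.wreg 3 ∧ (b = s.wreg 3 ∨ s.warr 2 b ≠ 0) ∧ t ≤ 160 * (b - s.wreg 2) := by
  simp only [extractMin, block, runs_seq]
  refine (runs_findLeast hW hlt).mono ?_
  rintro s₁ t₁ hf₁ ⟨h1, h2, h3, h4, h5, h6, h7⟩
  have e2 : s₁.wreg 2 = s.wreg 2 := hf₁.wreg 2 (by decide)
  have a1 : s₁.warr = s.warr := funext fun a => hf₁.warr a (by simp [findLeast, block, Prog.warrs])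
  have e8 : s₁.wreg 8 = s.wreg 8 := hf₁.wreg 8 (by decide)
  have r2 : s₁.rarr 2 = s.rarr 2 := hf₁.rarr 2 (by decide)
  refine (runs_moveLeast (s := s₁) (by omega) (by omega)).mono ?_
  rintro s₂ t₂ hf₂ ⟨σ, g1, g2, g3, g4, g5, g6, g7⟩
  rw [e2] at g1 g3 g5 g7
  rw [a1] at g4 g5 g6
  rw [r2] at g5 g6
  have e2' : s₂.wreg 2 = s.wreg 2 := (hf₂.wreg 2 (by decide)).trans e2
  have e4' : s₂.wreg 4 = s₁.wreg 4 := hf₂.wreg 4 (by decide)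
  have e8' : s₂.wreg 8 = s.wreg 8 := (hf₂.wreg 8 (by decide)).trans e8
  have a : ∀ x, x ≠ 1 → s₂.warr x = s.warr x := fun x hx =>
    (hf₂.warr x (by simpa [moveLeast, block, forUp, Prog.warrs] using hx)).trans (by rw [a1])
  -- the least key is attained, so that at least one element is moved
  have hlt' : s.wreg 2 < s₂.wreg 5 := by
    obtain ⟨i, hi1, hi2, hi3⟩ := h5
    by_contra hcon
    have hmem := perm_mem_Ico (σ := σ⁻¹) (a := s.wreg 2) (b := s₁.wreg 4)
      (fun k hk => by rw [Equiv.Perm.inv_eq_iff_eq, g3 k hk]) ⟨hi1, hi2⟩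
    have := g6 (σ⁻¹ i) (by omega) hmem.2
    rw [show σ (σ⁻¹ i) = i from σ.apply_symm_apply i, hi3] at this
    exact lt_irrefl _ this
  have hleast : ∃ m, (∀ i, s.wreg 2 ≤ i → i < s₂.wreg 5 → s.rarr 2 (s.warr 1 (σ i)) = m) ∧
      ∀ i, s₂.wreg 5 ≤ i → i < s₁.wreg 4 → m < s.rarr 2 (s.warr 1 (σ i)) := by
    refine ⟨s₁.rreg 1, fun i hi hi' => le_antisymm (g5 i hi hi') ?_, g6⟩
    have := perm_mem_Ico g3 (i := i) ⟨hi, by omega⟩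
    exact h6 _ this.1 this.2
  simp only [pushEvent, block, runs_cond, runs_seq, runs_storeW, runs_setW, runs_skip, Test.Fits,
    Test.Holds, Test.cost, WExp.Fits, WExp.eval, WExp.cost, e4', e8', e2']
  refine ⟨⟨⟨trivial, hW1, by omega⟩, trivial⟩, fun hc => ⟨trivial, hW1, trivial, trivial, trivial,
    trivial, trivial, trivial, ⟨trivial, hW1, ?_⟩, s₁.wreg 4, σ, ?_, h2, h4, by omega⟩, fun hc =>
    ⟨s₁.wreg 4, σ, ?_, h2, h4, by omega⟩⟩
  · simpa [e8'] using hcnt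
  · refine ⟨by simpa using hlt', by simpa using g2, h3, g3, by simp [Memory.layout, g4], ?_,
      Or.inr ⟨by simp; omega, ?_, ?_, ?_, ?_, ?_⟩⟩
    · simpa [Memory.layout] using hleast
    all_goals simp [Memory.layout, e8', e2', e4', a]
  · refine ⟨hlt', g2, h3, g3, by simp [Memory.layout, g4], by simpa [Memory.layout] using hleast,
      Or.inl ⟨by omega, ?_⟩⟩
    simp [Memory.layout, e8', a]

/-! ### Refining classes by a pivot -/

/-- The key of the element `x` for the pivot `w`. With `sg = 1` and `M` the distance matrix, it is
the Gromov product of `w` and `x` based at the element `0`, up to a term that depends on `w`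
only. -/
def pivotKey (M : ℕ → ℝ) (n w : ℕ) (sg : ℝ) (x : ℕ) : ℝ := sg * (M x - M (w * n + x))

/-- Refine all classes between the positions `wreg 10` and `wreg 3` by the key for the pivot
`wreg 9`, with sign `rreg 2`. -/
def refineRange : Prog := block [
  .setW 11 (.reg 10),
  forUp 11 3 (.storeR 2 (.arr 1 (.reg 11)) (.mul (.reg 2) (.sub (.arr 0 (.arr 1 (.reg 11)))
    (.arr 0 (.add (.mul (.reg 9) (.reg 0)) (.arr 1 (.reg 11))))))),
  .setW 2 (.reg 10),
  .loop (.wle (.add (.reg 2) (.const 1)) (.reg 3)) (.seq extractMin (.setW 2 (.reg 5)))]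

theorem Extracts.congr {κ κ' : ℕ → ℝ} {a b c : ℕ} {P P' : Layout} {σ : Equiv.Perm ℕ}
    (h : Extracts κ a b c P P' σ) (hκ : ∀ i, a ≤ i → i < b → κ (P.arr i) = κ' (P.arr i)) :
    Extracts κ' a b c P P' σ := by
  refine ⟨h.lt, h.le, h.inner, h.supp, h.arr, ?_, h.push⟩
  obtain ⟨m, h1, h2⟩ := h.least
  have := h.lt
  have := h.le
  refine ⟨m, fun i hi hi' => ?_, fun i hi hi' => ?_⟩
  · have := h.mem (i := i) ⟨hi, by omega⟩
    rw [← hκ _ this.1 this.2]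
    exact h1 i hi hi'
  · have := h.mem (i := i) ⟨by omega, hi'⟩
    rw [← hκ _ this.1 this.2]
    exact h2 i hi hi'

theorem Refines.arr_mem {n lo hi : ℕ} {P P' : Layout} (h : Refines n lo hi P P') {i : ℕ}
    (hi' : lo ≤ i ∧ i < hi) : ∃ i', (lo ≤ i' ∧ i' < hi) ∧ P'.arr i = P.arr i' := by
  obtain ⟨σ, h1, -, h3⟩ := h.perm
  exact ⟨σ i, perm_mem_Ico h3 hi', by rw [h1]; rfl⟩

/-- The effect of `refineRange`. Besides the steps linear in the length of the range, each new
class costs a number of steps linear in `n`. -/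
theorem runs_refineRange {W n : ℕ} {s : Memory} (hn : s.wreg 0 = n) (hW : (n + 2) ^ 2 ≤ W)
    (hlo : s.wreg 10 ≤ s.wreg 3) (hhi : s.wreg 3 ≤ n) (hw : s.wreg 9 < n)
    (harr : ∀ i < n, s.warr 1 i < n) (hcnt : s.wreg 8 + nonStarts n (s.warr 2) ≤ n) :
    Runs W refineRange s fun s' t =>
      Refines n (s.wreg 10) (s.wreg 3) s.layout s'.layout ∧
      SortedTo (pivotKey (s.rarr 0) n (s.wreg 9) (s.rreg 2)) (s.wreg 10) (s.wreg 3) (s.wreg 3)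
        s.layout s'.layout ∧
      t + 170 * (n + 1) * nonStarts n (s'.warr 2) ≤
        170 * (n + 1) * nonStarts n (s.warr 2) + 200 * (s.wreg 3 - s.wreg 10) + 20 := by
  have hnW : n + 2 ≤ W := le_trans (by nlinarith) hW
  set κ := pivotKey (s.rarr 0) n (s.wreg 9) (s.rreg 2) with hκ
  simp only [refineRange, block, runs_seq, runs_setW, WExp.Fits, WExp.eval, WExp.cost, true_and]
  refine Runs.forUp (fun q s₁ t => (∀ i, s.wreg 10 ≤ i → i < q →
    s₁.rarr 2 (s.warr 1 i) = κ (s.warr 1 i)) ∧ t ≤ 30 * (q - s.wreg 10)) ?_ ?_ ?_ ?_ ?_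
  · simp; omega
  · simpa using hlo
  · refine ⟨fun i h1 h2 => ?_, by simp⟩
    simp only [Memory.setW_wreg, reduceIte] at h2
    omega
  · rintro q s₁ t hf hq hq' e11 - ⟨hI, ht⟩
    simp at hq hq'
    have e0 : s₁.wreg 0 = n := by simpa [hn] using hf.wreg 0 (by decide)
    have e9 : s₁.wreg 9 = s.wreg 9 := by simpa using hf.wreg 9 (by decide)
    have a1 : s₁.warr 1 = s.warr 1 := by simpa using hf.warr 1 (by decide)
    have r0 : s₁.rarr 0 = s.rarr 0 := by simpa using hf.rarr 0 (by decide)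
    have r2 : s₁.rreg 2 = s.rreg 2 := by simpa using hf.rreg 2 (by decide)
    have hx := harr q (by omega)
    simp only [runs_storeR, RExp.Fits, RExp.eval, RExp.cost, WExp.Fits, WExp.eval, WExp.cost, e0,
      e9, a1, r0, r2, e11, Memory.setW_rarr, Memory.storeR_rarr, reduceIte, true_and, and_true]
    refine ⟨⟨by nlinarith, by nlinarith⟩, fun i hi hi' => ?_, by omega⟩
    by_cases e : s.warr 1 i = s.warr 1 q
    · rw [e, Function.update_self]
      rfl
    · rw [Function.update_of_ne e]
      refine hI i hi ?_
      by_contra h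
      exact e (by rw [show i = q by omega])
  rintro s₁ t₁ hf₁ - ⟨hI, ht₁⟩
  simp at hI ht₁
  have e0 : s₁.wreg 0 = n := by simpa [hn] using hf₁.wreg 0 (by decide)
  have e10 : s₁.wreg 10 = s.wreg 10 := by simpa using hf₁.wreg 10 (by decide)
  have e3 : s₁.wreg 3 = s.wreg 3 := by simpa using hf₁.wreg 3 (by decide)
  have e8 : s₁.wreg 8 = s.wreg 8 := by simpa using hf₁.wreg 8 (by decide)
  have ha : s₁.warr = s.warr := funext fun a => by
    simpa using hf₁.warr a (by simp [forUp, Prog.warrs])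
  have hP : s₁.layout = s.layout := by simp [Memory.layout, ha, e8]
  refine Runs.loop (I := fun s₂ t => s.wreg 10 ≤ s₂.wreg 2 ∧ s₂.wreg 2 ≤ s.wreg 3 ∧
      Refines n (s.wreg 10) (s.wreg 3) s.layout s₂.layout ∧
      SortedTo κ (s.wreg 10) (s.wreg 3) (s₂.wreg 2) s.layout s₂.layout ∧
      (s₂.wreg 2 = s.wreg 10 ∨ s₂.wreg 2 = s.wreg 3 ∨ s₂.warr 2 (s₂.wreg 2) ≠ 0) ∧
      (∀ k, s₂.wreg 2 < k → s₂.warr 2 k = s.warr 2 k) ∧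
      t + 170 * (n + 1) * nonStarts n (s₂.warr 2) ≤
        170 * (n + 1) * nonStarts n (s.warr 2) + 170 * (s₂.wreg 2 - s.wreg 10))
      (fun s₂ => s.wreg 3 - s₂.wreg 2) ?_ ?_ ?_
  · simp only [Memory.setW_wreg, Memory.setW_warr, reduceIte, e10, ha]
    have : (s₁.setW 2 (s.wreg 10)).layout = s.layout := by
      rw [← hP]; rfl
    rw [this]
    exact ⟨le_rfl, hlo, Refines.refl _ _ _ _,
      ⟨fun j k h1 h2 => by omega, fun j k h1 h2 => by omega⟩,
      Or.inl trivial, fun _ _ => trivial, by omega⟩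
  · rintro s₂ t hf₂ ⟨h1, h2, h3, h4, h5, h6, h7⟩
    have e3' : s₂.wreg 3 = s.wreg 3 := by simpa [e3] using hf₂.wreg 3 (by decide)
    have r2 : ∀ i, s.wreg 10 ≤ i → i < s.wreg 3 →
        s₂.rarr 2 (s₂.layout.arr i) = κ (s₂.layout.arr i) := by
      intro i hi hi'
      have : s₂.rarr 2 = s₁.rarr 2 := by simpa using hf₂.rarr 2 (by decide)
      obtain ⟨i', hi1, hi2⟩ := h3.arr_mem ⟨hi, hi'⟩
      rw [this, hi2]
      exact hI i' hi1.1 hi1.2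
    refine ⟨⟨⟨trivial, by show 1 ≤ W; omega, ?_⟩, trivial⟩, fun hb => ?_⟩
    · simp only [WExp.eval]; omega
    simp only [Test.Holds, WExp.eval, e3'] at hb
    have hcnt' : s₂.wreg 8 + nonStarts n (s₂.warr 2) ≤ n := h3.count.le.trans hcnt
    rw [runs_seq]
    refine (runs_extractMin (s := s₂) (by omega) (by omega) (by omega) (by omega)).mono ?_
    rintro s₃ t₃ hf₃ ⟨b, σ, he, hb1, hb2, ht₃⟩
    rw [e3'] at hb1 hb2
    have he' := he.congr (κ' := κ) fun i hi hi' => r2 i (by omega) (by omega)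
    have e2 : s₃.wreg 2 = s₂.wreg 2 := hf₃.wreg 2 (by decide)
    have hlt := he.lt
    have hle := he.le
    have hlay : (s₃.setW 2 (s₃.wreg 5)).layout = s₃.layout := rfl
    have href : Refines n (s.wreg 10) (s.wreg 3) s₂.layout s₃.layout := by
      refine he.refines h1 hb1 hhi (fun h => ?_) (fun h => ?_)
      · rcases h5 with e | e | e
        · rw [e]; exact h
        · omega
        · exact e
      · rcases hb2 with e | e
        · rw [e]; exact h
        · exact e
    simp only [runs_setW, WExp.Fits, WExp.eval, WExp.cost, Memory.setW_wreg, Memory.setW_warr,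
      reduceIte, true_and, hlay, Test.cost]
    refine ⟨⟨by omega, by omega, h3.trans href, ?_, ?_, fun k hk => ?_, ?_⟩, by omega⟩
    · refine h4.extracts h3 he' hb1 ?_ hb2 h6
      rcases h5 with e | e | e
      · exact Or.inl e
      · omega
      · exact Or.inr e
    · rcases he.push with ⟨e, e', _⟩ | ⟨e, e', _⟩
      · rcases hb2 with e'' | e''
        · exact Or.inr (Or.inl (by omega))
        · refine Or.inr (Or.inr ?_)
          change s₃.warr 2 = s₂.warr 2 at e'
          rw [e', e]
          exact e''
      · refine Or.inr (Or.inr ?_)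
        change s₃.warr 2 = _ at e'
        rw [e']
        simp
    · rw [← h6 k (by omega)]
      exact he.bd_eq (Or.inl (by omega))
    · -- either the whole class is passed, or a new class pays for the steps
      have hc : s₃.layout.cnt + nonStarts n (s₃.warr 2) =
        s₂.layout.cnt + nonStarts n (s₂.warr 2) := href.count
      rcases he.push with ⟨e, -, e', _⟩ | ⟨e, -, e', _⟩
      · have e1 : nonStarts n (s₃.warr 2) = nonStarts n (s₂.warr 2) := by omega
        rw [e1]
        omega
      · have e1 : nonStarts n (s₂.warr 2) = nonStarts n (s₃.warr 2) + 1 := by omega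
        rw [e1, mul_add] at h7
        omega
  · rintro s₂ t hf₂ ⟨h1, h2, h3, h4, h5, h6, h7⟩ hb
    have e3' : s₂.wreg 3 = s.wreg 3 := by simpa [e3] using hf₂.wreg 3 (by decide)
    simp only [Test.Holds, WExp.eval, e3'] at hb
    have : s₂.wreg 2 = s.wreg 3 := by omega
    rw [this] at h4 h7
    refine ⟨h3, h4, ?_⟩
    simp only [Test.cost, WExp.cost]
    omega

/-! ### Invariants of the search and of the ordered partition refinement -/

/-- `f` permutes the numbers below `n`. -/
def IsPerm (n : ℕ) (f : ℕ → ℕ) : Prop :=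
  (∀ i < n, f i < n) ∧ ∀ i < n, ∀ j < n, f i = f j → i = j

theorem IsPerm.exists_eq {n : ℕ} {f : ℕ → ℕ} (h : IsPerm n f) {x : ℕ} (hx : x < n) :
    ∃ i < n, f i = x := by
  have := Finset.surjOn_of_injOn_of_card_le (s := Finset.range n) (t := Finset.range n) f
    (fun i hi => by simpa using h.1 i (by simpa using hi))
    (fun i hi j hj => h.2 i (by simpa using hi) j (by simpa using hj)) le_rfl
  obtain ⟨i, hi, e⟩ := this (by simpa using hx)
  exact ⟨i, by simpa using hi, e⟩

theorem IsPerm.refines {n lo hi : ℕ} {P P' : Layout} (h : IsPerm n P.arr)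
    (hr : Refines n lo hi P P') (hn : hi ≤ n) : IsPerm n P'.arr := by
  obtain ⟨σ, h1, -, h3⟩ := hr.perm
  have hσ : ∀ i < n, σ i < n := fun i hi =>
    (perm_mem_Ico (a := 0) (b := n) (fun k hk => h3 k (by omega)) ⟨by omega, hi⟩).2
  rw [h1]
  exact ⟨fun i hi => h.1 _ (hσ i hi), fun i hi j hj e =>
    σ.injective (h.2 _ (hσ i hi) _ (hσ j hj) e)⟩

/-- `κ` is an affine function of the similarity to `w`, with slope `sg`. -/
def IsKey (G : ℕ → ℕ → ℝ) (n w : ℕ) (sg : ℝ) (κ : ℕ → ℝ) : Prop :=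
  ∃ e : ℝ, ∀ x < n, κ x = sg * G w x + e

section Search

variable {G : ℕ → ℕ → ℝ} {n : ℕ} {P P' : Layout} {κ : ℕ → ℝ}

/-- The state of the similarity-first search when the elements at the positions below `i` have been
listed and have divided the classes of the remaining elements. -/
structure SearchInv (G : ℕ → ℕ → ℝ) (n i : ℕ) (P : Layout) : Prop where
  perm : IsPerm n P.arr
  sep : ∀ j k, j < k → k < n → ¬ Same P.bd j k →
    (j < i ∧ ∀ v < j, G (P.arr v) (P.arr j) = G (P.arr v) (P.arr k)) ∨
    ∃ v < j, v < i ∧ G (P.arr v) (P.arr k) < G (P.arr v) (P.arr j) ∧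
      ∀ v' < v, G (P.arr v') (P.arr j) = G (P.arr v') (P.arr k)
  const : ∀ j k, j < n → k < n → Same P.bd j k → ∀ v < i,
    G (P.arr v) (P.arr j) = G (P.arr v) (P.arr k)
  start : ∀ j, 0 < j → j ≤ i → P.bd j ≠ 0

/-- Positions of different classes stay in their order if elements move within classes. -/
theorem Same.lt_of_not_same {bd : ℕ → ℕ} {j k j' k' : ℕ} (hjk : j < k) (h : ¬ Same bd j k)
    (hj : Same bd j' j) (hk : Same bd k' k) : j' < k' ∧ ¬ Same bd j' k' := by
  refine ⟨?_, fun e => h (hj.symm.trans (e.trans hk))⟩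
  simp only [Same, not_forall] at h
  obtain ⟨m, hm, hm0⟩ := h
  have := hj.le_iff hm0
  have := hk.le_iff hm0
  omega

/-- The element at position `i` is listed next; it divides the later classes, the elements most
similar to it coming first. -/
theorem SearchInv.refine {i : ℕ} {P₁ : Layout} (h : SearchInv G n i P) (hi : i < n)
    (harr : P₁.arr = P.arr) (hbd : P₁.bd = Function.update P.bd (i + 1) 1)
    (hr : Refines n (i + 1) n P₁ P') (hs : SortedTo κ (i + 1) n n P₁ P')
    (hκ : IsKey G n (P.arr i) (-1) κ) : SearchInv G n (i + 1) P' := by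
  have hperm : IsPerm n P₁.arr := by rw [harr]; exact h.perm
  have hperm' := hperm.refines hr le_rfl
  obtain ⟨e, he⟩ := hκ
  obtain ⟨σ, h1, h2, h3⟩ := hr.perm
  rw [harr] at h1
  have harr' : ∀ k, P'.arr k = P.arr (σ k) := fun k => by rw [h1]; rfl
  have hbd1 : ∀ k, P.bd k ≠ 0 → P₁.bd k ≠ 0 := by
    intro k hk
    rw [hbd]
    by_cases e : k = i + 1
    · simp [e]
    · rwa [Function.update_of_ne e]
  have hfix : ∀ v, v ≤ i → P'.arr v = P.arr v := fun v hv => by rw [harr', h3 v (by omega)]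
  have hσn : ∀ k < n, σ k < n := fun k hk =>
    (perm_mem_Ico (a := 0) (b := n) (fun l hl => h3 l (by omega)) ⟨by omega, hk⟩).2
  have hσ0 : ∀ k, Same P.bd (σ k) k := fun k => (h2 k).anti hbd1
  have hstart : ∀ j, 0 < j → j ≤ i + 1 → P'.bd j ≠ 0 := by
    intro j h0 hj
    refine hr.bd_ne j ?_
    by_cases e : j = i + 1
    · rw [hbd, e]; simp
    · exact hbd1 j (h.start j h0 (by omega))
  have hold : ∀ j k, j < n → k < n → Same P.bd j k → ∀ v < i,
      G (P'.arr v) (P'.arr j) = G (P'.arr v) (P'.arr k) := by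
    intro j k hj hk hjk v hv
    rw [hfix v hv.le, harr', harr']
    exact h.const _ _ (hσn j hj) (hσn k hk) ((hσ0 j).trans (hjk.trans (hσ0 k).symm)) v hv
  refine ⟨hperm', fun j k hjk hk hsame => ?_, fun j k hj hk hsame v hv => ?_, hstart⟩
  · by_cases hs1 : Same P₁.bd j k
    · have hj : i + 1 ≤ j := by
        by_contra hj
        have := hs1 (j + 1) (by omega)
        by_cases e : j = i
        · rw [hbd, e] at this; simp at this
        · exact hbd1 _ (h.start (j + 1) (by omega) (by omega)) this
      have hlt := hs.sep j k hj (by omega) hjk hk hs1 hsame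
      rw [he _ (hperm'.1 j (by omega)), he _ (hperm'.1 k hk)] at hlt
      refine Or.inr ⟨i, by omega, by omega, ?_, fun v hv => hold j k (by omega) hk ?_ v hv⟩
      · rw [hfix i le_rfl]; linarith
      · exact hs1.anti hbd1
    · by_cases hs0 : Same P.bd j k
      · have hji : j = i := by
          have : j ≤ i := by
            by_contra hj
            refine hs1 fun m hm => ?_
            rw [hbd, Function.update_of_ne (by omega)]
            exact hs0 m hm
          by_contra hne
          exact h.start (j + 1) (by omega) (by omega) (hs0 (j + 1) (by omega))
        exact Or.inl ⟨by omega, fun v hv => hold j k (by omega) hk hs0 v (by omega)⟩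
      · obtain ⟨hlt, hns⟩ := Same.lt_of_not_same hjk hs0 (hσ0 j) (hσ0 k)
        have hji : σ j < i → j = σ j := fun hj => σ.injective (h3 (σ j) (by omega)).symm
        have hji' : j < i → σ j = j := fun hj => h3 j (by omega)
        rcases h.sep _ _ hlt (hσn k hk) hns with ⟨hj, hv⟩ | ⟨v, hv, hvi, hlt', heq⟩
        · refine Or.inl ⟨by have := hji hj; omega, fun v hvj => ?_⟩
          have := hji hj
          rw [harr' j, harr' k, hfix v (by omega)]
          exact hv v (by omega)
        · refine Or.inr ⟨v, ?_, by omega, ?_, fun v' hv' => ?_⟩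
          · by_contra hvj
            have := hji' (by omega)
            omega
          · rw [harr' j, harr' k, hfix v (by omega)]; exact hlt'
          · rw [harr' j, harr' k, hfix v' (by omega)]; exact heq v' hv'
  · have hs1 : Same P₁.bd j k := hsame.anti hr.bd_ne
    by_cases hvi : v < i
    · exact hold j k hj hk (hs1.anti hbd1) v hvi
    obtain rfl : v = i := by omega
    have hcase : j = k ∨ (v + 1 ≤ j ∧ v + 1 ≤ k) := by
      by_contra hc
      exact hstart (min j k + 1) (by omega) (by omega) (hsame _ (by omega))
    rcases hcase with rfl | ⟨hj', hk'⟩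
    · rfl
    · have := hs.const j k hj' hj hk' hk hsame
      rw [he _ (hperm'.1 j hj), he _ (hperm'.1 k hk)] at this
      rw [hfix v le_rfl]
      linarith

/-- When all elements have been listed, all classes are singletons, and the positions form a
search order. -/
theorem SearchInv.searchOrder (h : SearchInv G n n P) {rank : ℕ → ℕ}
    (hrank : ∀ i < n, rank (P.arr i) = i) : SearchOrder G rank (Finset.range n) := by
  intro x hx y hy hxy
  obtain ⟨j, hj, rfl⟩ := h.perm.exists_eq (Finset.mem_range.1 hx)
  obtain ⟨k, hk, rfl⟩ := h.perm.exists_eq (Finset.mem_range.1 hy)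
  rw [hrank j hj, hrank k hk] at hxy
  have hns : ¬ Same P.bd j k := fun e => h.start k (by omega) (by omega) (e k (by omega))
  rw [hrank j hj]
  have lift : ∀ m ≤ n, ∀ p : ℕ → Prop, (∀ v < m, p (P.arr v)) →
      ∀ v ∈ Finset.range n, rank v < m → p v := by
    intro m hm p hp v hv hvm
    obtain ⟨l, hl, rfl⟩ := h.perm.exists_eq (Finset.mem_range.1 hv)
    rw [hrank l hl] at hvm
    exact hp l hvm
  rcases h.sep j k hxy hk hns with ⟨-, hv⟩ | ⟨v, hv, -, hlt, heq⟩
  · exact Or.inl (lift j hj.le _ hv)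
  · refine Or.inr ⟨P.arr v, Finset.mem_range.2 (h.perm.1 v (by omega)), ?_, hlt, ?_⟩
    · rwa [hrank v (by omega)]
    · rw [hrank v (by omega)]
      exact lift v (by omega) (fun w => G w (P.arr j) = G w (P.arr k)) heq

end Search

section Refinement

variable {G : ℕ → ℕ → ℝ} {n : ℕ} {P P' : Layout} {κ : ℕ → ℝ}

/-- No element at a position in `[l₁, h₁)` distinguishes elements of the same class at positions
in `[l₂, h₂)`. -/
def ConstOn (G : ℕ → ℕ → ℝ) (P : Layout) (l₁ h₁ l₂ h₂ : ℕ) : Prop :=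
  ∀ i j k, l₁ ≤ i → i < h₁ → l₂ ≤ j → j < h₂ → l₂ ≤ k → k < h₂ → Same P.bd j k →
    G (P.arr i) (P.arr j) = G (P.arr i) (P.arr k)

/-- Refinement moves elements within classes only, so that ranges bounded by ends of classes keep
their sets of elements. -/
theorem ConstOn.refines {lo hi l₁ h₁ l₂ h₂ : ℕ} (h : ConstOn G P l₁ h₁ l₂ h₂)
    (hr : Refines n lo hi P P') (hl₁ : P.bd l₁ ≠ 0) (hh₁ : P.bd h₁ ≠ 0) (hl₂ : P.bd l₂ ≠ 0)
    (hh₂ : P.bd h₂ ≠ 0) : ConstOn G P' l₁ h₁ l₂ h₂ := by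
  obtain ⟨σ, h1, h2, h3⟩ := hr.perm
  intro i j k hi hi' hj hj' hk hk' hs
  rw [h1]
  have a1 := (h2 i).le_iff hl₁
  have a2 := (h2 i).le_iff hh₁
  have a3 := (h2 j).le_iff hl₂
  have a4 := (h2 j).le_iff hh₂
  have a5 := (h2 k).le_iff hl₂
  have a6 := (h2 k).le_iff hh₂
  exact h (σ i) (σ j) (σ k) (by omega) (by omega) (by omega) (by omega) (by omega) (by omega)
    ((h2 j).trans ((hs.anti hr.bd_ne).trans (h2 k).symm))

/-- The invariant of the ordered partition refinement: the partition is compatible with a valid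
order, and the elements separated by the first `head` events do not distinguish elements of a
class on the other side of the cut. -/
structure OrderInv (G : ℕ → ℕ → ℝ) (n head : ℕ) (P : Layout) : Prop where
  perm : IsPerm n P.arr
  queue : QueueInv n P
  bd_zero : P.bd 0 ≠ 0
  bd_last : P.bd n ≠ 0
  head_le : head ≤ P.cnt
  order : ∃ R, Valid G (Finset.range n) R ∧
    ∀ j k, j < k → k < n → ¬ Same P.bd j k → R (P.arr j) (P.arr k)
  done : ∀ k < head, ConstOn G P (P.lft k) (P.cut k) (P.cut k) (P.rgt k) ∧
    ConstOn G P (P.cut k) (P.rgt k) (P.lft k) (P.cut k)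

theorem OrderInv.done_refines {head lo hi : ℕ} (h : OrderInv G n head P)
    (hr : Refines n lo hi P P') : ∀ k < head,
    ConstOn G P' (P'.lft k) (P'.cut k) (P'.cut k) (P'.rgt k) ∧
      ConstOn G P' (P'.cut k) (P'.rgt k) (P'.lft k) (P'.cut k) := by
  intro k hk
  have hk' := hk.trans_le h.head_le
  obtain ⟨e1, e2, e3⟩ := hr.old k hk'
  obtain ⟨-, -, -, b1, b2, b3⟩ := h.queue.event k hk'
  rw [e1, e2, e3]
  exact ⟨(h.done k hk).1.refines hr b1 b2 b2 b3, (h.done k hk).2.refines hr b2 b3 b1 b2⟩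

/-- Refining the classes on one side of a pivot by the similarity to the pivot, in the direction
towards the pivot, keeps every compatible valid order compatible, since valid orders are
Robinsonian. -/
theorem OrderInv.refine (hG : ∀ x y, G x y = G y x) {head lo hi pw : ℕ} {sg : ℝ}
    (h : OrderInv G n head P) (hr : Refines n lo hi P P') (hs : SortedTo κ lo hi hi P P')
    (hlo : P.bd lo ≠ 0) (hhi : P.bd hi ≠ 0) (hn : hi ≤ n) (hpw : pw < n)
    (hside : (sg = 1 ∧ hi ≤ pw) ∨ (sg = -1 ∧ pw < lo)) (hκ : IsKey G n (P.arr pw) sg κ) :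
    OrderInv G n head P' ∧ P'.arr pw = P.arr pw ∧ ConstOn G P' pw (pw + 1) lo hi := by
  obtain ⟨e, he⟩ := hκ
  have hperm := h.perm.refines hr hn
  have hdone := h.done_refines hr
  obtain ⟨σ, h1, h2, h3⟩ := hr.perm
  have hpw' : P'.arr pw = P.arr pw := by
    rw [h1, Function.comp_apply, h3 pw (by omega)]
  have hσn : ∀ k < n, σ k < n := fun k hk =>
    (perm_mem_Ico (a := 0) (b := n) (fun l hl => h3 l (by omega)) ⟨by omega, hk⟩).2
  refine ⟨⟨hperm, hr.queue h.queue hlo hhi, hr.bd_ne _ h.bd_zero, hr.bd_ne _ h.bd_last,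
    h.head_le.trans hr.cnt_le, ?_, hdone⟩, hpw', ?_⟩
  · obtain ⟨R, hR, hord⟩ := h.order
    refine ⟨R, hR, fun j k hjk hk hns => ?_⟩
    by_cases hs0 : Same P.bd j k
    · have hmem : lo ≤ j ∧ k < hi := by
        have hlo' := hs0.le_iff hlo
        have hhi' := hs0.le_iff hhi
        by_contra hc
        refine hns fun m hm => ?_
        rw [hr.bd_out m (by omega)]
        exact hs0 m hm
      have hlt := hs.sep j k hmem.1 (by omega) hjk hmem.2 hs0 hns
      have hj := hperm.1 j (by omega)
      have hk' := hperm.1 k hk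
      have hw := h.perm.1 pw hpw
      rw [he _ hj, he _ hk'] at hlt
      have hne : P'.arr j ≠ P'.arr k := fun e => by
        have := hperm.2 j (by omega) k hk e
        omega
      rcases hR.total _ (Finset.mem_range.2 hj) _ (Finset.mem_range.2 hk') hne with hc | hc
      · exact hc
      exfalso
      -- the pivot is outside of the range, hence in a different class than its elements
      have hσj := h2 j
      have hσk := h2 k
      have a1 := hσj.le_iff hlo
      have a2 := hσj.le_iff hhi
      have a3 := hσk.le_iff hlo
      have a4 := hσk.le_iff hhi
      have sep : ∀ l, lo ≤ l → l < hi → ¬ Same P.bd pw l := by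
        intro l hl hl' hsl
        have := hsl.le_iff hlo
        have := hsl.le_iff hhi
        omega
      have ej : P'.arr j = P.arr (σ j) := by rw [h1]; rfl
      have ek : P'.arr k = P.arr (σ k) := by rw [h1]; rfl
      rcases hside with ⟨rfl, hpos⟩ | ⟨rfl, hpos⟩
      · have r2 := hord (σ j) pw (by omega) hpw fun e => sep _ (by omega) (by omega) e.symm
        rw [← ej] at r2
        have := (hR.rob _ (Finset.mem_range.2 hk') _ (Finset.mem_range.2 hj) _
          (Finset.mem_range.2 hw) hc r2).2
        rw [hG (P'.arr k), hG (P'.arr j)] at this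
        linarith
      · have r1 := hord pw (σ k) (by omega) (hσn k hk) (sep _ (by omega) (by omega))
        rw [← ek] at r1
        have := (hR.rob _ (Finset.mem_range.2 hw) _ (Finset.mem_range.2 hk') _
          (Finset.mem_range.2 hj) r1 hc).1
        linarith
    · obtain ⟨hlt, hns'⟩ := Same.lt_of_not_same hjk hs0 (h2 j) (h2 k)
      rw [h1]
      exact hord _ _ hlt (hσn k hk) hns'
  · intro i j k hi hi' hj hj' hk hk' hsame
    obtain rfl : i = pw := by omega
    have := hs.const j k hj hj' hk hk' hsame
    rw [he _ (hperm.1 j (by omega)), he _ (hperm.1 k (by omega))] at this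
    rw [hpw']
    rcases hside with ⟨rfl, -⟩ | ⟨rfl, -⟩ <;> linarith

/-- When all events have been processed, the classes are modules. -/
theorem OrderInv.module (h : OrderInv G n P.cnt P) {i j k : ℕ} (hi : i < n) (hj : j < n)
    (hjk : Same P.bd j k) (hij : ¬ Same P.bd i j) :
    G (P.arr i) (P.arr j) = G (P.arr i) (P.arr k) := by
  rcases lt_trichotomy i j with e | e | e
  · obtain ⟨m, hm, a1, a2, a3, a4⟩ := h.queue.cover i j e hj hij
    obtain ⟨-, -, -, b1, b2, b3⟩ := h.queue.event m hm
    have c2 := hjk.le_iff b2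
    have c3 := hjk.le_iff b3
    exact (h.done m hm).1 i j k a1 a2 a3 a4 (by omega) (by omega) hjk
  · exact absurd (e ▸ Same.refl _ _) hij
  · obtain ⟨m, hm, a1, a2, a3, a4⟩ := h.queue.cover j i e hi fun e' => hij e'.symm
    obtain ⟨-, -, -, b1, b2, b3⟩ := h.queue.event m hm
    have c1 := hjk.le_iff b1
    have c2 := hjk.le_iff b2
    exact (h.done m hm).2 i j k a3 a4 a1 a2 (by omega) (by omega) hjk

/-- When all events have been processed, the element of the class at position `i` that the search
has listed last may be placed first. -/
theorem OrderInv.extract (hG : ∀ x y, G x y = G y x) {rank : ℕ → ℕ}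
    (hinj : ∀ x < n, ∀ y < n, rank x = rank y → x = y)
    (hsearch : SearchOrder G rank (Finset.range n)) {i b c : ℕ} {σ : Equiv.Perm ℕ}
    (h : OrderInv G n P.cnt P) (hi : i < n) (hbi : P.bd i ≠ 0) (hb : b ≤ n) (hbb : P.bd b ≠ 0)
    (hκ : ∀ x < n, κ x = -(rank x : ℝ)) (he : Extracts κ i b c P P' σ) :
    c = i + 1 ∧ OrderInv G n P.cnt P' ∧ P'.bd (i + 1) ≠ 0 := by
  have hlt := he.lt
  have hle := he.le
  have hr : Refines n i b P P' := he.refines le_rfl le_rfl hb (fun h => h) (fun h => h)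
  have hσn : ∀ k < n, σ k < n := fun k hk =>
    (perm_mem_Ico (a := 0) (b := n) (fun l hl => he.supp l (by omega)) ⟨by omega, hk⟩).2
  have hσi := he.mem (i := i) ⟨le_rfl, by omega⟩
  obtain ⟨m, hm1, hm2⟩ := he.least
  have hrank : ∀ x < n, ∀ y < n, κ x = κ y → x = y := by
    intro x hx y hy e
    rw [hκ x hx, hκ y hy] at e
    exact hinj x hx y hy (by exact_mod_cast neg_injective e)
  have hc : c = i + 1 := by
    by_contra hne
    have e1 := hm1 i le_rfl (by omega)
    have e2 := hm1 (i + 1) (by omega) (by omega)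
    have := σ.injective (h.perm.2 _ (hσn i hi) _ (hσn (i + 1) (by omega))
      (hrank _ (h.perm.1 _ (hσn i hi)) _ (h.perm.1 _ (hσn (i + 1) (by omega)))
        (e1.trans e2.symm)))
    omega
  subst hc
  have hbd' : P'.bd (i + 1) ≠ 0 := by
    rcases he.push with ⟨e, e', _⟩ | ⟨_, e', _⟩
    · rw [e', e]; exact hbb
    · rw [e']; simp
  refine ⟨rfl, ⟨h.perm.refines hr hb, hr.queue h.queue hbi hbb, hr.bd_ne _ h.bd_zero,
    hr.bd_ne _ h.bd_last, hr.cnt_le, ?_, h.done_refines hr⟩, hbd'⟩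
  obtain ⟨R, hR, hord⟩ := h.order
  -- the class at position `i`, and its element that has been listed last
  let N := (Finset.Ico i b).image P.arr
  have hmemN : ∀ l < n, P.arr l ∈ N ↔ i ≤ l ∧ l < b := by
    intro l hl
    simp only [N, Finset.mem_image, Finset.mem_Ico]
    constructor
    · rintro ⟨l', hl', e⟩
      rw [← h.perm.2 l' (by omega) l hl e]
      exact hl'
    · exact fun e => ⟨l, e, rfl⟩
  have hNn : N ⊆ Finset.range n := by
    intro x hx
    simp only [N, Finset.mem_image, Finset.mem_Ico] at hx
    obtain ⟨l, hl, rfl⟩ := hx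
    exact Finset.mem_range.2 (h.perm.1 l (by omega))
  have hmax : ∀ x ∈ N, rank x ≤ rank (P.arr (σ i)) := by
    intro x hx
    simp only [N, Finset.mem_image, Finset.mem_Ico] at hx
    obtain ⟨l, hl, rfl⟩ := hx
    have hl' : σ (σ⁻¹ l) = l := σ.apply_symm_apply l
    have hmem := perm_mem_Ico (σ := σ⁻¹) (a := i) (b := b)
      (fun k hk => by rw [Equiv.Perm.inv_eq_iff_eq, he.supp k hk]) hl
    have e1 : κ (P.arr (σ i)) ≤ κ (P.arr l) := by
      rw [hm1 i le_rfl (by omega)]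
      by_cases e : σ⁻¹ l < i + 1
      · rw [← hl']; exact (hm1 _ hmem.1 e).ge
      · have := hm2 (σ⁻¹ l) (by omega) hmem.2
        rw [hl'] at this
        exact this.le
    rw [hκ _ (h.perm.1 _ (hσn i hi)), hκ _ (h.perm.1 l (by omega))] at e1
    exact_mod_cast neg_le_neg_iff.1 e1
  have hsame : ∀ j k, i ≤ j → j < b → i ≤ k → k < b → Same P.bd j k :=
    fun j k h1 h2 h3 h4 l hl => he.inner l (by omega) (by omega)
  have hnsame : ∀ l j, (l < i ∨ b ≤ l) → i ≤ j → j < b → ¬ Same P.bd l j := by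
    intro l j hl hj hj' hs
    have := hs.le_iff hbi
    have := hs.le_iff hbb
    omega
  have hmod : ∀ v ∈ Finset.range n, v ∉ N → ∀ x ∈ N, ∀ y ∈ N, G v x = G v y := by
    intro v hv hvN x hx y hy
    obtain ⟨l, hl, rfl⟩ := h.perm.exists_eq (Finset.mem_range.1 hv)
    rw [hmemN l hl] at hvN
    obtain ⟨j, hj, rfl⟩ := h.perm.exists_eq (Finset.mem_range.1 (hNn hx))
    obtain ⟨k, hk, rfl⟩ := h.perm.exists_eq (Finset.mem_range.1 (hNn hy))
    rw [hmemN j hj] at hx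
    rw [hmemN k hk] at hy
    exact h.module hl hj (hsame j k hx.1 hx.2 hy.1 hy.2) (hnsame l j (by omega) hx.1 hx.2)
  have hint : ∀ x ∈ N, ∀ y ∈ Finset.range n, ∀ z ∈ N, R x y → R y z → y ∈ N := by
    intro x hx y hy z hz hxy hyz
    obtain ⟨l, hl, rfl⟩ := h.perm.exists_eq (Finset.mem_range.1 hy)
    obtain ⟨j, hj, rfl⟩ := h.perm.exists_eq (Finset.mem_range.1 (hNn hx))
    obtain ⟨k, hk, rfl⟩ := h.perm.exists_eq (Finset.mem_range.1 (hNn hz))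
    have hx' := (hmemN j hj).1 hx
    have hz' := (hmemN k hk).1 hz
    rw [hmemN l hl]
    by_contra hc
    rcases (show l < i ∨ b ≤ l by omega) with e | e
    · exact hR.asymm (hNn hx) hy hxy
        (hord l j (by omega) hj (hnsame l j (Or.inl e) hx'.1 hx'.2))
    · exact hR.asymm hy (hNn hz) hyz
        (hord k l (by omega) hl fun e' => hnsame l k (Or.inr e) hz'.1 hz'.2 e'.symm)
  have hzN : P.arr (σ i) ∈ N := (hmemN _ (hσn i hi)).2 hσi
  obtain ⟨R', hR', hfirst⟩ := (hsearch.of_module hNn hmod).exists_valid_first hG (hR.mono hNn)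
    (fun x hx y hy => hinj x (Finset.mem_range.1 (hNn hx)) y (Finset.mem_range.1 (hNn hy)))
    hzN hmax
  refine ⟨_, hR.substitute hG hNn hint hmod hR', fun j k hjk hk hns => ?_⟩
  have ej : P'.arr j = P.arr (σ j) := by rw [he.arr]; rfl
  have ek : P'.arr k = P.arr (σ k) := by rw [he.arr]; rfl
  rw [ej, ek]
  by_cases hs0 : Same P.bd j k
  · have hji : j = i := by
      have h1 : j < i + 1 ∧ i + 1 ≤ k := by
        by_contra hc
        refine hns fun l hl => ?_
        rw [he.bd_eq (by omega)]
        exact hs0 l hl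
      have := hs0.le_iff hbi
      omega
    have hkb : k < b := by
      have := hs0.le_iff hbb
      omega
    have hkN := (hmemN _ (hσn k hk)).2 (he.mem ⟨by omega, hkb⟩)
    subst hji
    refine Or.inl ⟨hzN, hkN, hfirst _ hkN fun e => ?_⟩
    have := σ.injective (h.perm.2 _ (hσn k hk) _ (hσn j hi) e)
    omega
  · obtain ⟨hlt, hns'⟩ := Same.lt_of_not_same hjk hs0 (he.same j) (he.same k)
    refine Or.inr ⟨fun e => ?_, hord _ _ hlt (hσn k hk) hns'⟩
    rw [hmemN _ (hσn j (by omega)), hmemN _ (hσn k hk)] at e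
    exact hns' (hsame _ _ e.1.1 e.1.2 e.2.1 e.2.2)

end Refinement

/-! ### Similarity-first search -/

/-- In memory `s`, word register `0` holds `n` and real array `0` holds the matrix `d` row by
row. -/
structure HoldsInput (n : ℕ) (d : ℕ → ℕ → ℝ) (s : Memory) : Prop where
  size : s.wreg 0 = n
  matrix : ∀ x < n, ∀ y < n, s.rarr 0 (x * n + y) = d x y

theorem HoldsInput.isKey {n : ℕ} {d : ℕ → ℕ → ℝ} {s : Memory} (h : HoldsInput n d s) {w : ℕ}
    (hw : w < n) (sg : ℝ) : IsKey (gromov d 0) n w sg (pivotKey (s.rarr 0) n w sg) := by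
  refine ⟨-(sg * d 0 w), fun x hx => ?_⟩
  have := h.matrix 0 (by omega) x hx
  rw [zero_mul, zero_add] at this
  unfold pivotKey gromov
  rw [this, h.matrix w hw x hx]
  ring

theorem HoldsInput.frame {n : ℕ} {d : ℕ → ℕ → ℝ} {s s' : Memory} {c : Prog}
    (h : HoldsInput n d s) (hf : Frame c s s') (h0 : 0 ∉ c.wregs := by decide)
    (h1 : 0 ∉ c.rarrs := by decide) : HoldsInput n d s' :=
  ⟨(hf.wreg 0 h0).trans h.size, fun x hx y hy => by rw [hf.rarr 0 h1]; exact h.matrix x hx y hy⟩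

/-- Arrange the elements `0, …, n - 1` in array `1` in a similarity-first search order. -/
def search : Prog := block [
  .setW 1 (.const 0),
  forUp 1 0 (.storeW 1 (.reg 1) (.reg 1)),
  .setR 2 (.const (-1)),
  .setW 3 (.reg 0),
  .setW 1 (.const 0),
  forUp 1 0 (block [
    .setW 9 (.arr 1 (.reg 1)),
    .storeW 2 (.add (.reg 1) (.const 1)) (.const 1),
    .setW 10 (.add (.reg 1) (.const 1)),
    refineRange])]

theorem nonStarts_update_le (n c : ℕ) (bd : ℕ → ℕ) :
    nonStarts n (Function.update bd c 1) ≤ nonStarts n bd := by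
  refine Finset.card_le_card fun k hk => ?_
  simp only [Finset.mem_filter] at hk ⊢
  refine ⟨hk.1, ?_⟩
  by_cases e : k = c
  · simp [e] at hk
  · simpa [e] using hk.2

theorem runs_search {W n : ℕ} {d : ℕ → ℕ → ℝ} {s : Memory} (hs : HoldsInput n d s)
    (hW : (n + 2) ^ 2 ≤ W) (h8 : s.wreg 8 = 0) (hbd : ∀ k, s.warr 2 k = 0) :
    Runs W search s fun s' t => SearchInv (gromov d 0) n n s'.layout ∧
      t ≤ 600 * (n + 1) ^ 2 := by
  have hnW : n + 2 ≤ W := le_trans (by nlinarith) hW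
  simp only [search, runs_seq, block, runs_setW, WExp.Fits, WExp.eval, WExp.cost]
  refine ⟨Nat.zero_le _, Runs.forUp (fun i s₁ t => (∀ j < i, s₁.warr 1 j = j) ∧ t ≤ 20 * i)
    ?_ ?_ ?_ ?_ ?_⟩
  · simp [hs.size]; omega
  · simp
  · simp
  · rintro i s₁ t hf - hi e1 - ⟨hI, ht⟩
    simp only [runs_storeW, WExp.Fits, WExp.eval, WExp.cost, e1, Memory.setW_warr,
      Memory.storeW_warr, reduceIte, true_and]
    refine ⟨fun j hj => ?_, by omega⟩
    by_cases e : j = i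
    · simp [e]
    · rw [Function.update_of_ne e]
      exact hI j (by omega)
  rintro s₁ t₁ hf₁ - ⟨hI, ht₁⟩
  have hin₀ : HoldsInput n d (s.setW 1 0) := ⟨by simpa using hs.size, hs.matrix⟩
  have hin₁ : HoldsInput n d s₁ := hin₀.frame hf₁
  have g8 : s₁.wreg 8 = 0 := by simpa [h8] using hf₁.wreg 8 (by decide)
  have a2 : ∀ k, s₁.warr 2 k = 0 := fun k => by rw [hf₁.warr 2 (by decide)]; exact hbd k
  simp only [Memory.setW_wreg, OfNat.zero_ne_ofNat, zero_ne_one, reduceIte, hs.size] at hI ht₁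
  have hin := hin₁.size
  simp only [runs_setW, runs_setR, RExp.Fits, RExp.eval, RExp.cost, WExp.Fits, WExp.eval,
    WExp.cost, true_and]
  refine ⟨Nat.zero_le _, ?_⟩
  refine Runs.forUp (fun i s₂ t => SearchInv (gromov d 0) n i s₂.layout ∧
    s₂.wreg 8 + nonStarts n (s₂.warr 2) ≤ n ∧
    t + 170 * (n + 1) * nonStarts n (s₂.warr 2) ≤ 170 * (n + 1) * n + 300 * (n + 1) * i)
    ?_ ?_ ?_ ?_ ?_
  · simp [hin]; omega
  · simp
  · simp only [Memory.setW_wreg, Memory.setW_warr, Memory.setR_wreg, Memory.setR_warr, reduceIte,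
      Nat.reduceEqDiff, OfNat.ofNat_ne_one, g8]
    have := nonStarts_le n (s₁.warr 2)
    refine ⟨⟨⟨fun i hi => ?_, fun i hi j hj e => ?_⟩, ?_, ?_, by omega⟩, by omega, by nlinarith⟩
    · simpa [Memory.layout, hI i hi] using hi
    · simpa [Memory.layout, hI i hi, hI j hj] using e
    · intro j k hjk hk hns
      exact absurd (fun m _ => a2 m) hns
    · intro j k hj hk hjk v hv
      omega
  · rintro i s₂ t hf - hi e1 - ⟨hinv, hcnt, ht⟩
    simp [hin] at hi
    have hin₂ : HoldsInput n d s₂ := HoldsInput.frame (c := forUp 1 0 (block [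
      .setW 9 (.arr 1 (.reg 1)), .storeW 2 (.add (.reg 1) (.const 1)) (.const 1),
      .setW 10 (.add (.reg 1) (.const 1)), refineRange])) ⟨by simpa using hin₁.size,
        by simpa using hin₁.matrix⟩ hf
    have e0 := hin₂.size
    have e3 : s₂.wreg 3 = n := by simpa [hin] using hf.wreg 3 (by decide)
    have r2 : s₂.rreg 2 = -1 := by simpa using hf.rreg 2 (by decide)
    simp only [block, runs_seq, runs_setW, runs_storeW, WExp.Fits, WExp.eval, WExp.cost, true_and,
      e1, Memory.setW_wreg, Memory.storeW_wreg, reduceIte, Nat.reduceEqDiff, OfNat.one_ne_ofNat]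
    refine ⟨⟨by omega, by omega⟩, by omega, ⟨by omega, by omega⟩, ?_⟩
    set s₃ := ((s₂.setW 9 (s₂.warr 1 i)).storeW 2 (i + 1) 1).setW 10 (i + 1) with hs₃
    have hin₃ : HoldsInput n d s₃ := ⟨by simpa [hs₃] using e0, by simpa [hs₃] using hin₂.matrix⟩
    have b2 : s₃.warr 2 = Function.update (s₂.warr 2) (i + 1) 1 := by simp [hs₃]
    have b1 : s₃.warr 1 = s₂.warr 1 := by simp [hs₃]
    have b9 : s₃.wreg 9 = s₂.warr 1 i := by simp [hs₃]
    have b10 : s₃.wreg 10 = i + 1 := by simp [hs₃]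
    have b3 : s₃.wreg 3 = n := by simpa [hs₃] using e3
    have b8 : s₃.wreg 8 = s₂.wreg 8 := by simp [hs₃]
    have br : s₃.rreg 2 = -1 := by simpa [hs₃] using r2
    have hle := nonStarts_update_le n (i + 1) (s₂.warr 2)
    rw [← b2] at hle
    have hw : s₂.warr 1 i < n := hinv.perm.1 i hi
    refine (runs_refineRange (s := s₃) hin₃.size hW (by omega) b3.le (by omega)
      (by rw [b1]; exact hinv.perm.1) (by omega)).mono ?_
    rintro s₄ t₄ hf₄ ⟨href, hsort, ht₄⟩
    rw [b10, b3] at href hsort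
    rw [b9, br] at hsort
    rw [b10, b3] at ht₄
    have hlay : (s₄.setW 1 (i + 1)).layout = s₄.layout := rfl
    rw [hlay]
    have hcount : s₄.wreg 8 + nonStarts n (s₄.warr 2) = s₃.wreg 8 + nonStarts n (s₃.warr 2) :=
      href.count
    refine ⟨hinv.refine hi b1 b2 href hsort (hin₃.isKey hw _), ?_, ?_⟩
    · simp only [Memory.setW_wreg, Memory.setW_warr, Nat.reduceEqDiff, OfNat.ofNat_ne_one,
        reduceIte]
      omega
    · simp only [Memory.setW_warr]
      have := Nat.mul_le_mul_left (170 * (n + 1)) hle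
      have h1 : 300 * (n + 1) * (i + 1) = 300 * (n + 1) * i + 300 * (n + 1) := by ring
      omega
  · rintro s₂ t hf - ⟨hinv, -, ht⟩
    simp only [Memory.setW_wreg, Memory.setR_wreg, OfNat.zero_ne_ofNat, zero_ne_one, reduceIte,
      hin] at hinv ht
    refine ⟨hinv, ?_⟩
    have h1 : 170 * (n + 1) * n + 300 * (n + 1) * n ≤ 470 * (n + 1) ^ 2 := by nlinarith
    have h2 : n + 1 ≤ (n + 1) ^ 2 := by nlinarith
    omega

/-- Store minus the position of each element in real array `4`, and join all classes into one. -/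
def storeRanks : Prog := block [
  .setW 1 (.const 0),
  .setR 3 (.const 0),
  forUp 1 0 (block [
    .storeR 4 (.arr 1 (.reg 1)) (.reg 3),
    .setR 3 (.sub (.reg 3) (.const 1)),
    .storeW 2 (.reg 1) (.const 0)]),
  .storeW 2 (.const 0) (.const 1),
  .setW 8 (.const 0),
  .setW 12 (.const 0)]

theorem runs_storeRanks {W n : ℕ} {s : Memory} (h0 : s.wreg 0 = n) (hn : 0 < n)
    (hW : n + 2 ≤ W) (hperm : IsPerm n (s.warr 1)) (hbd : s.warr 2 n ≠ 0) :
    Runs W storeRanks s fun s' t => (∀ i < n, s'.rarr 4 (s.warr 1 i) = -(i : ℝ)) ∧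
      (∀ k, 0 < k → k < n → s'.warr 2 k = 0) ∧ s'.warr 2 0 ≠ 0 ∧ s'.warr 2 n ≠ 0 ∧
      s'.wreg 8 = 0 ∧ s'.wreg 12 = 0 ∧ t ≤ 30 * (n + 1) := by
  simp only [storeRanks, runs_seq, block, runs_setW, runs_setR, WExp.Fits, WExp.eval, WExp.cost,
    RExp.Fits, RExp.eval, RExp.cost, true_and]
  refine ⟨Nat.zero_le _, Runs.forUp (fun i s₁ t =>
    (∀ j < i, s₁.rarr 4 (s.warr 1 j) = -(j : ℝ)) ∧ s₁.rreg 3 = -(i : ℝ) ∧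
    (∀ k < i, s₁.warr 2 k = 0) ∧ s₁.warr 2 n ≠ 0 ∧ t ≤ 25 * i) ?_ ?_ ?_ ?_ ?_⟩
  · simp [h0]; omega
  · simp
  · simpa using hbd
  · rintro i s₁ t hf - hi e1 - ⟨h1, h2, h3, h4, ht⟩
    simp [h0] at hi
    have a1 : s₁.warr 1 = s.warr 1 := by simpa using hf.warr 1 (by decide)
    simp only [block, runs_seq, runs_storeR, runs_setR, runs_storeW, WExp.Fits, WExp.eval,
      WExp.cost, RExp.Fits, RExp.eval, RExp.cost, true_and, e1, a1, h2, Memory.setW_rarr,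
      Memory.setW_warr, Memory.setW_rreg, Memory.storeW_warr, Memory.storeW_rarr,
      Memory.storeW_rreg, Memory.setR_rreg, Memory.setR_rarr, Memory.setR_warr, Memory.setR_wreg,
      Memory.storeR_rarr, Memory.storeR_rreg, Memory.storeR_warr, Memory.storeR_wreg, reduceIte]
    refine ⟨Nat.zero_le _, fun j hj => ?_, by push_cast; ring, fun k hk => ?_, ?_, by omega⟩
    · by_cases e : j = i
      · simp [e]
      · rw [Function.update_of_ne fun e' => e (hperm.2 j (by omega) i hi e')]
        exact h1 j (by omega)
    · by_cases e : k = i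
      · simp [e]
      · rw [Function.update_of_ne e]
        exact h3 k (by omega)
    · rw [Function.update_of_ne (by omega)]
      exact h4
  · rintro s₁ t hf - ⟨h1, h2, h3, h4, ht⟩
    simp [h0] at h1 h3 ht
    simp only [runs_seq, runs_setW, runs_storeW, WExp.Fits, WExp.eval, WExp.cost, true_and,
      Memory.setW_wreg, Memory.setW_warr, Memory.setW_rarr, Memory.storeW_rarr, Memory.storeW_warr,
      reduceIte, Nat.reduceEqDiff]
    refine ⟨by omega, by omega, by omega, by omega, h1, fun k hk hk' => ?_, by simp, ?_, by omega⟩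
    · rw [Function.update_of_ne (by omega)]
      exact h3 k hk'
    · rw [Function.update_of_ne (by omega)]
      exact h4

/-! ### Processing the events -/

/-- Refine the classes between the positions `wreg 10` and `wreg 3` by all pivots at the positions
from `wreg 16` up to register `e` (exclusive). -/
def pivots (e : ℕ) : Prog := forUp 16 e (.seq (.setW 9 (.arr 1 (.reg 16))) refineRange)

/-- Process the event `wreg 12`: the elements on either side of its cut refine the classes on the
other side. -/
def processEvent : Prog := block [
  .setW 13 (.arr 3 (.reg 12)),
  .setW 14 (.arr 4 (.reg 12)),
  .setW 15 (.arr 5 (.reg 12)),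
  .setR 2 (.const 1),
  .setW 10 (.reg 13),
  .setW 3 (.reg 14),
  .setW 16 (.reg 14),
  pivots 15,
  .setR 2 (.const (-1)),
  .setW 10 (.reg 14),
  .setW 3 (.reg 15),
  .setW 16 (.reg 13),
  pivots 14,
  .setW 12 (.add (.reg 12) (.const 1))]

/-- The pivots are not in the refined range, and so they keep their positions. -/
theorem ConstOn.refines_range {G : ℕ → ℕ → ℝ} {n l h lo hi : ℕ} {P P' : Layout}
    (hc : ConstOn G P l h lo hi) (hr : Refines n lo hi P P') (hd : h ≤ lo ∨ hi ≤ l) :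
    ConstOn G P' l h lo hi := by
  obtain ⟨σ, h1, h2, h3⟩ := hr.perm
  intro i j k hi hi' hj hj' hk hk' hs
  have aj := perm_mem_Ico h3 ⟨hj, hj'⟩
  have ak := perm_mem_Ico h3 ⟨hk, hk'⟩
  rw [h1]
  simp only [Function.comp_apply]
  rw [h3 i (by omega)]
  exact hc i (σ j) (σ k) hi hi' aj.1 aj.2 ak.1 ak.2
    ((h2 j).trans ((hs.anti hr.bd_ne).trans (h2 k).symm))

theorem Refines.widen {n lo hi lo' hi' : ℕ} {P P' : Layout} (h : Refines n lo hi P P')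
    (hlo : lo' ≤ lo) (hhi : hi ≤ hi') (b1 : P.bd lo ≠ 0) (b2 : P.bd hi ≠ 0) :
    Refines n lo' hi' P P' where
  perm := by
    obtain ⟨σ, h1, h2, h3⟩ := h.perm
    exact ⟨σ, h1, h2, fun i hi => h3 i (by omega)⟩
  bd_ne := h.bd_ne
  bd_out k hk := h.bd_out k (by omega)
  queue hq _ _ := h.queue hq b1 b2
  cnt_le := h.cnt_le
  old := h.old
  count := h.count

theorem Refines.size_eq {n lo hi : ℕ} {P P' : Layout} (h : Refines n lo hi P P') {k : ℕ}
    (hk : k < P.cnt) : P'.size k = P.size k := by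
  have := h.old k hk
  unfold Layout.size
  rw [this.1, this.2.1, this.2.2]

/-- The effect of refining a range by all pivots in another range. The number of steps is bounded by
the product of the two lengths, apart from a term linear in `n` for each new class; these terms are
paid by the potential `170 * (n + 1) * nonStarts n bd`, which drops with each new class. -/
theorem runs_pivots {W n e head : ℕ} {d : ℕ → ℕ → ℝ} {s : Memory} (hd : ∀ x y, d x y = d y x)
    (hs : HoldsInput n d s) (hW : (n + 2) ^ 2 ≤ W) (he : e = 14 ∨ e = 15)
    (hlo : s.wreg 10 ≤ s.wreg 3) (hhi : s.wreg 3 ≤ n) (hv : s.wreg 16 ≤ s.wreg e)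
    (hvn : s.wreg e ≤ n)
    (hside : (s.rreg 2 = 1 ∧ s.wreg 3 ≤ s.wreg 16) ∨ (s.rreg 2 = -1 ∧ s.wreg e ≤ s.wreg 10))
    (hblo : s.warr 2 (s.wreg 10) ≠ 0) (hbhi : s.warr 2 (s.wreg 3) ≠ 0)
    (hinv : OrderInv (gromov d 0) n head s.layout)
    (hcnt : s.wreg 8 + nonStarts n (s.warr 2) ≤ n) :
    Runs W (pivots e) s fun s' t => OrderInv (gromov d 0) n head s'.layout ∧
      Refines n (s.wreg 10) (s.wreg 3) s.layout s'.layout ∧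
      ConstOn (gromov d 0) s'.layout (s.wreg 16) (s.wreg e) (s.wreg 10) (s.wreg 3) ∧
      t + 170 * (n + 1) * nonStarts n (s'.warr 2) ≤ 170 * (n + 1) * nonStarts n (s.warr 2) +
        (s.wreg e - s.wreg 16) * (200 * (s.wreg 3 - s.wreg 10) + 40) + 10 := by
  have hnW : n + 2 ≤ W := le_trans (by nlinarith) hW
  have hx : 16 ∉ (Prog.seq (.setW 9 (.arr 1 (.reg 16))) refineRange).wregs := by decide
  have hxe : e ∉ (Prog.seq (.setW 9 (.arr 1 (.reg 16))) refineRange).wregs := by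
    rcases he with rfl | rfl <;> decide
  refine Runs.forUp (fun v s₁ t => OrderInv (gromov d 0) n head s₁.layout ∧
      Refines n (s.wreg 10) (s.wreg 3) s.layout s₁.layout ∧
      ConstOn (gromov d 0) s₁.layout (s.wreg 16) v (s.wreg 10) (s.wreg 3) ∧
      t + 170 * (n + 1) * nonStarts n (s₁.warr 2) ≤ 170 * (n + 1) * nonStarts n (s.warr 2) +
        (v - s.wreg 16) * (200 * (s.wreg 3 - s.wreg 10) + 40)) (by omega) hv ?_ ?_ ?_ hx hxe
      (by omega)
  · exact ⟨hinv, Refines.refl _ _ _ _, fun i j k h1 h2 => by omega, by omega⟩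
  · rintro v s₁ t hf hv1 hv2 e1 - ⟨hI, hR, hC, ht⟩
    have hin : HoldsInput n d s₁ := hs.frame hf (by simp [forUp, Prog.wregs]; decide)
      (by simp [forUp, Prog.rarrs]; decide)
    have e10 : s₁.wreg 10 = s.wreg 10 := hf.wreg 10 (by simp [forUp, Prog.wregs]; decide)
    have e3 : s₁.wreg 3 = s.wreg 3 := hf.wreg 3 (by simp [forUp, Prog.wregs]; decide)
    have r2 : s₁.rreg 2 = s.rreg 2 := hf.rreg 2 (by simp [forUp, Prog.rregs]; decide)
    have hcnt₁ : s₁.wreg 8 + nonStarts n (s₁.warr 2) ≤ n := hR.count.le.trans hcnt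
    have hw : s₁.warr 1 v < n := hI.perm.1 v (by omega)
    simp only [runs_seq, runs_setW, WExp.Fits, WExp.eval, WExp.cost, true_and, e1]
    have hlay : (s₁.setW 9 (s₁.warr 1 v)).layout = s₁.layout := rfl
    have hin' : HoldsInput n d (s₁.setW 9 (s₁.warr 1 v)) := ⟨by simpa using hin.size, hin.matrix⟩
    refine (runs_refineRange (s := s₁.setW 9 (s₁.warr 1 v)) hin'.size hW
      (by simpa [e10, e3] using hlo) (by simpa [e3] using hhi) (by simpa using hw)
      hI.perm.1 (by simpa using hcnt₁)).mono ?_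
    rintro s₂ t₂ hf₂ ⟨href, hsort, ht₂⟩
    rw [hlay] at href hsort
    simp only [Memory.setW_wreg, Memory.setW_warr, Memory.setW_rarr, Memory.setW_rreg, e10, e3, r2,
      reduceIte, Nat.reduceEqDiff] at href hsort ht₂
    have hlay₂ : (s₂.setW 16 (v + 1)).layout = s₂.layout := rfl
    rw [hlay₂]
    obtain ⟨h1, h2, h3⟩ := hI.refine (gromov_symm hd 0) href hsort (hR.bd_ne _ hblo)
      (hR.bd_ne _ hbhi) hhi (by omega : v < n) (by
        rcases hside with h | h
        · exact Or.inl ⟨h.1, by omega⟩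
        · exact Or.inr ⟨h.1, by omega⟩) (hin.isKey hw _)
    refine ⟨h1, hR.trans href, ?_, ?_⟩
    · have hC' := hC.refines_range href (by rcases hside with h | h <;> omega)
      intro i j k hi hi'
      by_cases e : i < v
      · exact hC' i j k hi e
      · exact h3 i j k (by omega) hi'
    · simp only [Memory.setW_warr]
      have : v + 1 - s.wreg 16 = (v - s.wreg 16) + 1 := by omega
      rw [this, add_mul]
      omega
  · rintro s₁ t hf - ⟨h1, h2, h3, h4⟩
    exact ⟨h1, h2, h3, by omega⟩

/-- Apart from the new classes, processing an event takes a number of steps proportional to the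
number of pairs that the event separates. -/
theorem runs_processEvent {W n : ℕ} {d : ℕ → ℕ → ℝ} {s : Memory} (hd : ∀ x y, d x y = d y x)
    (hs : HoldsInput n d s) (hW : (n + 2) ^ 2 ≤ W)
    (hinv : OrderInv (gromov d 0) n (s.wreg 12) s.layout) (hlt : s.wreg 12 < s.wreg 8)
    (hcnt : s.wreg 8 + nonStarts n (s.warr 2) ≤ n) :
    Runs W processEvent s fun s' t => s'.wreg 12 = s.wreg 12 + 1 ∧
      OrderInv (gromov d 0) n (s.wreg 12 + 1) s'.layout ∧
      Refines n 0 n s.layout s'.layout ∧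
      t + 170 * (n + 1) * nonStarts n (s'.warr 2) ≤ 170 * (n + 1) * nonStarts n (s.warr 2) +
        600 * s.layout.size (s.wreg 12) := by
  have hnW : n + 2 ≤ W := le_trans (by nlinarith) hW
  obtain ⟨hLC, hCR, hRn, bL, bC, bR⟩ := hinv.queue.event _ hlt
  simp only [processEvent, block, runs_seq, runs_setW, runs_setR, WExp.Fits, WExp.eval, WExp.cost,
    RExp.Fits, RExp.eval, RExp.cost, true_and, Memory.setW_wreg, Memory.setW_warr, Memory.setR_wreg,
    Memory.setR_warr, reduceIte, Nat.reduceEqDiff]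
  set L := s.warr 3 (s.wreg 12) with hL
  set C := s.warr 4 (s.wreg 12) with hC
  set R := s.warr 5 (s.wreg 12) with hR
  change L < C at hLC
  change C < R at hCR
  change R ≤ n at hRn
  change s.warr 2 L ≠ 0 at bL
  change s.warr 2 C ≠ 0 at bC
  change s.warr 2 R ≠ 0 at bR
  set s₁ := ((((((s.setW 13 L).setW 14 C).setW 15 R).setR 2 ((1 : ℚ) : ℝ)).setW 10 L).setW 3
    C).setW 16 C with hs₁
  have hin₁ : HoldsInput n d s₁ := ⟨by simpa [hs₁] using hs.size, hs.matrix⟩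
  have hlay₁ : s₁.layout = s.layout := rfl
  have e10 : s₁.wreg 10 = L := by simp [hs₁]
  have e3 : s₁.wreg 3 = C := by simp [hs₁]
  have e16 : s₁.wreg 16 = C := by simp [hs₁]
  have e15 : s₁.wreg 15 = R := by simp [hs₁]
  have e14 : s₁.wreg 14 = C := by simp [hs₁]
  have e13 : s₁.wreg 13 = L := by simp [hs₁]
  have e12 : s₁.wreg 12 = s.wreg 12 := by simp [hs₁]
  have e8 : s₁.wreg 8 = s.wreg 8 := by simp [hs₁]
  have a2 : s₁.warr 2 = s.warr 2 := rfl
  refine (runs_pivots (s := s₁) (head := s.wreg 12) hd hin₁ hW (Or.inr rfl) (by omega) (by omega)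
    (by omega) (by omega) (Or.inl ⟨by simp [hs₁], by omega⟩) (by rw [e10]; exact bL)
    (by rw [e3]; exact bC) hinv (by rw [e8, a2]; exact hcnt)).mono ?_
  rintro s₂ t₂ hf₂ ⟨hI₂, hR₂, hC₂, ht₂⟩
  rw [e10, e3, e16, e15] at hC₂
  rw [e10, e3, hlay₁] at hR₂
  rw [e10, e3, e16, e15, a2] at ht₂
  have g13 : s₂.wreg 13 = L := (hf₂.wreg 13 (by decide)).trans e13
  have g14 : s₂.wreg 14 = C := (hf₂.wreg 14 (by decide)).trans e14
  have g15 : s₂.wreg 15 = R := (hf₂.wreg 15 (by decide)).trans e15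
  have g12 : s₂.wreg 12 = s.wreg 12 := (hf₂.wreg 12 (by decide)).trans e12
  have hin₂ : HoldsInput n d s₂ := hin₁.frame hf₂
  rw [g13, g14, g15]
  set s₃ := (((s₂.setR 2 ((-1 : ℚ) : ℝ)).setW 10 C).setW 3 R).setW 16 L with hs₃
  have hin₃ : HoldsInput n d s₃ := ⟨by simpa [hs₃] using hin₂.size, hin₂.matrix⟩
  have hlay₃ : s₃.layout = s₂.layout := rfl
  have f10 : s₃.wreg 10 = C := by simp [hs₃]
  have f3 : s₃.wreg 3 = R := by simp [hs₃]
  have f16 : s₃.wreg 16 = L := by simp [hs₃]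
  have f14 : s₃.wreg 14 = C := by simp [hs₃, g14]
  have f12 : s₃.wreg 12 = s.wreg 12 := by simp [hs₃, g12]
  have b2 : s₃.warr 2 = s₂.warr 2 := rfl
  have hcnt₃ : s₃.wreg 8 + nonStarts n (s₃.warr 2) ≤ n := hR₂.count.le.trans hcnt
  refine (runs_pivots (s := s₃) (head := s.wreg 12) hd hin₃ hW (Or.inl rfl) (by omega) (by omega)
    (by omega) (by omega) (Or.inr ⟨by simp [hs₃], by omega⟩)
    (by rw [f10]; exact hR₂.bd_ne _ bC) (by rw [f3]; exact hR₂.bd_ne _ bR) hI₂ hcnt₃).mono ?_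
  rintro s₄ t₄ hf₄ ⟨hI₄, hR₄, hC₄, ht₄⟩
  rw [f10, f3, f16, f14] at hC₄
  rw [f10, f3, hlay₃] at hR₄
  rw [f10, f3, f16, f14, b2] at ht₄
  have h12 : s₄.wreg 12 = s.wreg 12 := (hf₄.wreg 12 (by decide)).trans f12
  rw [h12]
  have hlay₄ : (s₄.setW 12 (s.wreg 12 + 1)).layout = s₄.layout := rfl
  have bL₂ := hR₂.bd_ne _ bL
  have bC₂ := hR₂.bd_ne _ bC
  have bR₂ := hR₂.bd_ne _ bR
  have hRef : Refines n 0 n s.layout s₄.layout :=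
    (hR₂.widen (by omega) (by omega) bL bC).trans (hR₄.widen (by omega) (by omega) bC₂ bR₂)
  refine ⟨⟨by omega, by omega⟩, by simp, ?_, hRef, ?_⟩
  · rw [hlay₄]
    have hold := hRef.old _ hlt
    refine ⟨hI₄.perm, hI₄.queue, hI₄.bd_zero, hI₄.bd_last, ?_, hI₄.order, fun k hk => ?_⟩
    · exact Nat.succ_le_of_lt (hlt.trans_le hRef.cnt_le)
    · rcases (show k < s.wreg 12 ∨ k = s.wreg 12 by omega) with e | e
      · exact hI₄.done k e
      · rw [e, hold.1, hold.2.1, hold.2.2]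
        exact ⟨hC₄, hC₂.refines hR₄ bC₂ bR₂ bL₂ bC₂⟩
  · have hsize : s.layout.size (s.wreg 12) = (C - L) * (R - C) := rfl
    rw [hsize]
    obtain ⟨x, hx⟩ : ∃ x, C - L = x + 1 := ⟨C - L - 1, by omega⟩
    obtain ⟨y, hy⟩ : ∃ y, R - C = y + 1 := ⟨R - C - 1, by omega⟩
    rw [hx, hy] at ht₂ ht₄ ⊢
    have e1 : (y + 1) * (200 * (x + 1) + 40) = 200 * ((x + 1) * (y + 1)) + 40 * (y + 1) := by ring
    have e2 : (x + 1) * (200 * (y + 1) + 40) = 200 * ((x + 1) * (y + 1)) + 40 * (x + 1) := by ring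
    have e3 : (x + 1) * (y + 1) = x * y + x + y + 1 := by ring
    omega

/-- From the search order, compute a circular ordering: at each position, process the events; when
there are none left, the classes are modules, and of the class that starts at this position, the
last element in search order is placed first. -/
def refineOrder : Prog := block [
  .setW 1 (.const 0),
  forUp 1 0 (block [
    .loop (.wle (.add (.reg 12) (.const 1)) (.reg 8)) processEvent,
    .setW 3 (.reg 0),
    .setW 11 (.reg 1),
    forUp 11 3 (.storeR 2 (.arr 1 (.reg 11)) (.arr 4 (.arr 1 (.reg 11)))),
    .setW 2 (.reg 1),
    extractMin])]

/-- The total number of pairs separated by the first `h` events. -/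
def Layout.work (P : Layout) (h : ℕ) : ℕ := ∑ k ∈ Finset.range h, P.size k

theorem Refines.work_eq {n lo hi : ℕ} {P P' : Layout} (hr : Refines n lo hi P P') {h : ℕ}
    (hh : h ≤ P.cnt) : P'.work h = P.work h :=
  Finset.sum_congr rfl fun _ hk => hr.size_eq ((Finset.mem_range.1 hk).trans_le hh)

/-- After the queue has been emptied, the classes are modules by `OrderInv.module`. The steps are
paid by the potential of the new classes and by the pairs that the processed events separate. -/
theorem runs_events {W n : ℕ} {d : ℕ → ℕ → ℝ} {s : Memory} (hd : ∀ x y, d x y = d y x)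
    (hs : HoldsInput n d s) (hW : (n + 2) ^ 2 ≤ W)
    (hinv : OrderInv (gromov d 0) n (s.wreg 12) s.layout)
    (hcnt : s.wreg 8 + nonStarts n (s.warr 2) ≤ n) :
    Runs W (.loop (.wle (.add (.reg 12) (.const 1)) (.reg 8)) processEvent) s fun s' t =>
      s'.wreg 12 = s'.wreg 8 ∧
      OrderInv (gromov d 0) n (s'.wreg 12) s'.layout ∧
      Refines n 0 n s.layout s'.layout ∧
      t + 170 * (n + 1) * nonStarts n (s'.warr 2) + 620 * s.layout.work (s.wreg 12) ≤
        170 * (n + 1) * nonStarts n (s.warr 2) + 620 * s'.layout.work (s'.wreg 12) + 10 := by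
  have hnW : n + 2 ≤ W := le_trans (by nlinarith) hW
  refine Runs.loop (I := fun s₁ t => s₁.wreg 12 ≤ s₁.wreg 8 ∧
      OrderInv (gromov d 0) n (s₁.wreg 12) s₁.layout ∧
      Refines n 0 n s.layout s₁.layout ∧
      t + 170 * (n + 1) * nonStarts n (s₁.warr 2) + 620 * s.layout.work (s.wreg 12) ≤
        170 * (n + 1) * nonStarts n (s.warr 2) + 620 * s₁.layout.work (s₁.wreg 12))
      (fun s₁ => n - s₁.wreg 12) ?_ ?_ ?_
  · exact ⟨hinv.head_le, hinv, Refines.refl _ _ _ _, by omega⟩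
  · rintro s₁ t hf ⟨h1, h2, h3, h4⟩
    have hin : HoldsInput n d s₁ := hs.frame hf
    have hcnt₁ : s₁.wreg 8 + nonStarts n (s₁.warr 2) ≤ n := h3.count.le.trans hcnt
    simp only [Test.Fits, Test.Holds, Test.cost, WExp.Fits, WExp.eval, WExp.cost]
    refine ⟨⟨⟨trivial, by omega, by omega⟩, trivial⟩, fun hb => ?_⟩
    refine (runs_processEvent hd hin hW h2 (by omega) hcnt₁).mono ?_
    rintro s₂ t₂ hf₂ ⟨e12, g1, g2, g3⟩
    have hle : s₂.wreg 12 ≤ s₂.wreg 8 := e12 ▸ g1.head_le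
    have hw : s₂.layout.work (s₂.wreg 12) =
        s₁.layout.work (s₁.wreg 12) + s₁.layout.size (s₁.wreg 12) := by
      rw [e12, g2.work_eq (by exact hb)]
      exact Finset.sum_range_succ _ _
    have hpos : 0 < s₁.layout.size (s₁.wreg 12) := by
      obtain ⟨a1, a2, -⟩ := h2.queue.event _ hb
      exact Nat.mul_pos (by omega) (by omega)
    refine ⟨⟨hle, e12 ▸ g1, h3.trans g2, ?_⟩, by omega⟩
    rw [hw]
    omega
  · rintro s₁ t hf ⟨h1, h2, h3, h4⟩ hb
    simp only [Test.Holds, WExp.eval] at hb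
    refine ⟨by omega, h2, h3, ?_⟩
    simp only [Test.cost, WExp.cost]
    omega

/-! ### Computing a circular ordering -/

/-- The keys of the positions from `wreg 11` on are set to minus the positions in search order. -/
theorem runs_fill {W : ℕ} {s : Memory} (hW : s.wreg 3 + 1 ≤ W) (hle : s.wreg 11 ≤ s.wreg 3) :
    Runs W (forUp 11 3 (.storeR 2 (.arr 1 (.reg 11)) (.arr 4 (.arr 1 (.reg 11))))) s fun s' t =>
      (∀ j, s.wreg 11 ≤ j → j < s.wreg 3 → s'.rarr 2 (s.warr 1 j) = s.rarr 4 (s.warr 1 j)) ∧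
      t ≤ 20 * (s.wreg 3 - s.wreg 11) + 10 := by
  refine Runs.forUp (fun q s₁ t => (∀ j, s.wreg 11 ≤ j → j < q →
    s₁.rarr 2 (s.warr 1 j) = s.rarr 4 (s.warr 1 j)) ∧ t ≤ 20 * (q - s.wreg 11)) hW hle ?_ ?_ ?_
  · exact ⟨fun j h1 h2 => by omega, by omega⟩
  · rintro q s₁ t hf hq hq' e1 - ⟨h1, ht⟩
    have a1 : s₁.warr 1 = s.warr 1 := hf.warr 1 (by decide)
    have a4 : s₁.rarr 4 = s.rarr 4 := hf.rarr 4 (by decide)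
    simp only [runs_storeR, WExp.Fits, RExp.Fits, WExp.eval, RExp.eval, WExp.cost, RExp.cost,
      true_and, e1, a1, a4, Memory.setW_rarr, Memory.storeR_rarr, reduceIte]
    refine ⟨fun j hj hj' => ?_, by omega⟩
    by_cases e : s.warr 1 j = s.warr 1 q
    · simp [e]
    · rw [Function.update_of_ne e]
      exact h1 j hj (by
        have : j ≠ q := fun e' => e (by rw [e'])
        omega)
  · rintro s₁ t hf - ⟨h1, ht⟩
    exact ⟨h1, by omega⟩

/-- Each pair is separated at most once. -/
theorem OrderInv.work_le {G : ℕ → ℕ → ℝ} {n head : ℕ} {P : Layout} (h : OrderInv G n head P) :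
    P.work head ≤ n * n := by
  have h1 : P.work head ≤ P.work P.cnt :=
    Finset.sum_le_sum_of_subset (Finset.range_subset_range.2 h.head_le)
  have := h.queue.total
  unfold Layout.work at *
  omega

/-- The initial partition, with a single class. -/
theorem OrderInv.start {G : ℕ → ℕ → ℝ} {n : ℕ} {P : Layout} (hR : ∃ R, Valid G (Finset.range n) R)
    (hperm : IsPerm n P.arr) (h0 : P.bd 0 ≠ 0) (hn : P.bd n ≠ 0)
    (hbd : ∀ k, 0 < k → k < n → P.bd k = 0) (hcnt : P.cnt = 0) : OrderInv G n 0 P := by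
  have hsame : ∀ i j, i < j → j < n → Same P.bd i j := fun i j hij hj m hm =>
    hbd m (by omega) (by omega)
  obtain ⟨R, hR⟩ := hR
  refine ⟨hperm, ⟨fun k hk => by omega, fun i j hij hj hs => absurd (hsame i j hij hj) hs, ?_⟩, h0,
    hn, Nat.zero_le _, ⟨R, hR, fun j k hjk hk hs => absurd (hsame j k hjk hk) hs⟩,
    fun k hk => by omega⟩
  rw [hcnt]
  simpa using samePairs_le n P.bd

/-- The invariant of the main loop says that the positions up to the counter `i` start classes of
their own, so that in the end all classes are singletons, arranged by the compatible valid order. -/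
theorem runs_refineOrder {W n : ℕ} {d : ℕ → ℕ → ℝ} {rank : ℕ → ℕ} {s : Memory}
    (hd : ∀ x y, d x y = d y x) (hs : HoldsInput n d s) (hn : 0 < n) (hW : (n + 2) ^ 2 ≤ W)
    (hR : ∃ R, Valid (gromov d 0) (Finset.range n) R)
    (hinj : ∀ x < n, ∀ y < n, rank x = rank y → x = y)
    (hsearch : SearchOrder (gromov d 0) rank (Finset.range n))
    (hperm : IsPerm n (s.warr 1)) (hrank : ∀ x < n, s.rarr 4 x = -(rank x : ℝ))
    (hbd : ∀ k, 0 < k → k < n → s.warr 2 k = 0) (h0 : s.warr 2 0 ≠ 0) (hbn : s.warr 2 n ≠ 0)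
    (h8 : s.wreg 8 = 0) (h12 : s.wreg 12 = 0) :
    Runs W refineOrder s fun s' t => IsPerm n (s'.warr 1) ∧
      (∃ R, Valid (gromov d 0) (Finset.range n) R ∧
        ∀ j k, j < k → k < n → R (s'.warr 1 j) (s'.warr 1 k)) ∧
      t ≤ 1500 * (n + 1) ^ 2 := by
  have hnW : n + 2 ≤ W := le_trans (by nlinarith) hW
  simp only [refineOrder, block, runs_seq, runs_setW, WExp.Fits, WExp.eval, WExp.cost, true_and]
  set s₀ := s.setW 1 0 with hs₀
  have e0 : s₀.wreg 0 = n := by simpa [hs₀] using hs.size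
  have e1 : s₀.wreg 1 = 0 := by simp [hs₀]
  have hlay : s₀.layout = s.layout := rfl
  have hin₀ : HoldsInput n d s₀ := ⟨e0, hs.matrix⟩
  have hnz := nonStarts_le n (s.warr 2)
  have hnz' : nonStarts n (s.warr 2) ≤ n := nonStarts_le n (s.warr 2)
  refine ⟨Nat.zero_le _, Runs.forUp (fun i s₁ t =>
      OrderInv (gromov d 0) n (s₁.wreg 12) s₁.layout ∧ (∀ j ≤ i, s₁.warr 2 j ≠ 0) ∧
      s₁.wreg 8 + nonStarts n (s₁.warr 2) ≤ n ∧
      t + 170 * (n + 1) * nonStarts n (s₁.warr 2) ≤ 170 * (n + 1) * n +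
        620 * s₁.layout.work (s₁.wreg 12) + 300 * (n + 1) * i) ?_ ?_ ?_ ?_ ?_ (by decide)
      (by decide)⟩
  · omega
  · omega
  · rw [e1, hlay]
    refine ⟨?_, fun j hj => ?_, ?_, ?_⟩
    · have : s₀.wreg 12 = 0 := by simpa [hs₀] using h12
      rw [this]
      exact OrderInv.start hR hperm h0 hbn hbd h8
    · obtain rfl : j = 0 := by omega
      exact h0
    · have : s₀.wreg 8 = 0 := by simpa [hs₀] using h8
      rw [this]
      simpa [hs₀] using hnz
    · have := Nat.mul_le_mul_left (170 * (n + 1)) hnz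
      simp only [hs₀, Memory.setW_warr]
      omega
  · rintro i s₁ t hf - hi g1 - ⟨hI, hb, hcnt, ht⟩
    rw [e0] at hi
    have hin₁ : HoldsInput n d s₁ := hin₀.frame hf
    have r4 : s₁.rarr 4 = s.rarr 4 := hf.rarr 4 (by decide)
    simp only [block, runs_seq, runs_setW, WExp.Fits, WExp.eval, WExp.cost, true_and]
    refine (runs_events hd hin₁ hW hI hcnt).mono ?_
    rintro s₂ t₂ hf₂ ⟨h12₂, hI₂, hR₂, ht₂⟩
    have hin₂ : HoldsInput n d s₂ := hin₁.frame hf₂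
    have f1 : s₂.wreg 1 = i := (hf₂.wreg 1 (by decide)).trans g1
    have r4₂ : s₂.rarr 4 = s.rarr 4 := (hf₂.rarr 4 (by decide)).trans r4
    rw [hin₂.size]
    set s₃ := (s₂.setW 3 n).setW 11 ((s₂.setW 3 n).wreg 1) with hs₃
    have k11 : s₃.wreg 11 = i := by simp [hs₃, f1]
    have k3 : s₃.wreg 3 = n := by simp [hs₃]
    refine (runs_fill (s := s₃) (W := W) (by omega) (by omega)).mono ?_
    rintro s₄ t₄ hf₄ ⟨hfill, ht₄⟩
    rw [k11, k3] at hfill ht₄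
    have l1 : s₄.wreg 1 = i := (hf₄.wreg 1 (by decide)).trans (by simp [hs₃, f1])
    have l3 : s₄.wreg 3 = n := (hf₄.wreg 3 (by decide)).trans k3
    have l8 : s₄.wreg 8 = s₂.wreg 8 := (hf₄.wreg 8 (by decide)).trans (by simp [hs₃])
    have l12 : s₄.wreg 12 = s₂.wreg 12 := (hf₄.wreg 12 (by decide)).trans (by simp [hs₃])
    have lw : s₄.warr = s₂.warr := funext fun x =>
      (hf₄.warr x (by simp [forUp, Prog.warrs])).trans (by simp [hs₃])
    rw [l1]
    have hcnt₂ : s₂.wreg 8 + nonStarts n (s₂.warr 2) ≤ n := hR₂.count.le.trans hcnt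
    set s₅ := s₄.setW 2 i with hs₅
    have m2 : s₅.wreg 2 = i := by simp [hs₅]
    have m3 : s₅.wreg 3 = n := by simpa [hs₅] using l3
    have m8 : s₅.wreg 8 = s₂.wreg 8 := by simpa [hs₅] using l8
    have hlay₅ : s₅.layout = s₂.layout := by
      simp [Memory.layout, hs₅, l8, lw]
    refine (runs_extractMin (s := s₅) (W := W) (by omega) (by omega) (by omega) (by omega)).mono ?_
    rintro s₆ t₆ hf₆ ⟨b, σ, hE, hbn, hbb, ht₆⟩
    have n12 : s₆.wreg 12 = s₂.wreg 12 := (hf₆.wreg 12 (by decide)).trans (by simp [hs₅, l12])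
    rw [m2, m3, hlay₅] at *
    have hb₂ : s₂.layout.bd b ≠ 0 := by
      rcases hbb with rfl | hbb
      · exact hI₂.bd_last
      · have : s₅.warr 2 = s₂.warr 2 := by simp [hs₅, lw]
        rw [this] at hbb
        exact hbb
    have hbi : s₂.layout.bd i ≠ 0 := hR₂.bd_ne i (hb i le_rfl)
    have hE' : Extracts (fun x => -(rank x : ℝ)) i b (s₆.wreg 5) s₂.layout s₆.layout σ := by
      refine hE.congr fun j hj hj' => ?_
      have h1 : s₅.rarr 2 = s₄.rarr 2 := by simp [hs₅]
      have h2 := hfill j hj (by omega)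
      rw [h1]
      have h3 : s₃.warr 1 = s₂.warr 1 := by simp [hs₃]
      have h4 : s₃.rarr 4 = s.rarr 4 := by simp [hs₃, r4₂]
      rw [h3, h4] at h2
      exact h2.trans (hrank _ (hI₂.perm.1 j (by omega)))
    have hr₆ : Refines n i b s₂.layout s₆.layout :=
      hE'.refines le_rfl le_rfl hbn (fun h => h) (fun h => h)
    have hI₂' : OrderInv (gromov d 0) n s₂.layout.cnt s₂.layout := by
      rw [h12₂] at hI₂
      exact hI₂
    obtain ⟨hc, hI₆, hb₆⟩ := hI₂'.extract (gromov_symm hd 0) hinj hsearch hi hbi hbn hb₂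
      (fun x _ => rfl) hE'
    have hcnt₆ : s₆.wreg 8 + nonStarts n (s₆.warr 2) ≤ n := hr₆.count.le.trans hcnt₂
    have hw₆ : s₆.layout.work (s₂.wreg 12) = s₂.layout.work (s₂.wreg 12) :=
      hr₆.work_eq hI₂.head_le
    have hnz₆ : nonStarts n (s₆.warr 2) ≤ nonStarts n (s₂.warr 2) := by
      have h1 : s₆.wreg 8 + nonStarts n (s₆.warr 2) = s₂.wreg 8 + nonStarts n (s₂.warr 2) :=
        hr₆.count
      have h2 : s₂.wreg 8 ≤ s₆.wreg 8 := hr₆.cnt_le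
      omega
    have hlay₆ : (s₆.setW 1 (i + 1)).layout = s₆.layout := rfl
    rw [hlay₆]
    simp only [Memory.setW_wreg, Memory.setW_warr, Nat.reduceEqDiff, OfNat.ofNat_ne_one, reduceIte,
      n12, hw₆]
    refine ⟨?_, fun j hj => ?_, hcnt₆, ?_⟩
    · rw [h12₂]
      exact hI₆
    · by_cases e : j = i + 1
      · rw [e]; exact hb₆
      · exact hr₆.bd_ne j (hR₂.bd_ne j (hb j (by omega)))
    · have h1 : 300 * (n + 1) * (i + 1) = 300 * (n + 1) * i + 300 * (n + 1) := by ring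
      have h2 := Nat.mul_le_mul_left (170 * (n + 1)) hnz₆
      omega
  · rintro s₁ t hf - ⟨hI, hb, -, ht⟩
    rw [e0] at hb ht
    refine ⟨hI.perm, ?_, ?_⟩
    · obtain ⟨R, hR, hord⟩ := hI.order
      exact ⟨R, hR, fun j k hjk hk => hord j k hjk hk fun hs => hb k hk.le (hs k (by omega))⟩
    · have h1 := hI.work_le
      have h2 : 170 * (n + 1) * n + 620 * (n * n) + 300 * (n + 1) * n + 8 ≤ 1500 * (n + 1) ^ 2 := by
        nlinarith
      omega

/-- Compute a circular ordering of the distance. -/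
def circularOrder : Prog := block [search, storeRanks, refineOrder]

/-- `circularOrder` leaves in word array `1` a circular ordering of the distance. -/
theorem runs_circularOrder {W n : ℕ} {d : ℕ → ℕ → ℝ} {s : Memory}
    (hd : ∀ x y, d x y = d y x) (hs : HoldsInput n d s) (hn : 0 < n) (hW : (n + 2) ^ 2 ≤ W)
    (hR : ∃ R, Valid (gromov d 0) (Finset.range n) R)
    (h8 : s.wreg 8 = 0) (hbd : ∀ k, s.warr 2 k = 0) :
    Runs W circularOrder s fun s' t => IsPerm n (s'.warr 1) ∧
      (∀ i j k l, i < j → j < k → k < l → l < n →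
        Kalmanson d (s'.warr 1 i) (s'.warr 1 j) (s'.warr 1 k) (s'.warr 1 l)) ∧
      t ≤ 3000 * (n + 1) ^ 2 := by
  have hnW : n + 2 ≤ W := le_trans (by nlinarith) hW
  simp only [circularOrder, block, runs_seq]
  refine (runs_search hs hW h8 hbd).mono ?_
  rintro s₁ t₁ hf₁ ⟨hS, ht₁⟩
  have hin₁ : HoldsInput n d s₁ := hs.frame hf₁
  refine (runs_storeRanks hin₁.size hn hnW hS.perm (hS.start n hn le_rfl)).mono ?_
  rintro s₂ t₂ hf₂ ⟨g1, g2, g3, g4, g5, g6, ht₂⟩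
  have hin₂ : HoldsInput n d s₂ := hin₁.frame hf₂
  have a1 : s₂.warr 1 = s₁.warr 1 := hf₂.warr 1 (by decide)
  have hex : ∀ x, ∃ i, x < n → i < n ∧ s₁.warr 1 i = x := by
    intro x
    by_cases hx : x < n
    · obtain ⟨i, hi, e⟩ := hS.perm.exists_eq hx
      exact ⟨i, fun _ => ⟨hi, e⟩⟩
    · exact ⟨0, fun h => absurd h hx⟩
  choose rank hrank using hex
  have hrank' : ∀ i < n, rank (s₁.layout.arr i) = i := fun i hi => by
    have hi' := hS.perm.1 i hi
    exact hS.perm.2 _ (hrank _ hi').1 _ hi (hrank _ hi').2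
  refine (runs_refineOrder (rank := rank) hd hin₂ hn hW hR (fun x hx y hy e => ?_)
    (hS.searchOrder hrank') (a1 ▸ hS.perm) (fun x hx => ?_) g2 g3 g4 g5 g6).mono ?_
  · rw [← (hrank x hx).2, ← (hrank y hy).2, e]
  · have := g1 _ (hrank x hx).1
    rwa [(hrank x hx).2] at this
  rintro s₃ t₃ hf₃ ⟨hp, ⟨R, hR, hord⟩, ht₃⟩
  have hm : ∀ i < n, s₃.warr 1 i ∈ Finset.range n := fun i hi => Finset.mem_range.2 (hp.1 i hi)
  refine ⟨hp, fun i j k l hij hjk hkl hl => hR.kalmanson (hm i (by omega)) (hm j (by omega))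
    (hm k (by omega)) (hm l hl) (hord i j hij (by omega)) (hord j k hjk (by omega))
    (hord k l hkl hl), ?_⟩
  have : 30 * (n + 1) ≤ 30 * (n + 1) ^ 2 := by nlinarith
  omega

/-! ### Bisectors of a distance in circular position -/

/-- A distance `δ` between the positions on a cycle of length `n`, numbered periodically, that
satisfies the triangle inequality and the first Kalmanson inequality. -/
structure CircularMetric (n : ℕ) (δ : ℕ → ℕ → ℝ) : Prop where
  mod : ∀ x y, δ (x % n) (y % n) = δ x y
  symm : ∀ x y, δ x y = δ y x
  self : ∀ x, δ x x = 0
  triangle : ∀ x y z, δ x z ≤ δ x y + δ y z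
  kalmanson : ∀ i j k l, i ≤ j → j ≤ k → k ≤ l → l ≤ i + n → δ i j + δ k l ≤ δ i k + δ j l

/-- A circular ordering `e` of the elements yields a `CircularMetric`. -/
theorem CircularMetric.of_kalmanson {n : ℕ} {d : ℕ → ℕ → ℝ} {e : ℕ → ℕ} (hn : 0 < n)
    (hsymm : ∀ x y, d x y = d y x) (hself : ∀ x, d x x = 0)
    (htri : ∀ x < n, ∀ y < n, ∀ z < n, d x z ≤ d x y + d y z) (he : ∀ i < n, e i < n)
    (hk : ∀ i j k l, i < j → j < k → k < l → l < n → Kalmanson d (e i) (e j) (e k) (e l)) :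
    CircularMetric n fun i j => d (e (i % n)) (e (j % n)) := by
  have hm : ∀ i, e (i % n) < n := fun i => he _ (Nat.mod_lt _ hn)
  have htri' : ∀ x y z, d (e (x % n)) (e (z % n)) ≤
      d (e (x % n)) (e (y % n)) + d (e (y % n)) (e (z % n)) :=
    fun x y z => htri _ (hm x) _ (hm y) _ (hm z)
  have main : ∀ i j k l, i < n → i ≤ j → j ≤ k → k ≤ l → l ≤ i + n →
      d (e (i % n)) (e (j % n)) + d (e (k % n)) (e (l % n)) ≤
        d (e (i % n)) (e (k % n)) + d (e (j % n)) (e (l % n)) := by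
    intro i j k l hi hij hjk hkl hli
    rcases hij.eq_or_lt with rfl | hij
    · rw [hself, zero_add, hsymm (e (i % n)) (e (k % n))]
      exact htri' _ _ _
    rcases hjk.eq_or_lt with rfl | hjk
    · exact le_rfl
    rcases hkl.eq_or_lt with rfl | hkl
    · rw [hself, add_zero, hsymm (e (j % n)) (e (k % n))]
      exact htri' _ _ _
    rcases hli.eq_or_lt with rfl | hli
    · rw [Nat.add_mod_right, hsymm (e (j % n)) (e (i % n)), hsymm (e (k % n)) (e (i % n)), add_comm]
    rw [Nat.mod_eq_of_lt hi]
    have wrap : ∀ x, n ≤ x → x < i + n → x % n = x - n := fun x h1 h2 => by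
      rw [Nat.mod_eq_sub_mod h1, Nat.mod_eq_of_lt (by omega)]
    by_cases hj : j < n
    · rw [Nat.mod_eq_of_lt hj]
      by_cases hk' : k < n
      · rw [Nat.mod_eq_of_lt hk']
        by_cases hl : l < n
        · rw [Nat.mod_eq_of_lt hl]
          exact (hk i j k l hij hjk hkl hl).1
        · rw [wrap l (by omega) hli]
          exact ((hk (l - n) i j k (by omega) hij hjk hk').rotate hsymm).1
      · rw [wrap k (by omega) (by omega), wrap l (by omega) hli]
        exact (((hk (k - n) (l - n) i j (by omega) (by omega) hij hj).rotate hsymm).rotate hsymm).1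
    · rw [wrap j (by omega) (by omega), wrap k (by omega) (by omega), wrap l (by omega) hli]
      exact ((((hk (j - n) (k - n) (l - n) i (by omega) (by omega) (by omega) hi).rotate
        hsymm).rotate hsymm).rotate hsymm).1
  refine ⟨fun x y => by simp only [Nat.mod_mod], fun x y => hsymm _ _, fun x => hself _, htri',
    fun i j k l hij hjk hkl hli => ?_⟩
  have hq : n * (i / n) ≤ i := Nat.mul_div_le i n
  have hi := Nat.mod_add_div i n
  have shift : ∀ x, i ≤ x → (x - n * (i / n)) % n = x % n := fun x hx => by
    conv_rhs => rw [← Nat.sub_add_cancel (hq.trans hx), Nat.add_mul_mod_self_left]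
  have := main (i - n * (i / n)) (j - n * (i / n)) (k - n * (i / n)) (l - n * (i / n))
    (by have := Nat.mod_lt i hn; omega) (by omega) (by omega) (by omega) (by omega)
  rwa [shift i le_rfl, shift j hij, shift k (by omega), shift l (by omega)] at this

/-- `x` is nearer to `i` than to `j`. -/
def Nearer (δ : ℕ → ℕ → ℝ) (i j x : ℕ) : Prop := δ i x < δ j x

/-- The bisector of `i` and `j` passes between the positions `g` and `g + 1`. -/
def Cut (δ : ℕ → ℕ → ℝ) (i j g : ℕ) : Prop := ¬ (Nearer δ i j g ↔ Nearer δ i j (g + 1))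

open Classical in
/-- The entry at `(g, g')` of the matrix that encodes the bisector of `i` and `j`: the indicator of
the pairs of different cuts, and minus one half on the diagonal at the cuts. -/
noncomputable def cutWeight (δ : ℕ → ℕ → ℝ) (i j g g' : ℕ) : ℝ :=
  if g = g' then (if Cut δ i j g then -1 / 2 else 0) else
    if Cut δ i j g ∧ Cut δ i j g' then 1 else 0

open Classical in
/-- The indicator of the pairs of positions separated by the bisector of `i` and `j`. -/
noncomputable def bisects (δ : ℕ → ℕ → ℝ) (i j x y : ℕ) : ℝ :=
  if (Nearer δ i j x ↔ Nearer δ i j y) then 0 else 1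

theorem bisects_symm (δ : ℕ → ℕ → ℝ) (i j x y : ℕ) : bisects δ i j x y = bisects δ i j y x := by
  classical
  exact if_congr iff_comm rfl rfl

theorem bisects_self (δ : ℕ → ℕ → ℝ) (i j x : ℕ) : bisects δ i j x x = 0 := by
  simp [bisects]

theorem exists_change {p : ℕ → Prop} {a b : ℕ} (hab : a ≤ b) (ha : p a)
    (hb : ¬ p b) : ∃ g, a ≤ g ∧ g < b ∧ p g ∧ ¬ p (g + 1) := by
  by_contra hc
  push Not at hc
  have key : ∀ m, a ≤ m → m ≤ b → p m := fun m hm => by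
    induction m, hm using Nat.le_induction with
    | base => exact fun _ => ha
    | succ m hm ih => exact fun hmb => hc m hm hmb (ih (by omega))
  exact hb (key b hab le_rfl)

namespace CircularMetric

variable {n : ℕ} {δ : ℕ → ℕ → ℝ} {i j : ℕ}

theorem nonneg (h : CircularMetric n δ) (x y : ℕ) : 0 ≤ δ x y := by
  have h1 := h.triangle x y x
  rw [h.self, h.symm y x] at h1
  linarith

theorem nearer_congr (h : CircularMetric n δ) {x y : ℕ} (hxy : x % n = y % n) :
    Nearer δ i j x ↔ Nearer δ i j y := by
  unfold Nearer
  rw [← h.mod i x, ← h.mod j x, hxy, h.mod, h.mod]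

/-- The difference of the distances to `i` and to `j` increases from `i` to `j`. -/
theorem nearer_left (h : CircularMetric n δ) {x y : ℕ} (hix : i ≤ x) (hxy : x ≤ y) (hyj : y ≤ j)
    (hj : j ≤ i + n) (hy : Nearer δ i j y) : Nearer δ i j x := by
  have := h.kalmanson i x y j hix hxy hyj hj
  unfold Nearer at *
  rw [h.symm y j, h.symm x j] at this
  linarith

/-- The difference of the distances to `i` and to `j` decreases from `j` to the next copy of
`i`. -/
theorem nearer_right (h : CircularMetric n δ) {x y : ℕ} (hjx : j ≤ x) (hxy : x ≤ y)
    (hyi : y ≤ i + n) (hi : i ≤ j) (hx : Nearer δ i j x) : Nearer δ i j y := by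
  have := h.kalmanson j x y (i + n) hjx hxy hyi (by omega)
  unfold Nearer at *
  rw [← h.mod y (i + n), ← h.mod x (i + n), Nat.add_mod_right, h.mod, h.mod, h.symm y i,
    h.symm x i] at this
  linarith

theorem nearer_self (h : CircularMetric n δ) (hij : 0 < δ i j) : Nearer δ i j i := by
  unfold Nearer
  rwa [h.self, h.symm]

theorem not_nearer_self (h : CircularMetric n δ) : ¬ Nearer δ i j j := by
  unfold Nearer
  rw [h.self]
  exact not_lt.2 (h.nonneg _ _)

theorem nearer_add (h : CircularMetric n δ) (hij : 0 < δ i j) : Nearer δ i j (i + n) :=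
  (h.nearer_congr (by simp)).2 (h.nearer_self hij)

theorem not_cut_of_eq_zero (h : CircularMetric n δ) (hij : δ i j ≤ 0) (g : ℕ) :
    ¬ Cut δ i j g := by
  have : ∀ x, ¬ Nearer δ i j x := fun x => by
    have := h.triangle j i x
    rw [h.symm j i] at this
    unfold Nearer
    linarith
  simp [Cut, this]

/-- There are at most two cuts, one on the way from `i` to `j` and one on the way back. -/
theorem cut_iff (h : CircularMetric n δ) {g₁ g₂ g : ℕ} (hi : i < n) (hij : i < j) (hji : j < i + n)
    (h1 : i ≤ g₁) (h1' : g₁ < j) (hn1 : Nearer δ i j g₁) (hf1 : ¬ Nearer δ i j (g₁ + 1))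
    (h2 : j ≤ g₂) (h2' : g₂ < i + n) (hf2 : ¬ Nearer δ i j g₂) (hn2 : Nearer δ i j (g₂ + 1))
    (hg : g < n) : Cut δ i j g ↔ g = g₁ % n ∨ g = g₂ % n := by
  have key : ∀ x, i ≤ x → x < i + n → (Cut δ i j x ↔ x = g₁ ∨ x = g₂) := by
    intro x hx hx'
    constructor
    · intro hc
      by_contra hne
      rw [not_or] at hne
      refine hc ?_
      by_cases hxj : x < j
      · by_cases hlt : x < g₁
        · exact iff_of_true (h.nearer_left hx hlt.le h1'.le hji.le hn1)
            (h.nearer_left (by omega) (by omega : x + 1 ≤ g₁) h1'.le hji.le hn1)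
        · have hlt : g₁ + 1 ≤ x := by omega
          exact iff_of_false (fun e => hf1 (h.nearer_left (by omega) hlt hxj.le hji.le e))
            fun e => hf1 (h.nearer_left (by omega) (by omega) (by omega : x + 1 ≤ j) hji.le e)
      · by_cases hlt : x < g₂
        · exact iff_of_false (fun e => hf2 (h.nearer_right (by omega) hlt.le h2'.le hij.le e))
            fun e => hf2 (h.nearer_right (by omega) (by omega : x + 1 ≤ g₂) h2'.le hij.le e)
        · have hlt : g₂ + 1 ≤ x := by omega
          exact iff_of_true (h.nearer_right (by omega) hlt hx'.le hij.le hn2)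
            (h.nearer_right (by omega) (by omega : g₂ + 1 ≤ x + 1) (by omega) hij.le hn2)
    · rintro (rfl | rfl) hc
      · exact hf1 (hc.1 hn1)
      · exact hf2 (hc.2 hn2)
  have hmod : ∀ x, i ≤ x → x < i + n → x % n = if x < n then x else x - n := by
    intro x hx hx'
    split_ifs with e
    · exact Nat.mod_eq_of_lt e
    · rw [Nat.mod_eq_sub_mod (by omega), Nat.mod_eq_of_lt (by omega)]
  rw [hmod g₁ h1 (by omega), hmod g₂ (by omega) h2']
  by_cases hgi : i ≤ g
  · rw [key g hgi (by omega)]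
    split_ifs <;> omega
  · have : Cut δ i j g ↔ Cut δ i j (g + n) := by
      unfold Cut
      rw [h.nearer_congr (i := i) (j := j) (show g % n = (g + n) % n by simp),
        h.nearer_congr (i := i) (j := j) (show (g + 1) % n = (g + n + 1) % n by
          rw [show g + n + 1 = g + 1 + n by ring]; simp)]
    rw [this, key (g + n) (by omega) (by omega)]
    split_ifs <;> omega

/-- If the bisector has cuts at `k` and at `m`, then there is none between them. -/
theorem nearer_between (h : CircularMetric n δ) {k m : ℕ} (hi : i < n) (hij : i < j)
    (hji : j < i + n) (hkm : k < m) (hm : m < n) (hck : Cut δ i j k) (hcm : Cut δ i j m) :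
    Nearer δ i j (k + 1) ↔ Nearer δ i j m := by
  have hpos : 0 < δ i j := by
    by_contra e
    exact h.not_cut_of_eq_zero (not_lt.1 e) _ hck
  obtain ⟨g₁, h1, h1', hn1, hf1⟩ := exists_change hij.le (h.nearer_self hpos) h.not_nearer_self
  obtain ⟨g₂, h2, h2', hf2, hn2⟩ := exists_change (p := fun x => ¬ Nearer δ i j x) hji.le
    h.not_nearer_self (not_not.2 (h.nearer_add hpos))
  rw [not_not] at hn2
  have hck' := (h.cut_iff hi hij hji h1 h1' hn1 hf1 h2 h2' hf2 hn2 (hkm.trans hm)).1 hck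
  have hcm' := (h.cut_iff hi hij hji h1 h1' hn1 hf1 h2 h2' hf2 hn2 hm).1 hcm
  have succ : ∀ x, Nearer δ i j (x % n + 1) ↔ Nearer δ i j (x + 1) := fun x =>
    h.nearer_congr (by simp)
  have same : ∀ x, Nearer δ i j (x % n) ↔ Nearer δ i j x := fun x => h.nearer_congr (by simp)
  rcases hck' with rfl | rfl <;> rcases hcm' with rfl | rfl
  · omega
  · rw [succ, same]
    exact iff_of_false hf1 hf2
  · rw [succ, same]
    exact iff_of_true hn2 hn1
  · omega

theorem bisects_recursion (h : CircularMetric n δ) {k l : ℕ} (hi : i < n) (hij : i < j)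
    (hji : j < i + n) (hkl : k < l) (hl : l < n) :
    bisects δ i j k l = bisects δ i j k (l - 1) + bisects δ i j (k + 1) l -
      (if k + 1 < l then bisects δ i j (k + 1) (l - 1) else 0) - 2 * cutWeight δ i j k (l - 1) := by
  obtain ⟨m, rfl⟩ : ∃ m, l = m + 1 := ⟨l - 1, by omega⟩
  rw [Nat.add_sub_cancel]
  rcases (show k = m ∨ k < m by omega) with rfl | hkm
  · rw [bisects_self, bisects_self, if_neg (lt_irrefl _)]
    simp only [bisects, cutWeight, if_true, Cut]
    by_cases e : Nearer δ i j k ↔ Nearer δ i j (k + 1) <;> norm_num [e]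
  · rw [if_pos (by omega)]
    have hb := h.nearer_between hi hij hji hkm (by omega)
    simp only [bisects, cutWeight, if_neg hkm.ne]
    unfold Cut at *
    by_cases a1 : Nearer δ i j k <;> by_cases a2 : Nearer δ i j (k + 1) <;>
      by_cases a3 : Nearer δ i j m <;> by_cases a4 : Nearer δ i j (m + 1) <;>
      simp [a1, a2, a3, a4] at hb ⊢ <;> norm_num

end CircularMetric

/-! ### Collecting the cuts of all bisectors -/

/-- Binary search for a change of the test `b`, which is to read the position in register `22`:
between the positions `wreg 20`, where it fails, and `wreg 21`, where it succeeds. -/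
def binarySearch (b : Test) : Prog :=
  .loop (.wle (.add (.reg 20) (.const 2)) (.reg 21)) (block [
    .setW 22 (.half (.add (.reg 20) (.reg 21))),
    .cond b (.setW 21 (.reg 22)) (.setW 20 (.reg 22))])

/-- The length of the search interval is at most `2 ^ K` in the beginning and is halved in each
round, so that there are at most `K` rounds. -/
theorem runs_binarySearch {W K : ℕ} {b : Test} {p : ℕ → Prop} {s : Memory}
    (hW : 2 * s.wreg 21 + 2 ≤ W) (hlt : s.wreg 20 < s.wreg 21)
    (hlo : ¬ p (s.wreg 20)) (hhi : p (s.wreg 21)) (hK : s.wreg 21 - s.wreg 20 ≤ 2 ^ K)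
    (hb : ∀ s₁, Frame (binarySearch b) s s₁ → s₁.wreg 22 ≤ s.wreg 21 →
      b.Fits W s₁ ∧ (b.Holds s₁ ↔ p (s₁.wreg 22))) :
    Runs W (binarySearch b) s fun s' t => s.wreg 20 ≤ s'.wreg 20 ∧ s'.wreg 20 < s.wreg 21 ∧
      ¬ p (s'.wreg 20) ∧ p (s'.wreg 20 + 1) ∧ t ≤ (b.cost + 20) * K + 10 := by
  refine Runs.loop (I := fun s₁ t => s.wreg 20 ≤ s₁.wreg 20 ∧ s₁.wreg 20 < s₁.wreg 21 ∧
      s₁.wreg 21 ≤ s.wreg 21 ∧ ¬ p (s₁.wreg 20) ∧ p (s₁.wreg 21) ∧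
      ∃ k, s₁.wreg 21 - s₁.wreg 20 ≤ 2 ^ k ∧ t + (b.cost + 20) * k ≤ (b.cost + 20) * K)
    (fun s₁ => s₁.wreg 21 - s₁.wreg 20) ⟨le_rfl, hlt, le_rfl, hlo, hhi, K, hK, by omega⟩ ?_ ?_
  · rintro s₁ t hf ⟨h1, h2, h3, h4, h5, k, hk, ht⟩
    simp only [Test.Fits, Test.Holds, Test.cost, WExp.Fits, WExp.eval, WExp.cost]
    refine ⟨⟨⟨trivial, by omega, by omega⟩, trivial⟩, fun hlt₁ => ?_⟩
    obtain ⟨k, rfl⟩ : ∃ k', k = k' + 1 := by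
      rcases k with _ | k
      · simp at hk
        omega
      · exact ⟨k, rfl⟩
    rw [pow_succ] at hk
    simp only [block, runs_seq, runs_setW, runs_cond, WExp.Fits, WExp.eval, WExp.cost, true_and,
      Memory.setW_wreg, reduceIte, Nat.reduceEqDiff]
    obtain ⟨hfit, hhold⟩ := hb (s₁.setW 22 ((s₁.wreg 20 + s₁.wreg 21) / 2))
      ⟨fun x hx => by
        have hx' : x ≠ 22 := fun e => hx (by simp [e, binarySearch, block, Prog.wregs])
        simp only [Memory.setW_wreg, if_neg hx']
        exact hf.wreg x hx, fun x hx => hf.warr x hx, fun x hx => hf.rreg x hx,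
        fun x hx => hf.rarr x hx⟩ (by simp; omega)
    simp only [Memory.setW_wreg, reduceIte] at hhold
    rw [mul_add, mul_one] at ht
    refine ⟨by omega, hfit, fun hc => ?_, fun hc => ?_⟩
    · refine ⟨⟨h1, by omega, by omega, h4, hhold.1 hc, k, by omega, by omega⟩, by omega⟩
    · refine ⟨⟨by omega, by omega, h3, fun e => hc (hhold.2 e), h5, k, by omega, by omega⟩,
        by omega⟩
  · rintro s₁ t hf ⟨h1, h2, h3, h4, h5, k, hk, ht⟩ hdone
    simp only [Test.Holds, WExp.eval] at hdone
    have e : s₁.wreg 21 = s₁.wreg 20 + 1 := by omega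
    rw [e] at h5
    refine ⟨h1, by omega, h4, h5, ?_⟩
    simp only [Test.cost, WExp.cost]
    omega

/-- Word register `0` holds `n`, and the distances between the elements at the positions below
`2 * n` of word array `1` are given by `δ`. -/
structure HoldsCycle (n : ℕ) (δ : ℕ → ℕ → ℝ) (s : Memory) : Prop where
  size : s.wreg 0 = n
  lt : ∀ x < 2 * n, s.warr 1 x < n
  matrix : ∀ x < 2 * n, ∀ y < 2 * n, s.rarr 0 (s.warr 1 x * n + s.warr 1 y) = δ x y

theorem HoldsCycle.frame {n : ℕ} {δ : ℕ → ℕ → ℝ} {s s' : Memory} {c : Prog}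
    (h : HoldsCycle n δ s) (hf : Frame c s s') (h0 : 0 ∉ c.wregs := by decide)
    (h1 : 1 ∉ c.warrs := by decide) (h2 : 0 ∉ c.rarrs := by decide) : HoldsCycle n δ s' :=
  ⟨(hf.wreg 0 h0).trans h.size, fun x hx => by rw [hf.warr 1 h1]; exact h.lt x hx,
    fun x hx y hy => by rw [hf.warr 1 h1, hf.rarr 0 h2]; exact h.matrix x hx y hy⟩

/-- The test whether the element at position `wreg 22` is at least as near to the element with row
`wreg 25` as to the one with row `wreg 19`. -/
def notNearer : Test :=
  .rle (.arr 0 (.add (.reg 25) (.arr 1 (.reg 22)))) (.arr 0 (.add (.reg 19) (.arr 1 (.reg 22))))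

/-- Reduce word register `x` modulo `wreg 0`, if it is less than twice `wreg 0`. -/
def reduce (x : ℕ) : Prog := .cond (.wle (.reg 0) (.reg x)) (.setW x (.sub (.reg x) (.reg 0))) .skip

/-- Add `c` to the entry of real array `3` in row `wreg x` and column `wreg y`. -/
def addEntry (x y : ℕ) (c : ℚ) : Prog :=
  .storeR 3 (.add (.mul (.reg x) (.reg 0)) (.reg y))
    (.add (.arr 3 (.add (.mul (.reg x) (.reg 0)) (.reg y))) (.const c))

/-- Add to real array `3` the matrix that encodes cuts at `wreg 23` and at `wreg 24`. -/
def addCuts : Prog := block [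
  addEntry 23 24 1,
  addEntry 24 23 1,
  addEntry 23 23 (-1 / 2),
  addEntry 24 24 (-1 / 2)]

/-- Add the matrix that encodes the bisector of the positions `wreg 17` and `wreg 18` to real
array `3`. -/
def addBisector : Prog := block [
  .setW 19 (.mul (.arr 1 (.reg 17)) (.reg 0)),
  .setW 25 (.mul (.arr 1 (.reg 18)) (.reg 0)),
  .cond (.rle (.arr 0 (.add (.reg 19) (.arr 1 (.reg 18)))) (.const 0)) .skip (block [
    .setW 20 (.reg 17),
    .setW 21 (.reg 18),
    binarySearch notNearer,
    .setW 23 (.reg 20),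
    reduce 23,
    .setW 20 (.reg 18),
    .setW 21 (.add (.reg 17) (.reg 0)),
    binarySearch (.neg notNearer),
    .setW 24 (.reg 20),
    reduce 24,
    addCuts])]

theorem runs_reduce {W x : ℕ} {s : Memory} {Q : Memory → ℕ → Prop} (hlt : s.wreg x < 2 * s.wreg 0)
    (hQ : ∀ t ≤ 10, Q (s.setW x (s.wreg x % s.wreg 0)) t) : Runs W (reduce x) s Q := by
  simp only [reduce, runs_cond, runs_setW, runs_skip, Test.Fits, Test.Holds, Test.cost, WExp.Fits,
    WExp.eval, WExp.cost, true_and, and_self]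
  refine ⟨fun h => ?_, fun h => ?_⟩
  · have := hQ (3 + 1 + (3 + 1)) (by omega)
    rwa [Nat.mod_eq_sub_mod h, Nat.mod_eq_of_lt (by omega)] at this
  · have := hQ (3 + 1 + 1) (by omega)
    rw [Nat.mod_eq_of_lt (by omega)] at this
    convert this using 1
    simp [Memory.setW]

theorem index_inj {n a b a' b' : ℕ} (hb : b < n) (hb' : b' < n) (h : a * n + b = a' * n + b') :
    a = a' ∧ b = b' := by
  have hn : 0 < n := by omega
  constructor
  · have := congrArg (· / n) h
    simpa [Nat.add_div_of_dvd_right (dvd_mul_left n _), Nat.div_eq_of_lt hb,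
      Nat.div_eq_of_lt hb', hn] using this
  · have := congrArg (· % n) h
    simpa [Nat.mod_eq_of_lt hb, Nat.mod_eq_of_lt hb'] using this

theorem index_lt {n W a b : ℕ} (hW : (n + 2) ^ 2 ≤ W) (ha : a < n) (hb : b < n) :
    a * n + b ≤ W := by
  have : a * n ≤ n * n := Nat.mul_le_mul_right n ha.le
  nlinarith

/-- The rows of an `n × n` matrix stored in an array do not overlap. -/
theorem update_index {n a b g g' : ℕ} (f : ℕ → ℝ) (v : ℝ) (hb : b < n) (hg : g' < n) :
    Function.update f (a * n + b) v (g * n + g') =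
      if g = a ∧ g' = b then v else f (g * n + g') := by
  by_cases h : g = a ∧ g' = b
  · obtain ⟨rfl, rfl⟩ := h
    simp
  · rw [if_neg h, Function.update_of_ne fun e => h (index_inj hg hb e)]

open Classical in
theorem runs_addCuts {W n a b : ℕ} {s : Memory} (hW : (n + 2) ^ 2 ≤ W) (h0 : s.wreg 0 = n)
    (h23 : s.wreg 23 = a) (h24 : s.wreg 24 = b) (ha : a < n) (hb : b < n) (hab : a ≠ b) :
    Runs W addCuts s fun s' t => (∀ g < n, ∀ g' < n,
      s'.rarr 3 (g * n + g') = s.rarr 3 (g * n + g') +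
        if g = g' then (if g = a ∨ g = b then -1 / 2 else 0) else
          if (g = a ∨ g = b) ∧ (g' = a ∨ g' = b) then 1 else 0) ∧ t ≤ 100 := by
  have hrow : ∀ x < n, x * n ≤ W := fun x hx => by
    have := index_lt hW hx (show 0 < n by omega)
    omega
  simp only [addCuts, block, runs_seq, addEntry, runs_storeR, WExp.Fits, WExp.eval, WExp.cost,
    RExp.Fits, RExp.eval, RExp.cost, Memory.storeR_wreg, Memory.storeR_rarr, reduceIte, h0, h23,
    h24, hrow a ha, hrow b hb, index_lt hW ha hb, index_lt hW hb ha, index_lt hW ha ha,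
    index_lt hW hb hb, true_and]
  refine ⟨fun g hg g' hg' => ?_, by omega⟩
  simp only [update_index _ _ ha hg', update_index _ _ hb hg', update_index _ _ ha hb,
    update_index _ _ hb ha, update_index _ _ ha ha, update_index _ _ hb hb]
  by_cases x1 : g = a
  · have x2 : g ≠ b := fun e => hab (x1.symm.trans e)
    by_cases x3 : g' = a
    · have x4 : g' ≠ b := fun e => hab (x3.symm.trans e)
      simp [x1, x3, hab]
    · by_cases x4 : g' = b <;> simp [x1, x3, x4, hab, Ne.symm x3, hab.symm]
  · by_cases x2 : g = b
    · by_cases x3 : g' = a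
      · simp [x2, x3, hab, hab.symm]
      · by_cases x4 : g' = b
        · simp [x2, x4, hab.symm]
        · simp [x2, x3, x4, hab.symm, Ne.symm x4]
    · simp [x1, x2]

/-- Two binary searches, on the arc from `i` to `j` and on the arc from `j` to the next copy of `i`,
find the cuts of the bisector. If `i` and `j` have distance zero, there are none. -/
theorem runs_addBisector {W n K i j : ℕ} {δ : ℕ → ℕ → ℝ} {s : Memory} (hδ : CircularMetric n δ)
    (hs : HoldsCycle n δ s) (hW : (n + 2) ^ 2 ≤ W) (hK : n ≤ 2 ^ K)
    (hi : i < n) (hij : i < j) (hji : j < i + n) (h17 : s.wreg 17 = i) (h18 : s.wreg 18 = j) :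
    Runs W addBisector s fun s' t => (∀ g < n, ∀ g' < n,
      s'.rarr 3 (g * n + g') = s.rarr 3 (g * n + g') + cutWeight δ i j g g') ∧
      t ≤ 80 * K + 300 := by
  have hnW : 4 * n + 4 ≤ W := le_trans (by nlinarith) hW
  have hrow : ∀ x < n, x * n ≤ W := fun x hx => by
    have := index_lt hW hx (show 0 < n by omega)
    omega
  have e0 := hs.size
  have hli := hs.lt i (by omega)
  have hlj := hs.lt j (by omega)
  simp only [addBisector, block, runs_seq, runs_setW, runs_cond, runs_skip, WExp.Fits, WExp.eval,
    WExp.cost, RExp.Fits, RExp.eval, RExp.cost, Test.Fits, Test.Holds, Test.cost, true_and,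
    and_true, Memory.setW_wreg, Memory.setW_warr, Memory.setW_rarr, reduceIte, Nat.reduceEqDiff,
    OfNat.zero_ne_ofNat, e0, h17, h18, hs.matrix i (by omega) j (by omega)]
  refine ⟨hrow _ hli, hrow _ hlj, index_lt hW hli hlj, fun hz => ?_, fun hz => ?_⟩
  · refine ⟨fun g _ g' _ => ?_, by omega⟩
    have := hδ.not_cut_of_eq_zero (i := i) (j := j) (by simpa using hz)
    simp [cutWeight, this]
  have hpos : 0 < δ i j := by simpa using hz
  set s₁ := (((s.setW 19 (s.warr 1 i * n)).setW 25 (s.warr 1 j * n)).setW 20 i).setW 21 j with hs₁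
  have f0 : s₁.wreg 0 = n := by simp [hs₁, e0]
  have f19 : s₁.wreg 19 = s.warr 1 i * n := by simp [hs₁]
  have f25 : s₁.wreg 25 = s.warr 1 j * n := by simp [hs₁]
  have f20 : s₁.wreg 20 = i := by simp [hs₁]
  have f21 : s₁.wreg 21 = j := by simp [hs₁]
  have f17 : s₁.wreg 17 = i := by simp [hs₁, h17]
  have f18 : s₁.wreg 18 = j := by simp [hs₁, h18]
  have test : ∀ s₂ : Memory, s₂.wreg 19 = s.warr 1 i * n → s₂.wreg 25 = s.warr 1 j * n →
      s₂.warr 1 = s.warr 1 → s₂.rarr 0 = s.rarr 0 → s₂.wreg 22 < 2 * n →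
      notNearer.Fits W s₂ ∧ (notNearer.Holds s₂ ↔ ¬ Nearer δ i j (s₂.wreg 22)) := by
    intro s₂ g19 g25 a1 a0 hlt
    have := hs.lt _ hlt
    simp only [notNearer, Test.Fits, Test.Holds, RExp.Fits, RExp.eval, WExp.Fits, WExp.eval, g19,
      g25, a1, a0, true_and, hs.matrix i (by omega) _ hlt, hs.matrix j (by omega) _ hlt, Nearer,
      not_lt, and_true]
    exact ⟨index_lt hW hlj this, index_lt hW hli this⟩
  refine (runs_binarySearch (s := s₁) (K := K) (p := fun x => ¬ Nearer δ i j x) (by omega)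
    (by omega) (by rw [f20, not_not]; exact hδ.nearer_self hpos)
    (by rw [f21]; exact hδ.not_nearer_self) (by omega) fun s₂ hf₂ h22 =>
      test s₂ ((hf₂.wreg 19 (by decide)).trans f19) ((hf₂.wreg 25 (by decide)).trans f25)
        ((hf₂.warr 1 (by decide)).trans (by simp [hs₁]))
        ((hf₂.rarr 0 (by decide)).trans (by simp [hs₁])) (by omega)).mono ?_
  rintro s₂ t₂ hf₂ ⟨h1, h1', hn1, hf1, ht₂⟩
  rw [not_not] at hn1
  rw [f20] at h1
  rw [f21] at h1'
  set g₁ := s₂.wreg 20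
  have k0 : s₂.wreg 0 = n := (hf₂.wreg 0 (by decide)).trans f0
  have k17 : s₂.wreg 17 = i := (hf₂.wreg 17 (by decide)).trans f17
  have k18 : s₂.wreg 18 = j := (hf₂.wreg 18 (by decide)).trans f18
  have k19 : s₂.wreg 19 = s.warr 1 i * n := (hf₂.wreg 19 (by decide)).trans f19
  have k25 : s₂.wreg 25 = s.warr 1 j * n := (hf₂.wreg 25 (by decide)).trans f25
  have ka : s₂.warr 1 = s.warr 1 := (hf₂.warr 1 (by decide)).trans (by simp [hs₁])
  have kr : s₂.rarr 0 = s.rarr 0 := (hf₂.rarr 0 (by decide)).trans (by simp [hs₁])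
  have kc : s₂.rarr 3 = s.rarr 3 := (hf₂.rarr 3 (by decide)).trans (by simp [hs₁])
  refine runs_reduce (by simp [k0]; omega) fun t₃ ht₃ => ?_
  simp only [Memory.setW_wreg, reduceIte, Nat.reduceEqDiff, OfNat.zero_ne_ofNat, k0, k17, k18,
    true_and]
  refine ⟨by omega, ?_⟩
  set s₄ := (((s₂.setW 23 g₁).setW 23 (g₁ % n)).setW 20 j).setW 21 (i + n) with hs₄
  have l0 : s₄.wreg 0 = n := by simp [hs₄, k0]
  have l19 : s₄.wreg 19 = s.warr 1 i * n := by simp [hs₄, k19]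
  have l25 : s₄.wreg 25 = s.warr 1 j * n := by simp [hs₄, k25]
  have l20 : s₄.wreg 20 = j := by simp [hs₄]
  have l21 : s₄.wreg 21 = i + n := by simp [hs₄]
  have l23 : s₄.wreg 23 = g₁ % n := by simp [hs₄]
  refine (runs_binarySearch (s := s₄) (K := K) (b := .neg notNearer) (p := fun x => Nearer δ i j x)
    (by omega) (by omega) (by rw [l20]; exact hδ.not_nearer_self)
    (by rw [l21]; exact hδ.nearer_add hpos) (by omega) fun s₅ hf₅ h22 => by
      obtain ⟨q1, q2⟩ := test s₅ ((hf₅.wreg 19 (by decide)).trans l19)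
        ((hf₅.wreg 25 (by decide)).trans l25)
        ((hf₅.warr 1 (by decide)).trans (by simp [hs₄, ka]))
        ((hf₅.rarr 0 (by decide)).trans (by simp [hs₄, kr])) (by omega)
      exact ⟨q1, by rw [Test.Holds, q2, not_not]⟩).mono ?_
  rintro s₅ t₅ hf₅ ⟨h2, h2', hf2, hn2, ht₅⟩
  rw [l20] at h2
  rw [l21] at h2'
  set g₂ := s₅.wreg 20
  have m0 : s₅.wreg 0 = n := (hf₅.wreg 0 (by decide)).trans l0
  have m23 : s₅.wreg 23 = g₁ % n := (hf₅.wreg 23 (by decide)).trans l23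
  have mc : s₅.rarr 3 = s.rarr 3 := (hf₅.rarr 3 (by decide)).trans (by simp [hs₄, kc])
  refine runs_reduce (by simp [m0]; omega) fun t₆ ht₆ => ?_
  have hg1 : g₁ % n < n := Nat.mod_lt _ (by omega)
  have hg2 : g₂ % n < n := Nat.mod_lt _ (by omega)
  have hne : g₁ % n ≠ g₂ % n := by
    by_cases c1 : g₁ < n
    · by_cases c2 : g₂ < n
      · rw [Nat.mod_eq_of_lt c1, Nat.mod_eq_of_lt c2]; omega
      · rw [Nat.mod_eq_of_lt c1, Nat.mod_eq_sub_mod (by omega), Nat.mod_eq_of_lt (by omega)]; omega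
    · rw [Nat.mod_eq_sub_mod (by omega), Nat.mod_eq_of_lt (by omega),
        Nat.mod_eq_sub_mod (a := g₂) (by omega), Nat.mod_eq_of_lt (by omega)]
      omega
  have hcut := fun g hg => hδ.cut_iff (g := g) hi hij hji h1 h1' hn1 hf1 h2 h2' hf2 hn2 hg
  have c1 : notNearer.cost = 11 := rfl
  have c2 : (Test.neg notNearer).cost = 12 := rfl
  rw [c1] at ht₂
  rw [c2] at ht₅
  refine (runs_addCuts (n := n) (a := g₁ % n) (b := g₂ % n) hW (by simp [m0]) (by simp [m23])
    (by simp [m0]) hg1 hg2 hne).mono ?_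
  rintro s₇ t₇ - ⟨hadd, ht₇⟩
  refine ⟨fun g hg g' hg' => ?_, ?_⟩
  · rw [hadd g hg g' hg']
    simp only [cutWeight, hcut g hg, hcut g' hg', Memory.setW_rarr, mc]
  · clear * - ht₂ ht₃ ht₅ ht₆ ht₇
    omega

/-- Append a second copy of the circular ordering in word array `1`. -/
def doubleOrder : Prog := block [
  .setW 17 (.const 0),
  forUp 17 0 (.storeW 1 (.add (.reg 17) (.reg 0)) (.arr 1 (.reg 17)))]

theorem runs_doubleOrder {W n : ℕ} {s : Memory} (h0 : s.wreg 0 = n) (hW : (n + 2) ^ 2 ≤ W) :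
    Runs W doubleOrder s fun s' t => (∀ x < 2 * n, s'.warr 1 x = s.warr 1 (x % n)) ∧
      t ≤ 20 * (n + 1) := by
  have hnW : 4 * n + 4 ≤ W := le_trans (by nlinarith) hW
  simp only [doubleOrder, block, runs_seq, runs_setW, WExp.Fits, WExp.eval, WExp.cost]
  refine ⟨Nat.zero_le _, Runs.forUp (fun i s₁ t => (∀ x < n, s₁.warr 1 x = s.warr 1 x) ∧
    (∀ x < i, s₁.warr 1 (x + n) = s.warr 1 x) ∧ t ≤ 20 * i) ?_ ?_ ?_ ?_ ?_⟩
  · simp [h0]; omega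
  · simp
  · simp
  · rintro i s₁ t hf - hi e1 e0 ⟨h1, h2, ht⟩
    simp only [Memory.setW_wreg, OfNat.zero_ne_ofNat, reduceIte, h0] at hi e0
    simp only [runs_storeW, WExp.Fits, WExp.eval, WExp.cost, true_and, e1, e0, Memory.setW_warr,
      Memory.storeW_warr, reduceIte]
    refine ⟨by omega, fun x hx => ?_, fun x hx => ?_, by omega⟩
    · rw [Function.update_of_ne (by omega), h1 x hx]
    · by_cases e : x = i
      · rw [e, Function.update_self, h1 i hi]
      · rw [Function.update_of_ne (by omega)]
        exact h2 x (by omega)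
  · rintro s₁ t hf - ⟨h1, h2, ht⟩
    simp only [Memory.setW_wreg, OfNat.zero_ne_ofNat, reduceIte, h0] at h1 h2 ht
    refine ⟨fun x hx => ?_, by omega⟩
    by_cases e : x < n
    · rw [Nat.mod_eq_of_lt e]
      exact h1 x e
    · have := h2 (x - n) (by omega)
      rwa [Nat.sub_add_cancel (by omega), ← Nat.mod_eq_of_lt (show x - n < n by omega),
        ← Nat.mod_eq_sub_mod (by omega)] at this

/-- Sum up in real array `3` the matrices that encode the bisectors of all ordered pairs. -/
def collectCuts : Prog := block [
  .setW 17 (.const 0),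
  forUp 17 0 (block [
    .setW 26 (.add (.reg 17) (.reg 0)),
    .setW 18 (.add (.reg 17) (.const 1)),
    forUp 18 26 addBisector])]

theorem runs_addBisectors {W n K i : ℕ} {δ : ℕ → ℕ → ℝ} {s : Memory} (hδ : CircularMetric n δ)
    (hs : HoldsCycle n δ s) (hW : (n + 2) ^ 2 ≤ W) (hK : n ≤ 2 ^ K) (hi : i < n)
    (h17 : s.wreg 17 = i) (h18 : s.wreg 18 = i + 1) (h26 : s.wreg 26 = i + n) :
    Runs W (forUp 18 26 addBisector) s fun s' t => (∀ g < n, ∀ g' < n,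
      s'.rarr 3 (g * n + g') = s.rarr 3 (g * n + g') +
        ∑ j ∈ Finset.Ico (i + 1) (i + n), cutWeight δ i j g g') ∧
      t ≤ (80 * K + 350) * n := by
  have hnW : 4 * n + 4 ≤ W := le_trans (by nlinarith) hW
  refine Runs.forUp (fun j s₁ t => (∀ g < n, ∀ g' < n,
      s₁.rarr 3 (g * n + g') = s.rarr 3 (g * n + g') +
        ∑ j ∈ Finset.Ico (i + 1) j, cutWeight δ i j g g') ∧
      t ≤ (80 * K + 320) * (j - (i + 1))) ?_ ?_ ?_ ?_ ?_
  · omega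
  · omega
  · rw [h18]
    simp
  · rintro j s₁ t hf hj hj' e1 - ⟨h1, ht⟩
    have hs₁ : HoldsCycle n δ s₁ := hs.frame hf
    have e17 : s₁.wreg 17 = i := (hf.wreg 17 (by decide)).trans h17
    refine (runs_addBisector hδ hs₁ hW hK hi (j := j) (by omega) (by omega) e17 e1).mono ?_
    rintro s₂ t₂ - ⟨h2, ht₂⟩
    refine ⟨fun g hg g' hg' => ?_, ?_⟩
    · rw [Memory.setW_rarr, h2 g hg g' hg', h1 g hg g' hg', Finset.sum_Ico_succ_top (by omega),
        add_assoc]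
    · have : j + 1 - (i + 1) = j - (i + 1) + 1 := by omega
      rw [this, mul_add]
      omega
  · rintro s₁ t hf - ⟨h1, ht⟩
    rw [h26] at h1 ht
    refine ⟨h1, ?_⟩
    have h2 : (80 * K + 320) * (i + n - (i + 1)) ≤ (80 * K + 320) * n :=
      Nat.mul_le_mul_left _ (by omega)
    have h3 : (80 * K + 350) * n = (80 * K + 320) * n + 30 * n := by ring
    omega

theorem runs_collectCuts {W n K : ℕ} {δ : ℕ → ℕ → ℝ} {s : Memory} (hδ : CircularMetric n δ)
    (hs : HoldsCycle n δ s) (hW : (n + 2) ^ 2 ≤ W) (hK : n ≤ 2 ^ K)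
    (h3 : ∀ k, s.rarr 3 k = 0) :
    Runs W collectCuts s fun s' t => (∀ g < n, ∀ g' < n, s'.rarr 3 (g * n + g') =
        ∑ i ∈ Finset.range n, ∑ j ∈ Finset.Ico (i + 1) (i + n), cutWeight δ i j g g') ∧
      t ≤ (80 * K + 400) * (n + 1) ^ 2 := by
  have hnW : 4 * n + 4 ≤ W := le_trans (by nlinarith) hW
  have e0 := hs.size
  simp only [collectCuts, block, runs_seq, runs_setW, WExp.Fits, WExp.eval, WExp.cost, true_and]
  refine ⟨Nat.zero_le _, Runs.forUp (fun i s₁ t => (∀ g < n, ∀ g' < n, s₁.rarr 3 (g * n + g') =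
        ∑ i ∈ Finset.range i, ∑ j ∈ Finset.Ico (i + 1) (i + n), cutWeight δ i j g g') ∧
      t ≤ ((80 * K + 350) * n + 30) * i) ?_ ?_ ?_ ?_ ?_⟩
  · simp [e0]; omega
  · simp
  · simp [h3]
  · rintro i s₁ t hf - hi e1 e0' ⟨h1, ht⟩
    simp only [Memory.setW_wreg, OfNat.zero_ne_ofNat, reduceIte, e0] at hi e0'
    have hs₀ : HoldsCycle n δ (s.setW 17 0) := ⟨by simpa using e0, hs.lt, hs.matrix⟩
    have hs₁ : HoldsCycle n δ s₁ := hs₀.frame hf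
    simp only [runs_seq, runs_setW, WExp.Fits, WExp.eval, WExp.cost, Memory.setW_wreg, reduceIte,
      Nat.reduceEqDiff, OfNat.ofNat_ne_zero, e1, e0', true_and, and_true]
    refine ⟨by omega, ⟨by omega, by omega⟩, ?_⟩
    refine (runs_addBisectors (s := (s₁.setW 26 (i + n)).setW 18 (i + 1)) (i := i) hδ
      ⟨by simpa using e0', hs₁.lt, hs₁.matrix⟩ hW hK hi (by simp [e1]) (by simp) (by simp)).mono ?_
    rintro s₂ t₂ - ⟨h2, ht₂⟩
    refine ⟨fun g hg g' hg' => ?_, ?_⟩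
    · rw [Memory.setW_rarr, h2 g hg g' hg', Finset.sum_range_succ, ← h1 g hg g' hg']
      simp
    · rw [mul_add, mul_one]
      omega
  · rintro s₁ t hf - ⟨h1, ht⟩
    simp only [Memory.setW_wreg, OfNat.zero_ne_ofNat, reduceIte, e0] at h1 ht
    refine ⟨h1, ?_⟩
    have : ((80 * K + 350) * n + 30) * n + 8 ≤ (80 * K + 400) * (n + 1) ^ 2 := by
      have : 0 ≤ K * n := Nat.zero_le _
      nlinarith
    omega

/-! ### Summing up the bisectors -/

/-- Compute the entry of the output matrix at the positions `wreg 18` and `wreg 19` of the circular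
ordering from the entries at positions closer to each other. -/
def fillEntry : Prog := block [
  .setR 5 (.sub (.sub (.add
      (.arr 1 (.add (.mul (.arr 1 (.reg 18)) (.reg 0)) (.arr 1 (.sub (.reg 19) (.const 1)))))
      (.arr 1 (.add (.mul (.arr 1 (.add (.reg 18) (.const 1))) (.reg 0)) (.arr 1 (.reg 19)))))
      (.arr 1 (.add (.mul (.arr 1 (.add (.reg 18) (.const 1))) (.reg 0))
        (.arr 1 (.sub (.reg 19) (.const 1))))))
      (.mul (.reg 0) (.arr 3 (.add (.mul (.reg 18) (.reg 0)) (.sub (.reg 19) (.const 1)))))),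
  .storeR 1 (.add (.mul (.arr 1 (.reg 18)) (.reg 0)) (.arr 1 (.reg 19))) (.reg 5),
  .storeR 1 (.add (.mul (.arr 1 (.reg 19)) (.reg 0)) (.arr 1 (.reg 18))) (.reg 5)]

/-- Compute the output matrix, row by row from the last position of the circular ordering. -/
def fillMatrix : Prog := block [
  .setW 17 (.const 0),
  forUp 17 0 (block [
    .setW 18 (.sub (.sub (.reg 0) (.const 1)) (.reg 17)),
    .setW 19 (.add (.reg 18) (.const 1)),
    forUp 19 0 fillEntry])]

/-- The part of the matrix `O` filled before the entries of row `k` from column `l` on; the other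
entries are zero. -/
def partialMatrix (O : ℕ → ℕ → ℝ) (k l x y : ℕ) : ℝ :=
  if k < min x y ∨ (min x y = k ∧ max x y < l) then O x y else 0

/-- The entries of row `k` are computed from left to right, from the entries to their left and from
row `k + 1`. -/
theorem runs_fillRow {W n k : ℕ} {p : ℝ} {O c : ℕ → ℕ → ℝ} {s : Memory} (h0 : s.wreg 0 = n)
    (hW : (n + 2) ^ 2 ≤ W) (hp : s.rreg 0 = p) (hperm : IsPerm n (s.warr 1))
    (hc : ∀ g < n, ∀ g' < n, s.rarr 3 (g * n + g') = c g g')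
    (hsymm : ∀ x y, O x y = O y x)
    (hO : ∀ l, k < l → l < n → O k l = O k (l - 1) + O (k + 1) l -
      (if k + 1 < l then O (k + 1) (l - 1) else 0) - p * c k (l - 1))
    (hk : k < n) (h18 : s.wreg 18 = k) (h19 : s.wreg 19 = k + 1)
    (h1 : ∀ x < n, ∀ y < n,
      s.rarr 1 (s.warr 1 x * n + s.warr 1 y) = partialMatrix O k (k + 1) x y) :
    Runs W (forUp 19 0 fillEntry) s fun s' t =>
      (∀ x < n, ∀ y < n, s'.rarr 1 (s.warr 1 x * n + s.warr 1 y) = partialMatrix O k n x y) ∧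
      t ≤ 120 * n := by
  have hnW : 4 * n + 4 ≤ W := le_trans (by nlinarith) hW
  have hrow : ∀ x < n, x * n ≤ W := fun x hx => by
    have := index_lt hW hx (show 0 < n by omega)
    omega
  refine Runs.forUp (fun l s₁ t => (∀ x < n, ∀ y < n,
      s₁.rarr 1 (s.warr 1 x * n + s.warr 1 y) = partialMatrix O k l x y) ∧
      t ≤ 100 * (l - (k + 1))) ?_ ?_ ?_ ?_ ?_
  · omega
  · omega
  · rw [h19]
    exact ⟨h1, by omega⟩
  · rintro l s₁ t hf hl hl' e1 e0 ⟨h2, ht⟩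
    have hkl : k + 1 ≤ l := by omega
    have hln : l < n := by omega
    have e0' : s₁.wreg 0 = n := e0.trans h0
    have e18 : s₁.wreg 18 = k := (hf.wreg 18 (by decide)).trans h18
    have a1 : s₁.warr 1 = s.warr 1 := hf.warr 1 (by decide)
    have r0 : s₁.rreg 0 = p := (hf.rreg 0 (by decide)).trans hp
    have c3 : s₁.rarr 3 = s.rarr 3 := hf.rarr 3 (by decide)
    have pk := hperm.1 k hk
    have pk' := hperm.1 (k + 1) (by omega)
    have pl := hperm.1 l hln
    have pl' := hperm.1 (l - 1) (by omega)
    simp only [fillEntry, block, runs_seq, runs_setR, runs_storeR, WExp.Fits, WExp.eval, WExp.cost,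
      RExp.Fits, RExp.eval, RExp.cost, e0', e18, e1, a1, r0, c3, Memory.setR_wreg, Memory.setR_warr,
      Memory.setR_rreg, Memory.setR_rarr, Memory.storeR_wreg, Memory.storeR_warr,
      Memory.storeR_rreg, Memory.storeR_rarr, Memory.setW_rarr, reduceIte, true_and, and_true,
      hrow _ pk, hrow _ pk', hrow _ pl, hrow k hk, index_lt hW pk pl, index_lt hW pk pl',
      index_lt hW pk' pl,
      index_lt hW pk' pl', index_lt hW pl pk, index_lt hW hk (show l - 1 < n by omega),
      h2 k hk (l - 1) (by omega), h2 (k + 1) (by omega) l hln,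
      h2 (k + 1) (by omega) (l - 1) (by omega), hc k hk (l - 1) (by omega), show 1 ≤ W by omega,
      show k + 1 ≤ W by omega]
    have v1 : partialMatrix O k l k (l - 1) = O k (l - 1) := if_pos (by omega)
    have v2 : partialMatrix O k l (k + 1) l = O (k + 1) l := if_pos (by omega)
    -- for `l = k + 1` this is the entry at `(k + 1, k)`, which has not been written yet
    have v3 : partialMatrix O k l (k + 1) (l - 1) = if k + 1 < l then O (k + 1) (l - 1) else 0 := by
      unfold partialMatrix
      split_ifs <;> first | rfl | omega
    rw [v1, v2, v3, ← hO l (by omega) hln]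
    refine ⟨fun x hx y hy => ?_, by omega⟩
    rw [update_index _ _ pk (hperm.1 y hy), update_index _ _ pl (hperm.1 y hy), h2 x hx y hy]
    have inj : ∀ x < n, ∀ y < n, s.warr 1 x = s.warr 1 y ↔ x = y := fun x hx y hy =>
      ⟨hperm.2 x hx y hy, fun e => by rw [e]⟩
    simp only [inj x hx l hln, inj y hy k hk, inj x hx k hk, inj y hy l hln]
    unfold partialMatrix
    -- the entries at `(k, l)` and `(l, k)` are the ones written in this round
    by_cases u1 : x = l ∧ y = k
    · rw [if_pos u1, if_pos (by omega), u1.1, u1.2, hsymm]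
    · rw [if_neg u1]
      by_cases u2 : x = k ∧ y = l
      · rw [if_pos u2, if_pos (by omega), u2.1, u2.2]
      · rw [if_neg u2]
        exact if_congr (by omega) rfl rfl
  · rintro s₁ t hf - ⟨h2, ht⟩
    rw [h0] at h2 ht
    refine ⟨h2, by omega⟩

theorem runs_fillMatrix {W n : ℕ} {p : ℝ} {O c : ℕ → ℕ → ℝ} {s : Memory} (h0 : s.wreg 0 = n)
    (hW : (n + 2) ^ 2 ≤ W) (hp : s.rreg 0 = p) (hperm : IsPerm n (s.warr 1))
    (hc : ∀ g < n, ∀ g' < n, s.rarr 3 (g * n + g') = c g g')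
    (hsymm : ∀ x y, O x y = O y x) (hself : ∀ x, O x x = 0)
    (hO : ∀ k l, k < l → l < n → O k l = O k (l - 1) + O (k + 1) l -
      (if k + 1 < l then O (k + 1) (l - 1) else 0) - p * c k (l - 1))
    (h1 : ∀ k, s.rarr 1 k = 0) :
    Runs W fillMatrix s fun s' t =>
      (∀ x < n, ∀ y < n, s'.rarr 1 (s.warr 1 x * n + s.warr 1 y) = O x y) ∧
      t ≤ 200 * (n + 1) ^ 2 := by
  have hnW : 4 * n + 4 ≤ W := le_trans (by nlinarith) hW
  simp only [fillMatrix, block, runs_seq, runs_setW, WExp.Fits, WExp.eval, WExp.cost, true_and]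
  refine ⟨Nat.zero_le _, Runs.forUp (fun i s₁ t => (∀ x < n, ∀ y < n,
      s₁.rarr 1 (s.warr 1 x * n + s.warr 1 y) =
        if n - i ≤ x ∧ n - i ≤ y then O x y else 0) ∧ t ≤ (120 * n + 30) * i) ?_ ?_ ?_ ?_ ?_⟩
  · simp [h0]; omega
  · simp
  · refine ⟨fun x hx y hy => ?_, by omega⟩
    rw [if_neg (by simp; omega)]
    exact h1 _
  · rintro i s₁ t hf - hi e1 e0 ⟨h2, ht⟩
    simp only [Memory.setW_wreg, OfNat.zero_ne_ofNat, reduceIte, h0] at hi e0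
    have a1 : s₁.warr 1 = s.warr 1 := (hf.warr 1 (by decide)).trans (by simp)
    have r0 : s₁.rreg 0 = p := (hf.rreg 0 (by decide)).trans (by simpa using hp)
    have c3 : s₁.rarr 3 = s.rarr 3 := (hf.rarr 3 (by decide)).trans (by simp)
    simp only [runs_seq, runs_setW, WExp.Fits, WExp.eval, WExp.cost, Memory.setW_wreg, reduceIte,
      Nat.reduceEqDiff, e1, e0, true_and, and_true]
    refine ⟨by omega, ⟨by omega, by omega⟩, ?_⟩
    refine (runs_fillRow (s := (s₁.setW 18 (n - 1 - i)).setW 19 (n - 1 - i + 1)) (k := n - 1 - i)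
      (p := p) (O := O) (c := c) (by simpa using e0) hW (by simpa using r0)
      (by simpa [a1] using hperm) (by simpa [c3] using hc) hsymm (fun l => hO _ l) (by omega)
      (by simp) (by simp) fun x hx y hy => ?_).mono ?_
    · simp only [Memory.setW_rarr, Memory.setW_warr, a1]
      rw [h2 x hx y hy]
      unfold partialMatrix
      by_cases u : n - 1 - i < min x y ∨ (min x y = n - 1 - i ∧ max x y < n - 1 - i + 1)
      · rw [if_pos u]
        by_cases v : n - i ≤ x ∧ n - i ≤ y
        · rw [if_pos v]
        · have : x = y := by omega
          rw [if_neg v, this, hself]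
      · rw [if_neg u, if_neg (by omega)]
    · rintro s₂ t₂ - ⟨h3, ht₂⟩
      simp only [Memory.setW_warr, a1] at h3
      refine ⟨fun x hx y hy => ?_, ?_⟩
      · rw [Memory.setW_rarr, h3 x hx y hy]
        exact if_congr (by omega) rfl rfl
      · rw [mul_add, mul_one]
        omega
  · rintro s₁ t hf - ⟨h2, ht⟩
    simp only [Memory.setW_wreg, OfNat.zero_ne_ofNat, reduceIte, h0] at h2 ht
    refine ⟨fun x hx y hy => ?_, ?_⟩
    · rw [h2 x hx y hy, if_pos (by omega)]
    · have : (120 * n + 30) * n + 8 ≤ 200 * (n + 1) ^ 2 := by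
        have e1 : (120 * n + 30) * n = 120 * (n * n) + 30 * n := by ring
        have e2 : (n + 1) ^ 2 = n * n + 2 * n + 1 := by ring
        omega
      omega

/-! ### The order distance as a sum over pairs of positions -/

section OrderDistance

variable {X : Type*} [Fintype X]

open Classical in
/-- For `q = p / 2`, the order distance counts the ordered pairs `(u, v)` for which exactly one of
`x` and `y` is nearer to `u` than to `v`. -/
theorem orderDistance_half [DecidableEq X] (p : ℝ) (D : X → X → ℝ) (x y : X) :
    orderDistance p (p / 2) D x y =
      ∑ u, ∑ v, p / 2 * if (D u x < D v x ↔ D u y < D v y) then 0 else 1 := by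
  unfold orderDistance
  rw [sub_self]
  simp only [zero_mul, Finset.sum_const_zero, add_zero]
  rw [← Finset.univ_product_univ, ← Finset.sum_product' Finset.univ Finset.univ fun u v =>
    p / 2 * if (D u x < D v x ↔ D u y < D v y) then (0 : ℝ) else 1]
  rw [Finset.univ_product_univ, Finset.sum_filter]
  refine Finset.sum_congr rfl fun w _ => ?_
  simp only [partsDist_pair, mem_closer]
  split_ifs with h1 h2 h2
  · rfl
  · rfl
  · simp
  · -- the pairs left out in the definition separate no elements
    exfalso
    refine h1 ⟨fun e => h2 (by simp [e]), ?_, ?_⟩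
    · rw [Finset.empty_ssubset]
      by_contra hne
      rw [Finset.not_nonempty_iff_eq_empty] at hne
      have hx := mem_closer D w.1 w.2 x
      have hy := mem_closer D w.1 w.2 y
      rw [hne] at hx hy
      exact h2 (hx.symm.trans ((iff_of_false (by simp) (by simp)).trans hy))
    · rw [Finset.ssubset_univ_iff]
      intro he
      have hx := mem_closer D w.1 w.2 x
      have hy := mem_closer D w.1 w.2 y
      rw [he] at hx hy
      exact h2 (hx.symm.trans ((iff_of_true (by simp) (by simp)).trans hy))

/-- A sum over all elements is a sum over any `n` consecutive positions on the cycle. -/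
theorem sum_cycle {n : ℕ} {φ : ℕ → X} (hmod : ∀ i, φ (i % n) = φ i)
    (hinj : ∀ i < n, ∀ j < n, φ i = φ j → i = j) (hsurj : ∀ u, ∃ i < n, φ i = u) (f : X → ℝ)
    (a : ℕ) : ∑ u, f u = ∑ i ∈ Finset.Ico a (a + n), f (φ i) := by
  have himg := Nat.image_Ico_mod a n
  symm
  refine Finset.sum_nbij φ (fun _ _ => Finset.mem_univ _) ?_ ?_ fun _ _ => rfl
  · intro i hi j hj hij
    have hinj' : Set.InjOn (· % n) (Finset.Ico a (a + n) : Set ℕ) :=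
      Finset.injOn_of_card_image_eq (by rw [himg]; simp)
    have hn : 0 < n := by
      have := Finset.mem_Ico.1 (Finset.mem_coe.1 hi)
      omega
    refine hinj' hi hj (hinj _ (Nat.mod_lt _ hn) _ (Nat.mod_lt _ hn) ?_)
    rw [hmod, hmod, hij]
  · intro u _
    obtain ⟨i, hi, rfl⟩ := hsurj u
    rw [← Finset.mem_range, ← himg, Finset.mem_image] at hi
    obtain ⟨j, hj, rfl⟩ := hi
    exact ⟨j, hj, (hmod j).symm⟩

/-- The ordered pairs of distinct elements are given by a position `i` and one of the `n - 1`
positions after it on the cycle. -/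
theorem sum_pairs_cycle {n : ℕ} {φ : ℕ → X} (hmod : ∀ i, φ (i % n) = φ i)
    (hinj : ∀ i < n, ∀ j < n, φ i = φ j → i = j) (hsurj : ∀ u, ∃ i < n, φ i = u)
    (f : X → X → ℝ) (hf : ∀ u, f u u = 0) :
    ∑ u, ∑ v, f u v =
      ∑ i ∈ Finset.range n, ∑ j ∈ Finset.Ico (i + 1) (i + n), f (φ i) (φ j) := by
  rw [sum_cycle hmod hinj hsurj _ 0, zero_add, ← Finset.range_eq_Ico]
  refine Finset.sum_congr rfl fun i hi => ?_
  rw [sum_cycle hmod hinj hsurj _ i, Finset.sum_eq_sum_Ico_succ_bot, hf, zero_add]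
  have := Finset.mem_range.1 hi
  omega

end OrderDistance

/-- The order distance in terms of positions. -/
noncomputable def positionDistance (n : ℕ) (δ : ℕ → ℕ → ℝ) (p : ℝ) (x y : ℕ) : ℝ :=
  ∑ i ∈ Finset.range n, ∑ j ∈ Finset.Ico (i + 1) (i + n), p / 2 * bisects δ i j x y

/-- The recursion for single bisectors is linear in the cut matrix and hence passes to the sum. -/
theorem CircularMetric.positionDistance_recursion {n k l : ℕ} {δ : ℕ → ℕ → ℝ}
    (h : CircularMetric n δ) (p : ℝ) (hkl : k < l) (hl : l < n) :
    positionDistance n δ p k l = positionDistance n δ p k (l - 1) +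
      positionDistance n δ p (k + 1) l -
      (if k + 1 < l then positionDistance n δ p (k + 1) (l - 1) else 0) -
      p * ∑ i ∈ Finset.range n, ∑ j ∈ Finset.Ico (i + 1) (i + n), cutWeight δ i j k (l - 1) := by
  have hif : (if k + 1 < l then positionDistance n δ p (k + 1) (l - 1) else 0) =
      ∑ i ∈ Finset.range n, ∑ j ∈ Finset.Ico (i + 1) (i + n),
        p / 2 * if k + 1 < l then bisects δ i j (k + 1) (l - 1) else 0 := by
    split_ifs
    · rfl
    · simp
  rw [hif]
  unfold positionDistance
  rw [Finset.mul_sum, ← Finset.sum_add_distrib, ← Finset.sum_sub_distrib, ← Finset.sum_sub_distrib]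
  refine Finset.sum_congr rfl fun i hi => ?_
  rw [Finset.mul_sum, ← Finset.sum_add_distrib, ← Finset.sum_sub_distrib, ← Finset.sum_sub_distrib]
  refine Finset.sum_congr rfl fun j hj => ?_
  rw [Finset.mem_Ico] at hj
  rw [h.bisects_recursion (Finset.mem_range.1 hi) (by omega) (by omega) hkl hl]
  ring

/-! ### The algorithm -/

/-- Compute the order distance: find a circular ordering, collect the cuts of all bisectors, and
sum them up. -/
def orderDistanceProgram : Prog := block [circularOrder, doubleOrder, collectCuts, fillMatrix]

theorem runs_orderDistanceProgram {W n K : ℕ} {d : ℕ → ℕ → ℝ} {p : ℝ} {s : Memory}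
    (hsymm : ∀ x y, d x y = d y x) (hself : ∀ x, d x x = 0)
    (htri : ∀ x y z, d x z ≤ d x y + d y z) (hs : HoldsInput n d s) (hn : 0 < n)
    (hW : (n + 2) ^ 2 ≤ W) (hK : n ≤ 2 ^ K) (hR : ∃ R, Valid (gromov d 0) (Finset.range n) R)
    (hp : s.rreg 0 = p) (h8 : s.wreg 8 = 0) (hbd : ∀ k, s.warr 2 k = 0)
    (hr1 : ∀ k, s.rarr 1 k = 0) (hr3 : ∀ k, s.rarr 3 k = 0) :
    Runs W orderDistanceProgram s fun s' t => (∃ e, IsPerm n e ∧ ∀ x < n, ∀ y < n,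
      s'.rarr 1 (e x * n + e y) =
        positionDistance n (fun i j => d (e (i % n)) (e (j % n))) p x y) ∧
      t ≤ (80 * K + 4000) * (n + 1) ^ 2 := by
  simp only [orderDistanceProgram, block, runs_seq]
  refine (runs_circularOrder hsymm hs hn hW hR h8 hbd).mono ?_
  rintro s₁ t₁ hf₁ ⟨hperm, hkal, ht₁⟩
  have hin₁ : HoldsInput n d s₁ := hs.frame hf₁
  refine (runs_doubleOrder hin₁.size hW).mono ?_
  rintro s₂ t₂ hf₂ ⟨hdbl, ht₂⟩
  have hin₂ : HoldsInput n d s₂ := hin₁.frame hf₂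
  have hδ := CircularMetric.of_kalmanson hn hsymm hself (fun x _ y _ z _ => htri x y z) hperm.1 hkal
  have hlt : ∀ x, s₁.warr 1 (x % n) < n := fun x => hperm.1 _ (Nat.mod_lt x hn)
  have hcyc : HoldsCycle n (fun i j => d (s₁.warr 1 (i % n)) (s₁.warr 1 (j % n))) s₂ :=
    ⟨hin₂.size, fun x hx => by rw [hdbl x hx]; exact hlt x,
      fun x hx y hy => by rw [hdbl x hx, hdbl y hy]; exact hin₂.matrix _ (hlt x) _ (hlt y)⟩
  have q3 : s₂.rarr 3 = s.rarr 3 := (hf₂.rarr 3 (by decide)).trans (hf₁.rarr 3 (by decide))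
  refine (runs_collectCuts hδ hcyc hW hK (by rw [q3]; exact hr3)).mono ?_
  rintro s₃ t₃ hf₃ ⟨hcut, ht₃⟩
  have q1 : s₃.rarr 1 = s.rarr 1 := (hf₃.rarr 1 (by decide)).trans
    ((hf₂.rarr 1 (by decide)).trans (hf₁.rarr 1 (by decide)))
  have qp : s₃.rreg 0 = p := (hf₃.rreg 0 (by decide)).trans
    ((hf₂.rreg 0 (by decide)).trans ((hf₁.rreg 0 (by decide)).trans hp))
  have qa : ∀ x < n, s₃.warr 1 x = s₁.warr 1 x := fun x hx => by
    rw [hf₃.warr 1 (by decide), hdbl x (by omega), Nat.mod_eq_of_lt hx]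
  have hperm₃ : IsPerm n (s₃.warr 1) :=
    ⟨fun x hx => by rw [qa x hx]; exact hperm.1 x hx,
      fun x hx y hy => by rw [qa x hx, qa y hy]; exact hperm.2 x hx y hy⟩
  refine (runs_fillMatrix (p := p)
    (O := positionDistance n (fun i j => d (s₁.warr 1 (i % n)) (s₁.warr 1 (j % n))) p)
    (c := fun g g' => ∑ i ∈ Finset.range n, ∑ j ∈ Finset.Ico (i + 1) (i + n),
      cutWeight (fun i j => d (s₁.warr 1 (i % n)) (s₁.warr 1 (j % n))) i j g g')
    (hcyc.frame hf₃).size hW qp hperm₃ hcut ?_ ?_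
    (fun k l hkl hl => hδ.positionDistance_recursion p hkl hl) (by rw [q1]; exact hr1)).mono ?_
  · intro x y
    exact Finset.sum_congr rfl fun i _ => Finset.sum_congr rfl fun j _ => by rw [bisects_symm]
  · intro x
    simp [positionDistance, bisects_self]
  rintro s₄ t₄ - ⟨hout, ht₄⟩
  refine ⟨⟨s₁.warr 1, hperm, fun x hx y hy => ?_⟩, ?_⟩
  · rw [← qa x hx, ← qa y hy]
    exact hout x hx y hy
  · have h1 : 20 * (n + 1) ≤ 20 * (n + 1) ^ 2 := by nlinarith
    have h2 : (80 * K + 4000) * (n + 1) ^ 2 = (80 * K + 400) * (n + 1) ^ 2 +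
      3600 * (n + 1) ^ 2 := by ring
    omega

theorem isBigO_time : (fun n : ℕ => (((80 * (Nat.log 2 n + 1) + 4000) * (n + 1) ^ 2 : ℕ) : ℝ))
    =O[atTop] fun n : ℕ => (n : ℝ) ^ 2 * Real.log (n : ℝ) := by
  refine IsBigO.of_bound 24960 ?_
  filter_upwards [eventually_ge_atTop 2] with n hn
  have hn' : (2 : ℝ) ≤ n := by exact_mod_cast hn
  have hlog2 : (2 / 3 : ℝ) ≤ Real.log 2 := by have := Real.log_two_gt_d9; linarith
  have hlog : Real.log 2 ≤ Real.log n := Real.log_le_log (by norm_num) hn'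
  have hnat : (Nat.log 2 n : ℝ) * Real.log 2 ≤ Real.log n := by
    rw [← Real.log_pow]
    refine Real.log_le_log (by positivity) ?_
    exact_mod_cast Nat.pow_log_le_self 2 (by omega)
  have hnat' : (Nat.log 2 n : ℝ) ≤ 3 / 2 * Real.log n := by
    have : (0 : ℝ) ≤ Nat.log 2 n := Nat.cast_nonneg _
    nlinarith
  have h1 : 80 * ((Nat.log 2 n : ℝ) + 1) + 4000 ≤ 6240 * Real.log n := by linarith
  have h2 : ((n : ℝ) + 1) ^ 2 ≤ 4 * (n : ℝ) ^ 2 := by nlinarith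
  rw [Real.norm_of_nonneg (Nat.cast_nonneg _), Real.norm_of_nonneg (by
    have : 0 ≤ Real.log n := by linarith
    positivity)]
  push_cast
  calc (80 * ((Nat.log 2 n : ℝ) + 1) + 4000) * ((n : ℝ) + 1) ^ 2
      ≤ (6240 * Real.log n) * (4 * (n : ℝ) ^ 2) :=
        mul_le_mul h1 h2 (by positivity) (by linarith)
    _ = 24960 * ((n : ℝ) ^ 2 * Real.log n) := by ring

end OrderDist

theorem mainTheorem9 :
    ∃ (P : OrderDist.Prog) (k : ℕ) (T : ℕ → ℕ),
      ((fun n : ℕ => (T n : ℝ)) =O[atTop] fun n : ℕ => (n : ℝ) ^ 2 * Real.log (n : ℝ)) ∧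
      ∀ (n : ℕ) (X : Type*) [Fintype X] [DecidableEq X] [Nonempty X] (enum : Fin n ≃ X)
        (D : X → X → ℝ) (p : ℝ), 0 < p → OrderDist.IsCircularDistance D →
        ∃ (s : OrderDist.Memory) (t : ℕ),
          OrderDist.Exec ((n + 2) ^ k) P
            (OrderDist.inputMemory n p fun i j => D (enum i) (enum j)) s t ∧
          t ≤ T n ∧
          OrderDist.HoldsOutput s
            (fun i j : Fin n => OrderDist.orderDistance p (p / 2) D (enum i) (enum j)) := by
  refine ⟨OrderDist.orderDistanceProgram, 2,
    fun n => (80 * (Nat.log 2 n + 1) + 4000) * (n + 1) ^ 2, OrderDist.isBigO_time, ?_⟩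
  intro n X _ _ hne enum D p _ hD
  have hn : 0 < n := by
    obtain ⟨x⟩ := hne
    exact (enum.symm x).pos
  -- number the elements by natural numbers, periodically
  let el : ℕ → X := fun i => enum ⟨i % n, Nat.mod_lt i hn⟩
  have hel : ∀ i : Fin n, el i = enum i := fun i =>
    congrArg enum (Fin.ext (Nat.mod_eq_of_lt i.2))
  have hinj : ∀ i < n, ∀ j < n, el i = el j → i = j := by
    intro i hi j hj hij
    have h1 := hel ⟨i, hi⟩
    have h2 := hel ⟨j, hj⟩
    simp only at h1 h2
    rw [h1, h2] at hij
    exact congrArg Fin.val (enum.injective hij)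
  obtain ⟨R, hR⟩ := hD.exists_valid (el 0)
  have hRn : OrderDist.Valid (OrderDist.gromov (fun i j => D (el i) (el j)) 0) (Finset.range n)
      (fun i j => R (el i) (el j)) := by
    refine ⟨fun x _ => hR.irrefl _ (Finset.mem_univ _), fun x _ y _ z _ =>
      hR.trans _ (Finset.mem_univ _) _ (Finset.mem_univ _) _ (Finset.mem_univ _),
      fun x hx y hy hxy => hR.total _ (Finset.mem_univ _) _ (Finset.mem_univ _) fun e =>
        hxy (hinj x (Finset.mem_range.1 hx) y (Finset.mem_range.1 hy) e),
      fun x _ y _ z _ =>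
        hR.rob _ (Finset.mem_univ _) _ (Finset.mem_univ _) _ (Finset.mem_univ _),
      fun x _ y _ z _ w _ => hR.kal _ (Finset.mem_univ _) _ (Finset.mem_univ _) _
        (Finset.mem_univ _) _ (Finset.mem_univ _)⟩
  have hin : OrderDist.HoldsInput n (fun i j => D (el i) (el j))
      (OrderDist.inputMemory n p fun i j => D (enum i) (enum j)) := by
    refine ⟨by simp [OrderDist.inputMemory], fun x hx y hy => ?_⟩
    have hdiv : (x * n + y) / n = x := by
      rw [mul_comm, Nat.mul_add_div hn, Nat.div_eq_of_lt hy, add_zero]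
    have hmod : (x * n + y) % n = y := by
      rw [mul_comm, Nat.mul_add_mod, Nat.mod_eq_of_lt hy]
    simp only [OrderDist.inputMemory, hdiv, hmod]
    rw [dif_pos ⟨trivial, hx, hy⟩]
    exact congrArg₂ D (hel ⟨x, hx⟩).symm (hel ⟨y, hy⟩).symm
  obtain ⟨s, t, hexec, ⟨e, he, hout⟩, ht⟩ := OrderDist.runs_orderDistanceProgram (p := p)
    (d := fun i j => D (el i) (el j))
    (K := Nat.log 2 n + 1) (fun x y => hD.1.symm _ _) (fun x => hD.1.self _)
    (fun x y z => hD.triangle _ _ _) hin hn le_rfl (Nat.lt_pow_succ_log_self (by norm_num) n).le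
    ⟨_, hRn⟩ (by simp [OrderDist.inputMemory]) (by simp [OrderDist.inputMemory])
    (by simp [OrderDist.inputMemory]) (by simp [OrderDist.inputMemory])
    (by simp [OrderDist.inputMemory])
  refine ⟨s, t, hexec, ht, fun i j => ?_⟩
  obtain ⟨x, hx, hxi⟩ := he.exists_eq i.2
  obtain ⟨y, hy, hyj⟩ := he.exists_eq j.2
  have hout' := hout x hx y hy
  rw [hxi, hyj] at hout'
  simp only
  rw [hout', OrderDist.orderDistance_half,
    OrderDist.sum_pairs_cycle (n := n) (φ := fun i => el (e (i % n))) (fun i => by simp) ?_ ?_ _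
      (fun u => by simp)]
  · unfold OrderDist.positionDistance OrderDist.bisects OrderDist.Nearer
    rw [← hel i, ← hel j, ← hxi, ← hyj]
    refine Finset.sum_congr rfl fun a _ => Finset.sum_congr rfl fun b _ => ?_
    simp only [Nat.mod_eq_of_lt hx, Nat.mod_eq_of_lt hy]
  · intro a ha b hb hab
    rw [Nat.mod_eq_of_lt ha, Nat.mod_eq_of_lt hb] at hab
    exact he.2 a ha b hb (hinj _ (he.1 a ha) _ (he.1 b hb) hab)
  · intro u
    obtain ⟨a, ha, hau⟩ := he.exists_eq (enum.symm u).2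
    refine ⟨a, ha, ?_⟩
    simp only [Nat.mod_eq_of_lt ha]
    rw [hau, hel, Equiv.apply_symm_apply]
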